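/- Let $H(x,y)=\frac12y^2-\frac12x^2+\frac14x^4$ and consider the perturbed system $$\dot x=H_y+\varepsilon f(x,y),\quad \dot y=-H_x+\varepsilon g(x,y),\qquad f=\sum_{i+j\le3}a_{ij}x^iy^j,\quad g=\sum_{i+j\le3}b_{ij}x^iy^j ,$$ with arbitrary real $a_{ij},b_{ij}$. For $h\in\Sigma=(-\frac14,0)$ let $\delta(h)$, $\delta^*(h)$ be the ovals of $\{H=h\}$ around the centers $C=(1,0)$, $C^*=(-1,0)$, and let $d(h,\varepsilon)$, $d^*(h,\varepsilon)$ be the displacement maps (first return map minus identity, with $H$ as parameter) on the sections $\{y=0,x>1\}$ and $\{y=0,x<-1\}$. Let $I_k(h)=\oint_{\delta(h)}x^ky\,dx$, where $\delta(h)$ is oriented by the Hamiltonian flow (so that $I_k>0$). Put $$\lambda=\tfrac12a_{11}+b_{02},\quad \mu=a_{21}+b_{12},\quad m=2(a_{00}\mu+a_{10}\lambda),$$ $$Q_1=-(a_{00}y+a_{10}xy+a_{20}x^2y+a_{30}x^3y+\tfrac13a_{02}y^3+\tfrac13a_{12}xy^3).$$ For every $h\in\Sigma$ the maps $d,d^*$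 are defined for all small $\varepsilon$ and have convergent expansions $d=\sum_{k\ge1}\varepsilon^kM_k(h)$, $d^*=\sum_{k\ge1}\varepsilon^kM^*_k(h)$. The functions $I_0,hI_0,I_1,hI_1,I_2,hI_2$ are linearly independent on $\Sigma$. Below, "vanish" means vanish identically on $\Sigma$, and the upper (lower) sign is for $M_k$ ($M_k^*$). (i) $(\alpha_0+\alpha_1h)I_0\pm\beta_0I_1+\gamma_0I_2$ is the value of $M_1$ ($M_1^*$), where $\alpha_0=a_{10}+b_{01}$, $\alpha_1=\frac47(a_{12}+3b_{03})$, $\beta_0=2a_{20}+b_{11}$, $\gamma_0=3a_{30}+b_{21}+\frac17(a_{12}+3b_{03})$. $M_1$ vanishes if and only if $M_1^*$ vanishes, if and only if $a_{10}+b_{01}=a_{12}+3b_{03}=2a_{20}+b_{11}=3a_{30}+b_{21}=0$. (ii) If $M_1,M_1^*$ vanish, then $M_2$ ($M_2^*$) equals $(\alpha_0+\alpha_1h)I_0\pm(\beta_0+\beta_1h)I_1+(\gamma_0+\gamma_1h)I_2$, where $\alpha_0=-2a_{00}\lambda$, $\alpha_1=-\frac87a_{02}\lambda-(\frac87a_{30}+\frac8{63}a_{12})\mu$,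 $\beta_0=-2(a_{10}+a_{30}+\frac18a_{12})\lambda-2(a_{00}+a_{20}+\frac18a_{02})\mu$, $\beta_1=-a_{12}\lambda-a_{02}\mu$, $\gamma_0=-2(a_{20}+\frac17a_{02})\lambda-2(a_{10}+\frac87a_{30}+\frac8{63}a_{12})\mu$, $\gamma_1=-\frac89a_{12}\mu$. $M_2$ vanishes if and only if $M_2^*$ vanishes, if and only if $\lambda=\mu=0$ or one of the following holds: (a) $Q_1=a_{00}(x^2-1)y$, $\lambda=0$; (b) $Q_1=a_{10}(x^3-x)y$, $\mu=0$; (c) $Q_1=a_{10}(x^2-x)y$, $\mu=\lambda$; (d) $Q_1=-a_{10}(x^2+x)y$, $\mu=-\lambda$; (e) $Q_1=0$, $\lambda\mu(\lambda^2-\mu^2)\ne0$. (iii) If $M_1,M_1^*,M_2,M_2^*$ vanish, then $M_3$ ($M_3^*$) equals $(\alpha_0+\alpha_1h)I_0\pm(\beta_0+\beta_1h)I_1+\gamma_0I_2$, where $\alpha_0=mb_{00}$, $\alpha_1=m(\frac47\lambda-\frac67a_{11})$, $\beta_0=m(b_{10}+b_{30}+\frac18\mu-\frac38a_{21})$, $\beta_1=m(\frac12\mu-\frac32a_{21})$,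 $\gamma_0=m(b_{20}+\frac17\lambda-\frac3{14}a_{11})$. If moreover $m\ne0$, then $M_3$ vanishes if and only if $M_3^*$ vanishes, if and only if $b_{00}=b_{20}=b_{10}+b_{30}=2\lambda-3a_{11}=\mu-3a_{21}=0$. (iv) If $M_k,M_k^*$ vanish for $k\le3$, then: $M_4=M_4^*=0$ if $\lambda=0$ or if $\lambda\mu(\lambda^2-\mu^2)\ne0$; $M_4=-M_4^*=6a_{10}^3\lambda(\frac14+h)I_1$ if $\mu=0$; $M_4=6a_{10}^3\lambda(I_1-I_2)$, $M_4^*=-6a_{10}^3\lambda(I_1+I_2)$ if $\mu=\lambda$; $M_4=6a_{10}^3\lambda(I_1+I_2)$, $M_4^*=-6a_{10}^3\lambda(I_1-I_2)$ if $\mu=-\lambda$. The coefficients are free: every choice of the 4, 6, 5 real coefficients in the forms (i), (ii), (iii) of $M_1$, $M_2$, $M_3$, and every real multiple of each of $(\frac14+h)I_1$, $I_1-I_2$, $I_1+I_2$ as $M_4$, is realized by some perturbation for which all the previous coefficients $M_j,M_j^*$ vanish (with $m\neq0$ in the case of $M_3$). (v) If $M_k,M_k^*$ vanish for $k\le4$,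 then the system is integrable near $C$ and near $C^*$: for all small $\varepsilon$ it has a center close to $C$ (resp. $C^*$) and a nonconstant analytic first integral in a neighbourhood of $C$ (resp. $C^*$) that does not depend on $\varepsilon$, and this neighbourhood may be taken arbitrarily small. Moreover the system is Hamiltonian (with Hamiltonian function $H-\varepsilon Q$, $Q$ a polynomial), or reversible in $y$ (invariant under $(x,y,t)\mapsto(x,-y,-t)$), or reversible in $x$ (invariant under $(x,y,t)\mapsto(-x,y,-t)$) and of the form $$\dot x=H_y+\varepsilon[a_{00}(1-x^2)+a_{01}y+a_{21}x^2y+a_{03}y^3],\quad \dot y=-H_x+\varepsilon[b_{10}(x-x^3)+2a_{00}xy+2a_{21}xy^2],\qquad a_{21}\ne0 .$$ In the last case $(\pm1,0)$ are centers for all small $\varepsilon$. With $\Delta=a_{21}^2-4a_{03}(b_{10}+1/\varepsilon)$, $A_{1,2}=\frac{\varepsilon(-a_{21}\pm\sqrt\Delta)}{2(1+\varepsilon b_{10})}$, $B=-\frac{2\varepsilon a_{00}}{1+\varepsilon b_{10}}$, $n_{1,2}=\bigl(1\pm\frac{3a_{21}}{\sqrt\Delta}\bigr)\frac{1+\varepsilon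 b_{10}}4$, $C_1=\frac{1+\varepsilon a_{01}+(n_1+n_2)(2A_1-B^2)}{2n_2(A_2-A_1)}$, $C_2=\frac{1+\varepsilon a_{01}+(n_1+n_2)(2A_2-B^2)}{2n_1(A_1-A_2)}$ and $P_j=x^2+A_jy^2+By+C_j$, on every bounded set and for all sufficiently small $\varepsilon>0$ (depending on the set) the following function is real-valued and a nonconstant analytic first integral: $P_1^{n_1}P_2^{n_2}$ if $a_{03}>0$, or if $a_{03}=0$ and $a_{21}>0$; $(-P_1)^{-n_1}P_2^{-n_2}$ if $a_{03}<0$; $(-P_1)^{n_1}(-P_2)^{n_2}$ if $a_{03}=0$ and $a_{21}<0$ (principal values of roots and powers). -/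

import Mathlib

open Set Filter Topology

noncomputable section

namespace EightLoop

/-- Coefficients of a cubic perturbation: only `a i j`, `b i j` with `i + j ≤ 3` are used. -/
structure CubicPerturbation where
  a : ℕ → ℕ → ℝ
  b : ℕ → ℕ → ℝ

namespace CubicPerturbation

/-- `f(x,y) = ∑_{i+j ≤ 3} a_ij x^i y^j`. -/
def f (p : CubicPerturbation) (x y : ℝ) : ℝ :=
  ∑ i ∈ Finset.range 4, ∑ j ∈ Finset.range (4 - i), p.a i j * x ^ i * y ^ j

/-- `g(x,y) = ∑_{i+j ≤ 3} b_ij x^i y^j`. -/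
def g (p : CubicPerturbation) (x y : ℝ) : ℝ :=
  ∑ i ∈ Finset.range 4, ∑ j ∈ Finset.range (4 - i), p.b i j * x ^ i * y ^ j

/-- The perturbed vector field `(H_y + ε f, -H_x + ε g)`, where
`H = y²/2 - x²/2 + x⁴/4`, so that `H_y = y` and `-H_x = x - x³`. -/
def field (p : CubicPerturbation) (ε : ℝ) (z : ℝ × ℝ) : ℝ × ℝ :=
  (z.2 + ε * p.f z.1 z.2, (z.1 - z.1 ^ 3) + ε * p.g z.1 z.2)

/-- `λ = a₁₁/2 + b₀₂`. -/
def lam (p : CubicPerturbation) : ℝ := p.a 1 1 / 2 + p.b 0 2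

/-- `μ = a₂₁ + b₁₂`. -/
def mu (p : CubicPerturbation) : ℝ := p.a 2 1 + p.b 1 2

/-- `m = 2 (a₀₀ μ + a₁₀ λ)`. -/
def m (p : CubicPerturbation) : ℝ := 2 * (p.a 0 0 * p.mu + p.a 1 0 * p.lam)

/-- The polynomial `Q₁`. -/
def Q1 (p : CubicPerturbation) (x y : ℝ) : ℝ :=
  -(p.a 0 0 * y + p.a 1 0 * x * y + p.a 2 0 * x ^ 2 * y + p.a 3 0 * x ^ 3 * y
    + 1 / 3 * p.a 0 2 * y ^ 3 + 1 / 3 * p.a 1 2 * x * y ^ 3)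

end CubicPerturbation

/-- `Σ = (-1/4, 0)`. -/
def Sig : Set ℝ := Ioo (-(1 / 4)) 0

/-- The oval `δ(h) ⊂ {H = h, x > 0}`, `h ∈ Σ`, meets the `x`-axis in `xL h < 1 < xR h`. -/
def xL (h : ℝ) : ℝ := √(1 - √(1 + 4 * h))

/-- The right end of the oval `δ(h)`; one has `H(xR h, 0) = h`. -/
def xR (h : ℝ) : ℝ := √(1 + √(1 + 4 * h))

/-- The upper half of `δ(h)` is the graph of `ovalY h` over `[xL h, xR h]`, the lower half is
the graph of `- ovalY h`. -/
def ovalY (h x : ℝ) : ℝ := √(2 * h + x ^ 2 - x ^ 4 / 2)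

/-- The line integral `∮_{δ(h)} P(x,y) dx`, with `δ(h)` oriented by the Hamiltonian flow (the upper
half from left to right, the lower half from right to left). -/
def ovalIntegral (P : ℝ → ℝ → ℝ) (h : ℝ) : ℝ :=
  ∫ x in (xL h)..(xR h), (P x (ovalY h x) - P x (-ovalY h x))

/-- `I_k(h) = ∮_{δ(h)} x^k y dx`. -/
def I (k : ℕ) (h : ℝ) : ℝ := ovalIntegral (fun x y => x ^ k * y) h

/-- The point with energy `h` on the section `{y = 0, s x > 1}`, for `s = 1` (annulus around
`C = (1,0)`) or `s = -1` (annulus around `C* = (-1,0)`). -/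
def sectionPoint (s h : ℝ) : ℝ × ℝ := (s * xR h, 0)

/-- The trajectory of the perturbed system that starts at the point with energy `h` of the section
`{y = 0, s x > 1}` comes back to the section for the first time at the point with energy `h'`. -/
def IsFirstReturn (p : CubicPerturbation) (s ε h h' : ℝ) : Prop :=
  -(1 / 4) < h' ∧ ∃ T : ℝ, 0 < T ∧ ∃ γ : ℝ → ℝ × ℝ,
    γ 0 = sectionPoint s h ∧
    (∀ t ∈ Icc 0 T, HasDerivWithinAt γ (p.field ε (γ t)) (Icc 0 T) t) ∧
    (∀ t ∈ Ioo 0 T, ¬ ((γ t).2 = 0 ∧ 1 < s * (γ t).1)) ∧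
    γ T = sectionPoint s h'

open Classical in
/-- The displacement map `d(h, ε)` (first return map minus identity), in the energy parameter `h`. -/
def displacement (p : CubicPerturbation) (s h ε : ℝ) : ℝ :=
  if hr : ∃ h', IsFirstReturn p s ε h h' then hr.choose - h else 0

/-- The coefficient of `ε^k` in the expansion of the displacement map. -/
def melnikov (p : CubicPerturbation) (s : ℝ) (k : ℕ) (h : ℝ) : ℝ :=
  iteratedDeriv k (fun ε => displacement p s h ε) 0 / (k.factorial : ℝ)

/-- `M_k(h)`, for the annulus around `C = (1,0)`. -/
def M (p : CubicPerturbation) (k : ℕ) (h : ℝ) : ℝ := melnikov p 1 k h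

/-- `M_k^*(h)`, for the annulus around `C* = (-1,0)`. -/
def Mstar (p : CubicPerturbation) (k : ℕ) (h : ℝ) : ℝ := melnikov p (-1) k h

/-- The `k`-th coefficients of both displacement maps vanish identically on `Σ`. -/
def Vanish (p : CubicPerturbation) (k : ℕ) : Prop :=
  (∀ h ∈ Sig, M p k h = 0) ∧ (∀ h ∈ Sig, Mstar p k h = 0)

/-- The conditions, on top of `M₁ = 0`, for `M₂` to vanish: the trivial one `λ = μ = 0` and the five
other ones. -/
def M2Condition (p : CubicPerturbation) : Prop :=
  (p.lam = 0 ∧ p.mu = 0) ∨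
  ((∀ x y, p.Q1 x y = p.a 0 0 * (x ^ 2 - 1) * y) ∧ p.lam = 0) ∨
  ((∀ x y, p.Q1 x y = p.a 1 0 * (x ^ 3 - x) * y) ∧ p.mu = 0) ∨
  ((∀ x y, p.Q1 x y = p.a 1 0 * (x ^ 2 - x) * y) ∧ p.mu = p.lam) ∨
  ((∀ x y, p.Q1 x y = -p.a 1 0 * (x ^ 2 + x) * y) ∧ p.mu = -p.lam) ∨
  ((∀ x y, p.Q1 x y = 0) ∧ p.lam * p.mu * (p.lam ^ 2 - p.mu ^ 2) ≠ 0)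

/-- `c` is a center of `X`: an equilibrium with a neighbourhood all of whose other points lie on
(nonconstant) periodic orbits, contained in an arbitrarily small neighbourhood of `c`. -/
def IsCenter (X : ℝ × ℝ → ℝ × ℝ) (c : ℝ × ℝ) : Prop :=
  X c = 0 ∧ ∀ V ∈ 𝓝 c, ∃ U ∈ 𝓝 c, ∀ z ∈ U, z ≠ c →
    X z ≠ 0 ∧ ∃ γ : ℝ → ℝ × ℝ, ∃ T : ℝ, 0 < T ∧ γ 0 = z ∧
      (∀ t, HasDerivAt γ (X (γ t)) t) ∧ (∀ t, γ (t + T) = γ t) ∧ (∀ t, γ t ∈ V)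

/-- `F` is an analytic first integral of `X` on `K`, not constant on any nonempty open part
of `K`. -/
def IsAnalyticFirstIntegral (X : ℝ × ℝ → ℝ × ℝ) (K : Set (ℝ × ℝ)) (F : ℝ × ℝ → ℝ) : Prop :=
  AnalyticOnNhd ℝ F K ∧ (∀ z ∈ K, fderiv ℝ F z (X z) = 0) ∧
    ∀ W : Set (ℝ × ℝ), IsOpen W → W.Nonempty → W ⊆ K → ∃ z ∈ W, ∃ w ∈ W, F z ≠ F w

/-- Near `c₀` the perturbed system is integrable for all small `ε`: it has a center close to `c₀`
and an analytic first integral on a neighbourhood of `c₀` that does not shrink with `ε`. -/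
def IsIntegrableNear (p : CubicPerturbation) (c₀ : ℝ × ℝ) : Prop :=
  ∀ V ∈ 𝓝 c₀, ∃ U ∈ 𝓝 c₀, U ⊆ V ∧ ∀ᶠ ε in 𝓝 (0 : ℝ),
    (∃ c ∈ U, IsCenter (p.field ε) c) ∧ ∃ F, IsAnalyticFirstIntegral (p.field ε) U F

/-- The Hamiltonian stratum: `f = -Q_y`, `g = Q_x` for a polynomial `Q`, that is, the perturbed
system is Hamiltonian with Hamiltonian function `H - ε Q`. -/
def IsHamiltonian (p : CubicPerturbation) : Prop :=
  ∃ Q : MvPolynomial (Fin 2) ℝ, ∀ x y : ℝ,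
    p.f x y = -MvPolynomial.eval ![x, y] (MvPolynomial.pderiv 1 Q) ∧
    p.g x y = MvPolynomial.eval ![x, y] (MvPolynomial.pderiv 0 Q)

/-- Reversible in `y`: the system is invariant under `(x, y, t) ↦ (x, -y, -t)`. -/
def IsReversibleInY (p : CubicPerturbation) : Prop :=
  ∀ ε x y : ℝ, p.field ε (x, -y) = (-(p.field ε (x, y)).1, (p.field ε (x, y)).2)

/-- Reversible in `x`: the system is invariant under `(x, y, t) ↦ (-x, y, -t)`. -/
def IsReversibleInX (p : CubicPerturbation) : Prop :=
  ∀ ε x y : ℝ, p.field ε (-x, y) = ((p.field ε (x, y)).1, -(p.field ε (x, y)).2)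

/-! The Darboux first integral. The index `σ = 1` (resp. `σ = -1`) stands for the subscript `1`
(resp. `2`) of the two factors. -/

/-- `√Δ`, `Δ = a₂₁² - 4 a₀₃ (b₁₀ + 1/ε)`, with the root `i √(-Δ)` for `Δ < 0`. -/
def darbouxSqrt (p : CubicPerturbation) (ε : ℝ) : ℂ :=
  (((p.a 2 1) ^ 2 - 4 * p.a 0 3 * (p.b 1 0 + 1 / ε) : ℝ) : ℂ) ^ (1 / 2 : ℂ)

/-- The coefficients `A_{1,2}` of `y²`. -/
def darbouxA (p : CubicPerturbation) (ε σ : ℝ) : ℂ :=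
  ε * (-p.a 2 1 + σ * darbouxSqrt p ε) / (2 * (1 + ε * p.b 1 0))

/-- The coefficient `B₁ = B₂` of `y`. -/
def darbouxB (p : CubicPerturbation) (ε : ℝ) : ℂ :=
  -(2 * ε * p.a 0 0) / (1 + ε * p.b 1 0)

/-- The exponents `n_{1,2}`. -/
def darbouxN (p : CubicPerturbation) (ε σ : ℝ) : ℂ :=
  (1 + σ * (3 * p.a 2 1 / darbouxSqrt p ε)) * ((1 + ε * p.b 1 0) / 4)

/-- The constant terms `C_{1,2}`. -/
def darbouxC (p : CubicPerturbation) (ε σ : ℝ) : ℂ :=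
  (1 + ε * p.a 0 1 + (darbouxN p ε 1 + darbouxN p ε (-1)) *
      (2 * darbouxA p ε σ - darbouxB p ε ^ 2)) /
    (2 * darbouxN p ε (-σ) * (darbouxA p ε (-σ) - darbouxA p ε σ))

/-- The factors `x² + A y² + B y + C`. -/
def darbouxP (p : CubicPerturbation) (ε σ : ℝ) (z : ℝ × ℝ) : ℂ :=
  (z.1 : ℂ) ^ 2 + darbouxA p ε σ * (z.2 : ℂ) ^ 2 + darbouxB p ε * z.2 + darbouxC p ε σ

open Classical in
/-- The Darboux first integral `P₁^{n₁} P₂^{n₂}`; where a factor is negative its sign is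
changed. -/
def darboux (p : CubicPerturbation) (ε : ℝ) (z : ℝ × ℝ) : ℂ :=
  if 0 < p.a 0 3 ∨ (p.a 0 3 = 0 ∧ 0 < p.a 2 1) then
    darbouxP p ε 1 z ^ darbouxN p ε 1 * darbouxP p ε (-1) z ^ darbouxN p ε (-1)
  else if p.a 0 3 < 0 then
    (-darbouxP p ε 1 z) ^ (-darbouxN p ε 1) * darbouxP p ε (-1) z ^ (-darbouxN p ε (-1))
  else
    (-darbouxP p ε 1 z) ^ darbouxN p ε 1 * (-darbouxP p ε (-1) z) ^ darbouxN p ε (-1)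

end EightLoop

end

noncomputable section

namespace EightLoop

/-! Along an orbit of the perturbed system dH = εω with ω = g dx − f dy, so the displacement is an
integral of ω. Its analyticity in ε comes from the coordinates x² = 1 + 2r cos θ, y = −√2 r sin θ,
in which H = r² − 1/4: an orbit is a graph r(θ) whose integral equation is solved in C([0, 2π]) by
the analytic implicit function theorem (`exists_radius`, `exists_orbit`).

The coefficients come from the recursion q₀ = 1, q_i ω = dQ_i + q_{i+1} dH. The function H − Σ
ε^{i+1} Q_i then changes along an orbit by ε^{k+1} ∫ q_k ω, so the coefficients up to order k vanish
and M_{k+1} = ∮ q_k ω (`melnikov_of_chain`). On a level y² is a function of x, so a form p(x, y) dx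
with p even in y integrates to zero, and odd forms reduce to I₀, I₁, I₂ modulo the differentials of
x^i y³ (`melnikov_value`).

If M₁ = 0, then q₁ = −2(λx + μx²/2) and M₂ is the integral of 2(λ + μx) Q₁ dx. Unless λ = μ = 0, the
vanishing of M₂ means that Q₁ = c(x) y with 2(λ + μx) c(x) = m(x³ − x). The form 2(λ + μx) c y dx is
then m(y dH − y² dy), so the recursion continues (`isStep_Q2`, `isStep_Q3`), and M₄ reduces to m ∮ c
c' y dx. The formulas turn into conditions on the coefficients by the linear independence of the six
functions, read off from their expansions at r = 0 (`linearIndependent_I`). The central symmetry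
exchanges the annuli and gives the starred formulas (`Mstar_eq`).

When four orders vanish, only three strata remain (`strata_of_vanish`). In each of them there is a
function G with dG = κ(ẋ dy − ẏ dx), κ > 0, on a neighbourhood of (1, 0) independent of ε
(`HasLocalIntegral`): H − εQ in the Hamiltonian case; the value of y² transported to x = 1 when the
system is reversible in y; the Darboux function when it is reversible in x. Level curves of G around
the equilibrium are closed, so it is a center (`isCenter_of_integral`). -/

/-! ### Analytic implicit functions, square roots of functions, changes of time -/

/-- The implicit function theorem in Banach spaces, in the analytic category, for an equation whose
partial derivative in the unknown is the identity. -/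
theorem exists_analytic_implicit {X E : Type*} [NormedAddCommGroup X] [NormedSpace ℝ X]
    [CompleteSpace X] [NormedAddCommGroup E] [NormedSpace ℝ E] [CompleteSpace E]
    {Φ : X × E → E} {x₀ : X} {u₀ : E} (hΦ : AnalyticAt ℝ Φ (x₀, u₀)) (h0 : Φ (x₀, u₀) = 0)
    (hd : ∀ v, fderiv ℝ Φ (x₀, u₀) (0, v) = v) :
    ∃ ψ : X → E, AnalyticAt ℝ ψ x₀ ∧ ψ x₀ = u₀ ∧
      (∀ᶠ z in 𝓝 (x₀, u₀), Φ z = 0 ↔ ψ z.1 = z.2) ∧ ∀ᶠ x in 𝓝 x₀, Φ (x, ψ x) = 0 := by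
  set D := fderiv ℝ Φ (x₀, u₀) with hD
  have hsplit : ∀ a b, D (a, b) = D (a, 0) + b := fun a b => by
    rw [show (a, b) = (a, (0 : E)) + (0, b) by simp, map_add, hd]
  -- `A` is the derivative of `(x, u) ↦ (x, Φ (x, u))`. It is triangular with identity diagonal, so
  -- its inverse `B` is explicit.
  let A : X × E →L[ℝ] X × E := (ContinuousLinearMap.fst ℝ X E).prod D
  let B : X × E →L[ℝ] X × E := (ContinuousLinearMap.fst ℝ X E).prod
    (ContinuousLinearMap.snd ℝ X E - D.comp ((ContinuousLinearMap.fst ℝ X E).prod 0))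
  let i : (X × E) ≃L[ℝ] (X × E) := ContinuousLinearEquiv.equivOfInverse A B
    (by rintro ⟨a, b⟩
        refine Prod.ext rfl ?_
        change D (a, b) - D (a, 0) = b
        rw [hsplit]; abel)
    (by rintro ⟨a, b⟩
        refine Prod.ext rfl ?_
        change D (a, b - D (a, 0)) = b
        rw [hsplit]; abel)
  let G : X × E → X × E := fun z => (z.1, Φ z)
  have hGa : AnalyticAt ℝ G (x₀, u₀) := analyticAt_fst.prod hΦ
  have hG : HasStrictFDerivAt G (i : X × E →L[ℝ] X × E) (x₀, u₀) :=
    hasStrictFDerivAt_fst.prodMk hΦ.hasStrictFDerivAt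
  let e := hG.toOpenPartialHomeomorph G
  have hmem : (x₀, u₀) ∈ e.source := hG.mem_toOpenPartialHomeomorph_source
  have he : ∀ z, e z = G z := fun z => rfl
  have hG0 : G (x₀, u₀) = (x₀, 0) := by simp [G, h0]
  have hsymm : AnalyticAt ℝ e.symm (x₀, 0) := by
    have := e.analyticAt_symm' (i := i) hmem hGa hG.hasFDerivAt.fderiv
    rwa [he, hG0] at this
  have hs0 : e.symm (x₀, 0) = (x₀, u₀) := by
    rw [← hG0, ← he, e.left_inv hmem]
  let ψ : X → E := fun x => (e.symm (x, 0)).2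
  have hψ0 : ψ x₀ = u₀ := by simp [ψ, hs0]
  have hψa : AnalyticAt ℝ ψ x₀ := by
    have h1 : AnalyticAt ℝ (fun x : X => (x, (0 : E))) x₀ := analyticAt_id.prod analyticAt_const
    exact (analyticAt_snd).comp (hsymm.comp_of_eq h1 rfl)
  refine ⟨ψ, hψa, hψ0, ?_, ?_⟩
  · have hsrc : ∀ᶠ z in 𝓝 (x₀, u₀), z ∈ e.source := e.open_source.mem_nhds hmem
    have htgt : ∀ᶠ z : X × E in 𝓝 (x₀, u₀), (z.1, (0 : E)) ∈ e.target := by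
      have hc : Tendsto (fun z : X × E => (z.1, (0 : E))) (𝓝 (x₀, u₀)) (𝓝 (x₀, 0)) :=
        (continuous_fst.prodMk continuous_const).tendsto' _ _ rfl
      refine hc (e.open_target.mem_nhds ?_)
      rw [← hG0, ← he]; exact e.map_source hmem
    filter_upwards [hsrc, htgt] with z hz ht
    constructor
    · intro h
      have : e z = (z.1, 0) := by rw [he]; simp [G, h]
      simp only [ψ, ← this, e.left_inv hz]
    · intro h
      have h1 : G (e.symm (z.1, 0)) = (z.1, 0) := e.right_inv ht
      have h2 : (e.symm (z.1, 0)).1 = z.1 := by simpa [G] using congrArg Prod.fst h1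
      have h3 : e.symm (z.1, 0) = z := Prod.ext h2 h
      rw [h3] at h1
      exact congrArg Prod.snd h1
  · have htgt : ∀ᶠ x in 𝓝 x₀, (x, (0 : E)) ∈ e.target := by
      have hc : Tendsto (fun x : X => (x, (0 : E))) (𝓝 x₀) (𝓝 (x₀, 0)) :=
        (continuous_id.prodMk continuous_const).tendsto' _ _ rfl
      refine hc (e.open_target.mem_nhds ?_)
      rw [← hG0, ← he]; exact e.map_source hmem
    filter_upwards [htgt] with x ht
    have h1 : G (e.symm (x, 0)) = (x, 0) := e.right_inv ht
    have h2 : (e.symm (x, 0)).1 = x := congrArg Prod.fst h1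
    have h3 : e.symm (x, 0) = (x, ψ x) := Prod.ext h2 rfl
    rw [h3] at h1
    exact congrArg Prod.snd h1

section ContinuousFunctions

variable {K : Type*} [TopologicalSpace K]

/-- The pointwise square root of a continuous function. -/
def sqrtC (w : C(K, ℝ)) : C(K, ℝ) := ⟨fun t => √(w t), by fun_prop⟩

@[simp] theorem sqrtC_apply (w : C(K, ℝ)) (t : K) : sqrtC w t = √(w t) := rfl

theorem isUnit_of_pos {w : C(K, ℝ)} (hw : ∀ t, 0 < w t) : IsUnit w := by
  rw [ContinuousMap.isUnit_iff_forall_ne_zero]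
  exact fun t => (hw t).ne'

/-- Compactness makes pointwise positivity an open condition on continuous functions. -/
theorem eventually_pos [CompactSpace K] {w₀ : C(K, ℝ)} (hw : ∀ t, 0 < w₀ t) : ∀ᶠ w in 𝓝 w₀, ∀ t, 0 < w t := by
  have : {w : C(K, ℝ) | MapsTo w univ (Ioi 0)} ∈ 𝓝 w₀ :=
    (ContinuousMap.isOpen_setOfPred_mapsTo isCompact_univ isOpen_Ioi).mem_nhds fun t _ => hw t
  filter_upwards [this] with w hw t using hw (mem_univ t)

/-- Taking square roots is analytic at positive functions. -/
theorem analyticAt_sqrtC [CompactSpace K] {w₀ : C(K, ℝ)} (hw : ∀ t, 0 < w₀ t) : AnalyticAt ℝ sqrtC w₀ := by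
  let v₀ := sqrtC w₀
  have hv : ∀ t, 0 < v₀ t := fun t => Real.sqrt_pos.2 (hw t)
  have hvv : v₀ * v₀ = w₀ := by ext t; exact Real.mul_self_sqrt (hw t).le
  -- The factor `c = (2 v₀)⁻¹` normalises the derivative of `v ↦ v² − w` at `v₀` to the identity.
  obtain ⟨c, hc⟩ : ∃ c : C(K, ℝ), c * (v₀ + v₀) = 1 := by
    obtain ⟨u, hu⟩ := isUnit_of_pos (w := v₀ + v₀) (fun t => add_pos (hv t) (hv t))
    exact ⟨((u⁻¹ : C(K, ℝ)ˣ) : C(K, ℝ)), by rw [← hu]; simp⟩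
  let Φ : C(K, ℝ) × C(K, ℝ) → C(K, ℝ) := fun z => c * (z.2 * z.2 - z.1)
  have hΦ : AnalyticAt ℝ Φ (w₀, v₀) :=
    analyticAt_const.mul ((analyticAt_snd.mul analyticAt_snd).sub analyticAt_fst)
  obtain ⟨ψ, h1, h2, h3, h4⟩ := exists_analytic_implicit (Φ := Φ) hΦ (by simp [Φ, hvv]) (by
    intro v
    have hs : HasFDerivAt (Prod.snd : C(K, ℝ) × C(K, ℝ) → C(K, ℝ)) _ (w₀, v₀) :=
      hasFDerivAt_snd (𝕜 := ℝ)
    have hf : HasFDerivAt (Prod.fst : C(K, ℝ) × C(K, ℝ) → C(K, ℝ)) _ (w₀, v₀) :=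
      hasFDerivAt_fst (𝕜 := ℝ)
    have hd : HasFDerivAt Φ _ (w₀, v₀) := ((hs.mul hs).sub hf).const_mul c
    rw [hd.fderiv]
    have : c * (v₀ * v + v₀ * v) = v := by
      rw [show c * (v₀ * v + v₀ * v) = c * (v₀ + v₀) * v by ring, hc, one_mul]
    simpa using this)
  refine h1.congr ?_
  -- The implicit solution only satisfies `ψ² = w`; staying close to the positive `v₀`, it is the
  -- positive root.
  have hψpos : ∀ᶠ w in 𝓝 w₀, ∀ t, 0 < ψ w t := by
    have := h1.continuousAt.eventually (eventually_pos (w₀ := ψ w₀) (by rw [h2]; exact hv))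
    exact this
  filter_upwards [h4, hψpos] with w hw1 hw2
  have h5 : ψ w * ψ w = w := by
    have : (v₀ + v₀) * (c * (ψ w * ψ w - w)) = 0 := by
      have h6 : c * (ψ w * ψ w - w) = 0 := hw1
      rw [h6, mul_zero]
    rw [← mul_assoc, mul_comm (v₀ + v₀), hc, one_mul] at this
    exact sub_eq_zero.1 this
  ext t
  have h6 : ψ w t * ψ w t = w t := by
    conv_rhs => rw [← h5]
    rfl
  rw [sqrtC_apply, ← h6, Real.sqrt_mul_self (hw2 t).le]

end ContinuousFunctions

/-- The operator `u ↦ (t ↦ ∫_0^t u)` on `C([0,a])`. -/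
def volterra (a : ℝ) (ha : 0 ≤ a) : C(Icc (0 : ℝ) a, ℝ) →L[ℝ] C(Icc (0 : ℝ) a, ℝ) :=
  LinearMap.mkContinuous
    { toFun := fun u => ⟨fun t => ∫ s in (0 : ℝ)..t, u (projIcc 0 a ha s), by
        have h : Continuous fun s => u (projIcc 0 a ha s) := by fun_prop
        exact (intervalIntegral.continuous_primitive (fun _ _ => h.intervalIntegrable _ _) 0).comp
          continuous_subtype_val⟩
      map_add' := fun u v => by
        ext t
        have h : ∀ u : C(Icc (0 : ℝ) a, ℝ), Continuous fun s => u (projIcc 0 a ha s) :=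
          fun u => by fun_prop
        exact intervalIntegral.integral_add ((h u).intervalIntegrable _ _)
          ((h v).intervalIntegrable _ _)
      map_smul' := fun c u => by
        ext t
        exact intervalIntegral.integral_const_mul c _ }
    a (fun u => by
      refine (ContinuousMap.norm_le _ (by positivity)).2 fun t => ?_
      refine (intervalIntegral.norm_integral_le_of_norm_le_const
        (C := ‖u‖) fun s _ => u.norm_coe_le_norm _).trans ?_
      rw [sub_zero, abs_of_nonneg t.2.1, mul_comm]
      exact mul_le_mul_of_nonneg_right t.2.2 (norm_nonneg _))

/-- A change of time: the scalar equation `θ' = w(θ)`, with `w` continuous, positive and bounded,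
has a global solution, which is an increasing bijection of the line. -/
theorem exists_time_change {w : ℝ → ℝ} (hw : Continuous w) (hpos : ∀ s, 0 < w s) {C : ℝ}
    (hC : ∀ s, w s ≤ C) :
    ∃ e : ℝ ≃o ℝ, (∀ t, HasDerivAt e (w (e t)) t) ∧
      ∀ s, e.symm s = ∫ r in (0 : ℝ)..s, (w r)⁻¹ := by
  have hC0 : 0 < C := (hpos 0).trans_le (hC 0)
  have hwi : Continuous fun s => (w s)⁻¹ := hw.inv₀ fun s => (hpos s).ne'
  let τ : ℝ → ℝ := fun s => ∫ r in (0 : ℝ)..s, (w r)⁻¹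
  have hτ : ∀ s, HasDerivAt τ (w s)⁻¹ s := fun s =>
    intervalIntegral.integral_hasDerivAt_right (hwi.intervalIntegrable _ _)
      (hwi.stronglyMeasurableAtFilter _ _) hwi.continuousAt
  have hmono : StrictMono τ := strictMono_of_hasDerivAt_pos hτ fun s => inv_pos.2 (hpos s)
  have hcont : Continuous τ := continuous_iff_continuousAt.2 fun s => (hτ s).continuousAt
  have hτ0 : τ 0 = 0 := intervalIntegral.integral_same
  -- The bound on `w` makes the travel time grow at least linearly, hence `τ` is onto.
  have hgrow : Monotone fun s => τ s - C⁻¹ * s := by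
    refine monotone_of_hasDerivAt_nonneg (f' := fun s => (w s)⁻¹ - C⁻¹ * 1)
      (fun s => (hτ s).sub ((hasDerivAt_id s).const_mul _)) fun s => ?_
    have := inv_anti₀ (hpos s) (hC s)
    simpa using this
  have htop : Tendsto τ atTop atTop := by
    refine tendsto_atTop_mono' _ ?_ (tendsto_id.const_mul_atTop (inv_pos.2 hC0))
    filter_upwards [eventually_ge_atTop 0] with s hs
    have := hgrow hs
    simp only [hτ0, mul_zero, sub_zero] at this
    simpa using this
  have hbot : Tendsto τ atBot atBot := by
    refine tendsto_atBot_mono' _ ?_ (tendsto_id.const_mul_atBot (inv_pos.2 hC0))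
    filter_upwards [eventually_le_atBot 0] with s hs
    have := hgrow hs
    simp only [hτ0, mul_zero, sub_zero] at this
    simpa using this
  let e := hmono.orderIsoOfSurjective τ (hcont.surjective htop hbot)
  refine ⟨e.symm, fun t => ?_, fun s => rfl⟩
  have h := (hτ (e.symm t)).of_local_left_inverse (f := τ) (g := e.symm)
    e.symm.continuous.continuousAt (inv_pos.2 (hpos _)).ne'
    (Eventually.of_forall fun y => e.apply_symm_apply y)
  simpa using h

/-! ### The cubic field and the uniqueness of the first return -/

theorem sum_cubic (c : ℕ → ℕ → ℝ) (x y : ℝ) :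
    ∑ i ∈ Finset.range 4, ∑ j ∈ Finset.range (4 - i), c i j * x ^ i * y ^ j =
      c 0 0 + c 0 1 * y + c 0 2 * y ^ 2 + c 0 3 * y ^ 3 + c 1 0 * x + c 1 1 * x * y
        + c 1 2 * x * y ^ 2 + c 2 0 * x ^ 2 + c 2 1 * x ^ 2 * y + c 3 0 * x ^ 3 := by
  simp [Finset.sum_range_succ]
  ring

theorem CubicPerturbation.f_eq (p : CubicPerturbation) (x y : ℝ) : p.f x y =
    p.a 0 0 + p.a 0 1 * y + p.a 0 2 * y ^ 2 + p.a 0 3 * y ^ 3 + p.a 1 0 * x + p.a 1 1 * x * y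
      + p.a 1 2 * x * y ^ 2 + p.a 2 0 * x ^ 2 + p.a 2 1 * x ^ 2 * y + p.a 3 0 * x ^ 3 :=
  sum_cubic _ _ _

theorem CubicPerturbation.g_eq (p : CubicPerturbation) (x y : ℝ) : p.g x y =
    p.b 0 0 + p.b 0 1 * y + p.b 0 2 * y ^ 2 + p.b 0 3 * y ^ 3 + p.b 1 0 * x + p.b 1 1 * x * y
      + p.b 1 2 * x * y ^ 2 + p.b 2 0 * x ^ 2 + p.b 2 1 * x ^ 2 * y + p.b 3 0 * x ^ 3 :=
  sum_cubic _ _ _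

theorem CubicPerturbation.contDiff_field (p : CubicPerturbation) (ε : ℝ) (n : WithTop ℕ∞) :
    ContDiff ℝ n (p.field ε) := by
  unfold CubicPerturbation.field
  simp only [p.f_eq, p.g_eq]
  fun_prop

theorem xR_strictMonoOn : StrictMonoOn xR (Ici (-(1 / 4))) := by
  intro a ha b hb hab
  have ha' : 0 ≤ 1 + 4 * a := by have := mem_Ici.1 ha; linarith
  refine Real.sqrt_lt_sqrt (by positivity) ?_
  have := Real.sqrt_lt_sqrt ha' (show 1 + 4 * a < 1 + 4 * b by linarith)
  linarith

theorem one_lt_xR {h : ℝ} (hh : -(1 / 4) < h) : 1 < xR h := by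
  have h1 : 0 < √(1 + 4 * h) := Real.sqrt_pos.2 (by linarith)
  exact Real.lt_sqrt_of_sq_lt (by linarith)

/-- The field is only locally Lipschitz; both arcs are compact, so a single ball contains them and
the field is Lipschitz there. -/
theorem solution_unique {X : ℝ × ℝ → ℝ × ℝ} (hX : ContDiff ℝ 1 X) {T : ℝ} {γ₁ γ₂ : ℝ → ℝ × ℝ}
    (h₁ : ∀ t ∈ Icc 0 T, HasDerivWithinAt γ₁ (X (γ₁ t)) (Icc 0 T) t)
    (h₂ : ∀ t ∈ Icc 0 T, HasDerivWithinAt γ₂ (X (γ₂ t)) (Icc 0 T) t) (h0 : γ₁ 0 = γ₂ 0) :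
    EqOn γ₁ γ₂ (Icc 0 T) := by
  have c₁ : ContinuousOn γ₁ (Icc 0 T) := fun t ht => (h₁ t ht).continuousWithinAt
  have c₂ : ContinuousOn γ₂ (Icc 0 T) := fun t ht => (h₂ t ht).continuousWithinAt
  obtain ⟨R, hR⟩ := ((isCompact_Icc.image_of_continuousOn c₁).union
    (isCompact_Icc.image_of_continuousOn c₂)).isBounded.subset_closedBall 0
  obtain ⟨L, hL⟩ := (hX.locallyLipschitz.locallyLipschitzOn
    (s := Metric.closedBall (0 : ℝ × ℝ) R)).exists_lipschitzOnWith_of_compact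
    (isCompact_closedBall _ _)
  have hright : ∀ {γ : ℝ → ℝ × ℝ},
      (∀ t ∈ Icc 0 T, HasDerivWithinAt γ (X (γ t)) (Icc 0 T) t) →
      ∀ t ∈ Ico 0 T, HasDerivWithinAt γ (X (γ t)) (Ici t) t := fun h t ht =>
    ((h t ⟨ht.1, ht.2.le⟩).mono (Icc_subset_Icc_left ht.1)).mono_of_mem_nhdsWithin
      (Icc_mem_nhdsGE ht.2)
  exact ODE_solution_unique_of_mem_Icc_right (v := fun _ => X) (s := fun _ => Metric.closedBall 0 R)
    (K := L) (fun t _ => hL) c₁ (hright h₁)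
    (fun t ht => hR (Or.inl (mem_image_of_mem _ ⟨ht.1, ht.2.le⟩))) c₂ (hright h₂)
    (fun t ht => hR (Or.inr (mem_image_of_mem _ ⟨ht.1, ht.2.le⟩))) h0

/-- With two different return times, the later orbit would meet the section too early. The bound
`-(1/4) < h'` in the definition puts the end point on the section and makes `h'` recoverable from
its abscissa. Hence the choice in `displacement` is immaterial. -/
theorem IsFirstReturn.unique {p : CubicPerturbation} {s ε h h₁ h₂ : ℝ} (hs : s * s = 1)
    (H₁ : IsFirstReturn p s ε h h₁) (H₂ : IsFirstReturn p s ε h h₂) : h₁ = h₂ := by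
  have key : ∀ {h₁ h₂ : ℝ} {T₁ T₂ : ℝ} {γ₁ γ₂ : ℝ → ℝ × ℝ}, -(1 / 4) < h₁ → 0 < T₁ → T₁ ≤ T₂ →
      γ₁ 0 = sectionPoint s h → γ₂ 0 = sectionPoint s h →
      (∀ t ∈ Icc 0 T₁, HasDerivWithinAt γ₁ (p.field ε (γ₁ t)) (Icc 0 T₁) t) →
      (∀ t ∈ Icc 0 T₂, HasDerivWithinAt γ₂ (p.field ε (γ₂ t)) (Icc 0 T₂) t) →
      γ₁ T₁ = sectionPoint s h₁ → γ₂ T₂ = sectionPoint s h₂ →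
      (∀ t ∈ Ioo 0 T₂, ¬ ((γ₂ t).2 = 0 ∧ 1 < s * (γ₂ t).1)) →
      sectionPoint s h₁ = sectionPoint s h₂ := by
    intro h₁ h₂ T₁ T₂ γ₁ γ₂ hh hT hle i₁ i₂ d₁ d₂ e₁ e₂ n₂
    have heq := solution_unique (p.contDiff_field ε 1) d₁
      (fun t ht => (d₂ t ⟨ht.1, ht.2.trans hle⟩).mono (Icc_subset_Icc_right hle))
      (i₁.trans i₂.symm) ⟨hT.le, le_rfl⟩
    rcases hle.eq_or_lt with h | h
    · rw [← e₁, heq, h, e₂]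
    · refine absurd ?_ (n₂ T₁ ⟨hT, h⟩)
      rw [← heq, e₁]
      refine ⟨rfl, ?_⟩
      simp only [sectionPoint, ← mul_assoc, hs, one_mul]
      exact one_lt_xR hh
  have hfin : sectionPoint s h₁ = sectionPoint s h₂ := by
    obtain ⟨hh₁, T₁, hT₁, γ₁, i₁, d₁, n₁, e₁⟩ := H₁
    obtain ⟨hh₂, T₂, hT₂, γ₂, i₂, d₂, n₂, e₂⟩ := H₂
    rcases le_total T₁ T₂ with hle | hle
    · exact key hh₁ hT₁ hle i₁ i₂ d₁ d₂ e₁ e₂ n₂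
    · exact (key hh₂ hT₂ hle i₂ i₁ d₂ d₁ e₂ e₁ n₁).symm
  have h3 : xR h₁ = xR h₂ := by
    have := congrArg (fun z : ℝ × ℝ => s * z.1) hfin
    simpa only [sectionPoint, ← mul_assoc, hs, one_mul] using this
  exact xR_strictMonoOn.injOn H₁.1.le H₂.1.le h3

theorem IsFirstReturn.displacement_eq {p : CubicPerturbation} {s ε h h' : ℝ} (hs : s * s = 1)
    (H : IsFirstReturn p s ε h h') : displacement p s h ε = h' - h := by
  have hr : ∃ h', IsFirstReturn p s ε h h' := ⟨h', H⟩
  rw [displacement, dif_pos hr, hr.choose_spec.unique hs H]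

/-! ### Polar coordinates adapted to H and the displacement map -/

open Real (pi pi_pos)

theorem two_pi_nonneg : (0 : ℝ) ≤ 2 * Real.pi := by positivity

/-- The interval of angles. -/
abbrev Angle := Icc (0 : ℝ) (2 * Real.pi)

/-- In the coordinates below H = r² − 1/4, so the ovals are the circles r = const with 0 < r < 1/2,
and the sign of y makes θ increase along the flow. An orbit is sought as a radius function in
`C(Angle, ℝ)`. -/
def cosK : C(Angle, ℝ) := ⟨fun t => Real.cos t, by fun_prop⟩
def sinK : C(Angle, ℝ) := ⟨fun t => Real.sin t, by fun_prop⟩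

/-- `x = √(1 + 2 r cos θ)`. -/
def xK (u : C(Angle, ℝ)) : C(Angle, ℝ) := sqrtC (1 + (2 : ℝ) • (u * cosK))
/-- `y = -√2 r sin θ`. -/
def yK (u : C(Angle, ℝ)) : C(Angle, ℝ) := (-√2 : ℝ) • (u * sinK)

/-- A cubic polynomial on the curve `r = u(θ)`. -/
def polyK (c : ℕ → ℕ → ℝ) (u : C(Angle, ℝ)) : C(Angle, ℝ) :=
  ∑ i ∈ Finset.range 4, ∑ j ∈ Finset.range (4 - i), c i j • (xK u ^ i * yK u ^ j)

/-- `ε⁻¹` times the radial velocity. -/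
def numK (p : CubicPerturbation) (u : C(Angle, ℝ)) : C(Angle, ℝ) :=
  xK u * cosK * polyK p.a u - (√2)⁻¹ • (sinK * polyK p.b u)

/-- `r` times the angular velocity. -/
def denK (p : CubicPerturbation) (z : ℝ × C(Angle, ℝ)) : C(Angle, ℝ) :=
  √2 • (z.2 * xK z.2) - z.1 • (xK z.2 * sinK * polyK p.a z.2 + (√2)⁻¹ • (cosK * polyK p.b z.2))

/-- The derivative `dr/dθ`, divided by `ε`. -/
def slopeK (p : CubicPerturbation) (z : ℝ × C(Angle, ℝ)) : C(Angle, ℝ) :=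
  z.2 * numK p z.2 * Ring.inverse (denK p z)

@[simp] theorem cosK_apply (t : Angle) : cosK t = Real.cos t := rfl
@[simp] theorem sinK_apply (t : Angle) : sinK t = Real.sin t := rfl
@[simp] theorem xK_apply (u : C(Angle, ℝ)) (t : Angle) :
    xK u t = √(1 + 2 * (u t * Real.cos t)) := rfl
@[simp] theorem yK_apply (u : C(Angle, ℝ)) (t : Angle) :
    yK u t = -√2 * (u t * Real.sin t) := rfl
theorem polyK_apply (c : ℕ → ℕ → ℝ) (u : C(Angle, ℝ)) (t : Angle) : polyK c u t =
    ∑ i ∈ Finset.range 4, ∑ j ∈ Finset.range (4 - i), c i j * xK u t ^ i * yK u t ^ j := by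
  simp only [polyK, ContinuousMap.sum_apply, ContinuousMap.smul_apply, ContinuousMap.mul_apply,
    ContinuousMap.pow_apply, smul_eq_mul, mul_assoc]

theorem abs_two_mul_cos_lt {r : ℝ} (hr : 0 < r) (hr' : r < 1 / 2) (θ : ℝ) :
    0 < 1 + 2 * (r * Real.cos θ) := by
  have h1 := Real.neg_one_le_cos θ
  nlinarith

theorem ringInverse_apply {w : C(Angle, ℝ)} (hw : ∀ t, 0 < w t) (t : Angle) :
    Ring.inverse w t = (w t)⁻¹ := by
  have h : Ring.inverse w * w = 1 := Ring.inverse_mul_cancel _ (isUnit_of_pos hw)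
  have h2 : Ring.inverse w t * w t = 1 := by
    rw [← ContinuousMap.mul_apply, h]; rfl
  exact eq_inv_of_mul_eq_one_left h2

theorem analyticAt_xK {u₀ : C(Angle, ℝ)} (h : ∀ t, 0 < u₀ t ∧ u₀ t < 1 / 2) :
    AnalyticAt ℝ xK u₀ := by
  have h1 : AnalyticAt ℝ (fun u : C(Angle, ℝ) => 1 + (2 : ℝ) • (u * cosK)) u₀ :=
    analyticAt_const.fun_add ((analyticAt_id.fun_mul analyticAt_const).fun_const_smul)
  refine AnalyticAt.comp (g := sqrtC) (analyticAt_sqrtC fun t => ?_) h1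
  exact abs_two_mul_cos_lt (h t).1 (h t).2 t

theorem analyticAt_yK (u₀ : C(Angle, ℝ)) : AnalyticAt ℝ yK u₀ :=
  (analyticAt_id.fun_mul analyticAt_const).fun_const_smul

theorem analyticAt_polyK (c : ℕ → ℕ → ℝ) {u₀ : C(Angle, ℝ)} (h : ∀ t, 0 < u₀ t ∧ u₀ t < 1 / 2) :
    AnalyticAt ℝ (polyK c) u₀ := by
  unfold polyK
  refine Finset.analyticAt_fun_sum _ fun i _ => Finset.analyticAt_fun_sum _ fun j _ => ?_
  exact (((analyticAt_xK h).fun_pow _).fun_mul ((analyticAt_yK _).fun_pow _)).fun_const_smul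

theorem analyticAt_slopeK (p : CubicPerturbation) {z₀ : ℝ × C(Angle, ℝ)}
    (h : ∀ t, 0 < z₀.2 t ∧ z₀.2 t < 1 / 2) (hd : ∀ t, 0 < denK p z₀ t) :
    AnalyticAt ℝ (denK p) z₀ ∧ AnalyticAt ℝ (slopeK p) z₀ := by
  have hs : AnalyticAt ℝ (fun z : ℝ × C(Angle, ℝ) => z.2) z₀ := analyticAt_snd
  have hf : AnalyticAt ℝ (fun z : ℝ × C(Angle, ℝ) => z.1) z₀ := analyticAt_fst
  have hx : AnalyticAt ℝ (fun z : ℝ × C(Angle, ℝ) => xK z.2) z₀ := (analyticAt_xK h).comp hs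
  have hP : ∀ c, AnalyticAt ℝ (fun z : ℝ × C(Angle, ℝ) => polyK c z.2) z₀ :=
    fun c => (analyticAt_polyK c h).comp hs
  have hden : AnalyticAt ℝ (denK p) z₀ :=
    (hs.fun_mul hx).fun_const_smul.fun_sub (hf.fun_smul
      (((hx.fun_mul analyticAt_const).fun_mul (hP _)).fun_add
        (analyticAt_const.fun_mul (hP _)).fun_const_smul))
  refine ⟨hden, (hs.fun_mul (((hx.fun_mul analyticAt_const).fun_mul (hP _)).fun_sub
      (analyticAt_const.fun_mul (hP _)).fun_const_smul)).fun_mul ?_⟩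
  obtain ⟨v, hv⟩ := isUnit_of_pos hd
  have := analyticAt_inverse (𝕜 := ℝ) v
  rw [hv] at this
  exact this.comp (f := denK p) hden

/-- The orbit of the perturbed system in the polar coordinates adapted to `H` depends analytically
on the small parameter. -/
theorem exists_radius (p : CubicPerturbation) {r₀ : ℝ} (hr : 0 < r₀) (hr' : r₀ < 1 / 2) :
    ∃ U : ℝ → C(Angle, ℝ), AnalyticAt ℝ U 0 ∧ U 0 = ContinuousMap.const _ r₀ ∧
      ContinuousAt (fun ε => denK p (ε, U ε)) 0 ∧ ContinuousAt (fun ε => slopeK p (ε, U ε)) 0 ∧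
      (∀ t, 0 < denK p (0, U 0) t) ∧
      ∀ᶠ ε in 𝓝 (0 : ℝ), (∀ t, 0 < U ε t ∧ U ε t < 1 / 2) ∧ (∀ t, 0 < denK p (ε, U ε) t) ∧
        U ε = ContinuousMap.const _ r₀ + ε • volterra _ two_pi_nonneg (slopeK p (ε, U ε)) := by
  set u₀ : C(Angle, ℝ) := ContinuousMap.const _ r₀ with hu₀
  have hu : ∀ t, 0 < u₀ t ∧ u₀ t < 1 / 2 := fun t => ⟨hr, hr'⟩
  have hden : ∀ t, 0 < denK p (0, u₀) t := by
    intro t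
    have h1 := Real.sqrt_pos.2 (abs_two_mul_cos_lt hr hr' t)
    have : denK p (0, u₀) t = √2 * (r₀ * √(1 + 2 * (r₀ * Real.cos t))) := by
      simp [denK, hu₀]
    rw [this]; positivity
  obtain ⟨hA, hS⟩ := analyticAt_slopeK p (z₀ := (0, u₀)) hu hden
  let V := volterra _ two_pi_nonneg
  -- The integral form of dr/dθ = ε · slope. The factor ε removes the derivative of the slope at ε =
  -- 0, so the partial derivative in `u` is the identity.
  let Φ : ℝ × C(Angle, ℝ) → C(Angle, ℝ) := fun z => z.2 - u₀ - z.1 • V (slopeK p z)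
  have hV : AnalyticAt ℝ (fun z => V (slopeK p z)) (0, u₀) := (V.analyticAt _).comp hS
  have hΦ : AnalyticAt ℝ Φ (0, u₀) :=
    (analyticAt_snd.fun_sub analyticAt_const).fun_sub (analyticAt_fst.fun_smul hV)
  obtain ⟨U, h1, h2, h3, h4⟩ := exists_analytic_implicit hΦ (by simp [Φ]) (by
    intro v
    have hs : HasFDerivAt (fun z : ℝ × C(Angle, ℝ) => z.2) _ ((0 : ℝ), u₀) :=
      hasFDerivAt_snd (𝕜 := ℝ)
    have hf : HasFDerivAt (fun z : ℝ × C(Angle, ℝ) => z.1) _ ((0 : ℝ), u₀) :=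
      hasFDerivAt_fst (𝕜 := ℝ)
    have hd : HasFDerivAt Φ _ ((0 : ℝ), u₀) :=
      (hs.sub_const u₀).sub (hf.smul hV.differentiableAt.hasFDerivAt)
    rw [hd.fderiv]
    simp)
  have hpair : ContinuousAt (fun ε : ℝ => (ε, U ε)) 0 := continuousAt_id.prodMk h1.continuousAt
  have hdc : ContinuousAt (fun ε => denK p (ε, U ε)) 0 :=
    ContinuousAt.comp (g := denK p) (by rw [h2]; exact hA.continuousAt) hpair
  have hsc : ContinuousAt (fun ε => slopeK p (ε, U ε)) 0 :=
    ContinuousAt.comp (g := slopeK p) (by rw [h2]; exact hS.continuousAt) hpair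
  refine ⟨U, h1, h2, hdc, hsc, by rw [h2]; exact hden, ?_⟩
  have hpos := h1.continuousAt.eventually (eventually_pos (by rw [h2]; exact fun t => (hu t).1))
  have hlt : ∀ᶠ ε in 𝓝 (0 : ℝ), ∀ t, 0 < (ContinuousMap.const Angle (1 / 2 : ℝ) - U ε) t := by
    have hc : ContinuousAt (fun ε => ContinuousMap.const Angle (1 / 2 : ℝ) - U ε) 0 :=
      continuousAt_const.sub h1.continuousAt
    exact hc.eventually (eventually_pos (by beta_reduce; rw [h2]; exact fun t => sub_pos.2 (hu t).2))
  have hdp := hdc.eventually (eventually_pos (by beta_reduce; rw [h2]; exact hden))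
  filter_upwards [hpos, hlt, hdp, h4] with ε e1 e2 e3 e4
  refine ⟨fun t => ⟨e1 t, sub_pos.1 (e2 t)⟩, e3, ?_⟩
  have h5 : U ε - u₀ - ε • V (slopeK p (ε, U ε)) = 0 := e4
  rw [sub_sub, sub_eq_zero] at h5
  exact h5

/-- The passage from polar to Cartesian coordinates. -/
theorem polar_hasDerivAt {ε fv gv θ ρ' den : ℝ} {ρ : ℝ → ℝ} (h0 : 0 < ρ θ) (h1 : ρ θ < 1 / 2)
    (hden : den = √2 * (ρ θ * √(1 + 2 * (ρ θ * Real.cos θ))) -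
      ε * (√(1 + 2 * (ρ θ * Real.cos θ)) * Real.sin θ * fv + (√2)⁻¹ * (Real.cos θ * gv)))
    (hd0 : 0 < den) (hρ : HasDerivAt ρ ρ' θ)
    (hρ' : ρ' = ε * (ρ θ * (√(1 + 2 * (ρ θ * Real.cos θ)) * Real.cos θ * fv
      - (√2)⁻¹ * (Real.sin θ * gv)) * den⁻¹)) :
    HasDerivAt (fun s => √(1 + 2 * (ρ s * Real.cos s)))
      ((-√2 * (ρ θ * Real.sin θ) + ε * fv) * (ρ θ * den⁻¹)) θ ∧
    HasDerivAt (fun s => -√2 * (ρ s * Real.sin s))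
      ((√(1 + 2 * (ρ θ * Real.cos θ)) - √(1 + 2 * (ρ θ * Real.cos θ)) ^ 3 + ε * gv)
        * (ρ θ * den⁻¹)) θ := by
  have hw := abs_two_mul_cos_lt h0 h1 θ
  have hxpos := Real.sqrt_pos.2 hw
  have hxx := Real.sq_sqrt hw.le
  set x := √(1 + 2 * (ρ θ * Real.cos θ)) with hx
  have h2 : √2 ^ 2 = (2 : ℝ) := Real.sq_sqrt (by norm_num)
  have h2p : 0 < √(2 : ℝ) := by positivity
  have hcs := Real.sin_sq_add_cos_sq θ
  set c := Real.cos θ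
  set s := Real.sin θ
  set q := √(2 : ℝ)
  constructor
  · have hd := (((hρ.mul (Real.hasDerivAt_cos θ)).const_mul 2).const_add 1).sqrt hw.ne'
    refine hd.congr_deriv ?_
    rw [hρ']
    change 2 * (ε * (ρ θ * (x * c * fv - q⁻¹ * (s * gv)) * den⁻¹) * c + ρ θ * -s) / (2 * x) = _
    field_simp
    rw [hden]
    field_simp
    linear_combination (q * ε * fv * x) * hcs
  · have hd := (hρ.mul (Real.hasDerivAt_sin θ)).const_mul (-q)
    refine hd.congr_deriv ?_
    rw [hρ']
    change -q * (ε * (ρ θ * (x * c * fv - q⁻¹ * (s * gv)) * den⁻¹) * s + ρ θ * c) = _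
    field_simp
    rw [hden]
    field_simp
    linear_combination (ε * gv) * hcs - (c * x * ρ θ) * h2 + x * hxx

/-- The curve `θ ↦ (x, y)` in polar coordinates, together with its derivative. -/
structure IsOrbitArc (p : CubicPerturbation) (ε : ℝ) (x y x' y' : ℝ → ℝ) : Prop where
  hx : ∀ θ ∈ Icc 0 (2 * Real.pi), HasDerivAt x (x' θ) θ
  hy : ∀ θ ∈ Icc 0 (2 * Real.pi), HasDerivAt y (y' θ) θ
  energy : ∀ θ ∈ Icc 0 (2 * Real.pi), (x θ ^ 3 - x θ) * x' θ + y θ * y' θ =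
    ε * (p.g (x θ) (y θ) * x' θ - p.f (x θ) (y θ) * y' θ)

/-- The radius of the oval `δ(h)` in polar coordinates. -/
def radius (h : ℝ) : ℝ := √(h + 1 / 4)

theorem radius_pos {h : ℝ} (hh : h ∈ Sig) : 0 < radius h :=
  Real.sqrt_pos.2 (by have := hh.1; linarith)

theorem radius_lt {h : ℝ} (hh : h ∈ Sig) : radius h < 1 / 2 := by
  refine (Real.sqrt_lt' (by norm_num)).2 ?_
  have := hh.2
  norm_num
  linarith

theorem radius_sq {h : ℝ} (hh : h ∈ Sig) : radius h ^ 2 = h + 1 / 4 :=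
  Real.sq_sqrt (by have := hh.1; linarith)

theorem xR_eq_of_sq {h r : ℝ} (hr : 0 ≤ r) (h2 : h + 1 / 4 = r ^ 2) : xR h = √(1 + 2 * r) := by
  have : √(1 + 4 * h) = 2 * r := by
    rw [show 1 + 4 * h = (2 * r) ^ 2 by linarith, Real.sqrt_sq (by linarith)]
  rw [xR, this]

/-- The point with polar angle `θ` of the oval `δ(h)`. -/
def ovalX (h θ : ℝ) : ℝ := √(1 + 2 * (radius h * Real.cos θ))
/-- The second coordinate of the point with polar angle `θ` of the oval `δ(h)`. -/
def ovalZ (h θ : ℝ) : ℝ := -√2 * (radius h * Real.sin θ)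

/-- Everything used later about orbits. Besides the analyticity of the displacement, the arc and its
velocity are continuous at ε = 0 in the uniform topology, which permits passing to the limit in
integrals along the orbit. -/
theorem exists_orbit (p : CubicPerturbation) {h : ℝ} (hh : h ∈ Sig) :
    AnalyticAt ℝ (fun ε => displacement p 1 h ε) 0 ∧
    ∃ Γ : ℝ → C(Angle, (ℝ × ℝ) × (ℝ × ℝ)), ContinuousAt Γ 0 ∧
      (∀ t, Γ 0 t = ((ovalX h t, ovalZ h t),
        (ovalZ h t * (√2 * ovalX h t)⁻¹, (ovalX h t - ovalX h t ^ 3) * (√2 * ovalX h t)⁻¹))) ∧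
      ∀ᶠ ε in 𝓝 (0 : ℝ), (∃ h', IsFirstReturn p 1 ε h h') ∧
        -(1 / 4) < h + displacement p 1 h ε ∧
        ∃ x y x' y' : ℝ → ℝ, IsOrbitArc p ε x y x' y' ∧
          (∀ t : Angle, Γ ε t = ((x t, y t), (x' t, y' t))) ∧
          x 0 = xR h ∧ y 0 = 0 ∧ x (2 * Real.pi) = xR (h + displacement p 1 h ε) ∧
          y (2 * Real.pi) = 0 := by
  obtain ⟨U, hUa, hU0, hdc, hsc, hd0, hev⟩ := exists_radius p (radius_pos hh) (radius_lt hh)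
  set π2 : Angle := ⟨2 * Real.pi, two_pi_nonneg, le_rfl⟩ with hπ2
  -- everything about a single parameter
  have main : ∀ ε, ((∀ t, 0 < U ε t ∧ U ε t < 1 / 2) ∧ (∀ t, 0 < denK p (ε, U ε) t) ∧
      U ε = ContinuousMap.const _ (radius h) +
        ε • volterra _ two_pi_nonneg (slopeK p (ε, U ε))) →
      IsFirstReturn p 1 ε h (U ε π2 ^ 2 - 1 / 4) ∧
      ∃ x y x' y' : ℝ → ℝ, IsOrbitArc p ε x y x' y' ∧
        (∀ t : Angle, x t = xK (U ε) t ∧ y t = yK (U ε) t ∧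
          x' t = (yK (U ε) t + ε * polyK p.a (U ε) t) * (U ε t * (denK p (ε, U ε) t)⁻¹) ∧
          y' t = (xK (U ε) t - xK (U ε) t ^ 3 + ε * polyK p.b (U ε) t)
            * (U ε t * (denK p (ε, U ε) t)⁻¹)) ∧
        x 0 = xR h ∧ y 0 = 0 ∧ x (2 * Real.pi) = xR (U ε π2 ^ 2 - 1 / 4) ∧
        y (2 * Real.pi) = 0 := by
    rintro ε ⟨hu, hden, heq⟩
    set u := U ε with hu_def
    set S := slopeK p (ε, u) with hS
    let P : ℝ → Angle := projIcc 0 (2 * Real.pi) two_pi_nonneg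
    have hP : ∀ t : Angle, P t = t := fun t => projIcc_val _ t
    have hP' : ∀ {θ : ℝ} (hθ : θ ∈ Icc 0 (2 * Real.pi)), P θ = ⟨θ, hθ⟩ :=
      fun hθ => projIcc_of_mem _ hθ
    have hPc : Continuous P := continuous_projIcc
    let ρ : ℝ → ℝ := fun θ => radius h + ε * ∫ s in (0 : ℝ)..θ, S (P s)
    have hSc : Continuous fun s => S (P s) := S.continuous.comp hPc
    have hρd : ∀ θ, HasDerivAt ρ (ε * S (P θ)) θ := fun θ =>
      ((intervalIntegral.integral_hasDerivAt_right (hSc.intervalIntegrable _ _)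
        (hSc.stronglyMeasurableAtFilter _ _) hSc.continuousAt).const_mul ε).const_add _
    have hρu : ∀ t : Angle, ρ t = u t := by
      intro t
      conv_rhs => rw [heq]
      rfl
    let x : ℝ → ℝ := fun s => √(1 + 2 * (ρ s * Real.cos s))
    let y : ℝ → ℝ := fun s => -√2 * (ρ s * Real.sin s)
    have hxu : ∀ t : Angle, x t = xK u t := fun t => by simp [x, hρu]
    have hyu : ∀ t : Angle, y t = yK u t := fun t => by simp [y, hρu]
    have hfa : ∀ t : Angle, p.f (x t) (y t) = polyK p.a u t := fun t => by
      rw [polyK_apply, hxu, hyu]; rfl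
    have hgb : ∀ t : Angle, p.g (x t) (y t) = polyK p.b u t := fun t => by
      rw [polyK_apply, hxu, hyu]; rfl
    -- The angular velocity; dividing the field by it parametrises the orbit by θ.
    let ω : ℝ → ℝ := fun θ => denK p (ε, u) (P θ) * (u (P θ))⁻¹
    have hωpos : ∀ θ, 0 < ω θ := fun θ => mul_pos (hden _) (inv_pos.2 (hu _).1)
    have hωc : Continuous ω := by
      have h1 : Continuous fun θ => u (P θ) := u.continuous.comp hPc
      have h2 : Continuous fun θ => denK p (ε, u) (P θ) := (denK p (ε, u)).continuous.comp hPc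
      exact h2.mul (h1.inv₀ fun θ => (hu _).1.ne')
    have hωi : ∀ t : Angle, (u t * (denK p (ε, u) t)⁻¹) = (ω t)⁻¹ := fun t => by
      simp only [ω, hP, mul_inv, inv_inv]; ring
    have hder : ∀ t : Angle, HasDerivAt x ((y t + ε * p.f (x t) (y t)) * (ω t)⁻¹) t ∧
        HasDerivAt y ((x t - x t ^ 3 + ε * p.g (x t) (y t)) * (ω t)⁻¹) t := by
      intro t
      have := polar_hasDerivAt (ε := ε) (fv := p.f (x t) (y t)) (gv := p.g (x t) (y t)) (θ := t)
        (ρ := ρ) (den := denK p (ε, u) t) (by rw [hρu]; exact (hu t).1)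
        (by rw [hρu]; exact (hu t).2)
        (by rw [hfa, hgb, hρu]; simp [denK]; ring) (hden t) (hρd t)
        (by
          rw [hP, hS, slopeK, ContinuousMap.mul_apply, ringInverse_apply hden, hρu, hfa, hgb]
          simp [numK])
      rw [← hωi, ← hρu]
      exact this
    have hy0 : ρ 0 = radius h := by simp [ρ]
    have hend : ρ (2 * Real.pi) = u π2 := hρu π2
    have hx0 : x 0 = xR h := by
      simp only [x, hy0, Real.cos_zero, mul_one]
      exact (xR_eq_of_sq (radius_pos hh).le (radius_sq hh).symm).symm
    have hx1 : x (2 * Real.pi) = xR (u π2 ^ 2 - 1 / 4) := by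
      simp only [x, hend, Real.cos_two_pi, mul_one]
      exact (xR_eq_of_sq (hu _).1.le (by ring)).symm
    have hy0' : y 0 = 0 := by simp [y]
    have hy1' : y (2 * Real.pi) = 0 := by simp [y]
    refine ⟨?_, x, y, fun θ => (y θ + ε * p.f (x θ) (y θ)) * (ω θ)⁻¹,
      fun θ => (x θ - x θ ^ 3 + ε * p.g (x θ) (y θ)) * (ω θ)⁻¹, ⟨fun θ hθ => (hder ⟨θ, hθ⟩).1,
      fun θ hθ => (hder ⟨θ, hθ⟩).2, fun θ _ => by ring⟩, fun t => ⟨hxu t, hyu t, ?_, ?_⟩,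
      hx0, hy0', hx1, hy1'⟩
    · -- the first return
      obtain ⟨B, hB⟩ : ∃ B, ∀ t : Angle, denK p (ε, u) t * (u t)⁻¹ ≤ B := by
        have hcc : Continuous fun t : Angle => denK p (ε, u) t * (u t)⁻¹ :=
          (denK p (ε, u)).continuous.mul (u.continuous.inv₀ fun t => (hu t).1.ne')
        obtain ⟨B, hB⟩ := (isCompact_range hcc).bddAbove
        exact ⟨B, fun t => hB (mem_range_self t)⟩
      obtain ⟨e, he, hes⟩ := exists_time_change hωc hωpos (fun θ => hB (P θ))
      have he0 : e 0 = 0 := by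
        have : e.symm 0 = 0 := by rw [hes]; simp
        conv_lhs => rw [← this]
        exact e.apply_symm_apply 0
      set T := e.symm (2 * Real.pi) with hT
      have heT : e T = 2 * Real.pi := e.apply_symm_apply _
      have hTpos : 0 < T := by
        have h1 : e 0 < e T := by rw [he0, heT]; positivity
        exact e.lt_iff_lt.1 h1
      refine ⟨by have := sq_pos_of_pos (hu π2).1; linarith, T, hTpos,
        fun t => (x (e t), y (e t)), ?_, ?_, ?_, ?_⟩
      · simp [he0, hx0, hy0', sectionPoint]
      · intro t ht
        have hm : e t ∈ Icc 0 (2 * Real.pi) :=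
          ⟨by rw [← he0]; exact e.monotone ht.1, by rw [← heT]; exact e.monotone ht.2⟩
        have h1 := (hder ⟨e t, hm⟩).1.comp t (he t)
        have h2 := (hder ⟨e t, hm⟩).2.comp t (he t)
        refine (HasDerivAt.congr_deriv (h1.prodMk h2) ?_).hasDerivWithinAt
        have := (hωpos (e t)).ne'
        simp only [CubicPerturbation.field]
        ext <;> field_simp
      -- For 0 < θ < 2π, y = 0 forces θ = π, where x = √(1 − 2r) < 1 is off the section.
      · rintro t ht ⟨h1, h2⟩
        have hm0 : 0 < e t := by rw [← he0]; exact e.strictMono ht.1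
        have hm1 : e t < 2 * Real.pi := by rw [← heT]; exact e.strictMono ht.2
        have hρpos : 0 < ρ (e t) := by
          have := hρu ⟨e t, hm0.le, hm1.le⟩
          rw [this]; exact (hu _).1
        have hρlt : ρ (e t) < 1 / 2 := by
          have := hρu ⟨e t, hm0.le, hm1.le⟩
          rw [this]; exact (hu _).2
        have hsin : Real.sin (e t) = 0 := by
          have h3 : -√2 * (ρ (e t) * Real.sin (e t)) = 0 := h1
          have h4 : √(2 : ℝ) ≠ 0 := by positivity
          rcases mul_eq_zero.1 h3 with h | h
          · exact absurd (neg_eq_zero.1 h) h4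
          · exact (mul_eq_zero.1 h).resolve_left hρpos.ne'
        have hpi : e t = Real.pi := by
          obtain ⟨n, hn⟩ := Real.sin_eq_zero_iff.1 hsin
          have hn0 : (0 : ℝ) < n := by
            by_contra hcon
            have : (n : ℝ) * Real.pi ≤ 0 := mul_nonpos_of_nonpos_of_nonneg (not_lt.1 hcon)
              Real.pi_pos.le
            linarith
          have hn2 : (n : ℝ) < 2 := by
            by_contra hcon
            have := mul_le_mul_of_nonneg_right (not_lt.1 hcon) Real.pi_pos.le
            linarith
          have : n = 1 := by
            have h5 : (0 : ℤ) < n := by exact_mod_cast hn0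
            have h6 : n < (2 : ℤ) := by exact_mod_cast hn2
            omega
          rw [← hn, this]; simp
        have h3 : 1 < √(1 + 2 * (ρ (e t) * Real.cos (e t))) := by simpa using h2
        rw [hpi, Real.cos_pi] at h3
        rw [hpi] at hρpos
        have : √(1 + 2 * (ρ Real.pi * -1)) ≤ 1 := Real.sqrt_le_one.2 (by linarith)
        linarith
      · simp [heT, hx1, hy1', sectionPoint]
    · simp only [hωi, hxu, hyu, ← hfa]
    · simp only [hωi, hxu, hyu, ← hgb]
  have hdisp : ∀ᶠ ε in 𝓝 (0 : ℝ), displacement p 1 h ε = U ε π2 ^ 2 - 1 / 4 - h := by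
    filter_upwards [hev] with ε hε
    exact (main ε hε).1.displacement_eq (by norm_num)
  constructor
  · have hev2 : AnalyticAt ℝ (fun ε => U ε π2) 0 :=
      AnalyticAt.comp (g := fun v : C(Angle, ℝ) => v π2)
        ((ContinuousMap.evalCLM ℝ π2 : C(Angle, ℝ) →L[ℝ] ℝ).analyticAt _) hUa
    exact (((hev2.fun_pow 2).fun_sub analyticAt_const).fun_sub analyticAt_const).congr
      (hdisp.mono fun ε h => h.symm)
  have hxc : ContinuousAt (fun ε => xK (U ε)) 0 :=
    ContinuousAt.comp (g := xK) (analyticAt_xK (by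
      rw [hU0]; exact fun t => ⟨radius_pos hh, radius_lt hh⟩)).continuousAt hUa.continuousAt
  have hyc : ContinuousAt (fun ε => yK (U ε)) 0 :=
    ContinuousAt.comp (g := yK) (analyticAt_yK _).continuousAt hUa.continuousAt
  have hpc : ∀ c, ContinuousAt (fun ε => polyK c (U ε)) 0 := fun c =>
    ContinuousAt.comp (g := polyK c) (analyticAt_polyK c (by
      rw [hU0]; exact fun t => ⟨radius_pos hh, radius_lt hh⟩)).continuousAt hUa.continuousAt
  have hic : ContinuousAt (fun ε => Ring.inverse (denK p (ε, U ε))) 0 := by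
    obtain ⟨v, hv⟩ := isUnit_of_pos hd0
    have := (analyticAt_inverse (𝕜 := ℝ) v).continuousAt
    rw [hv] at this
    exact ContinuousAt.comp (g := Ring.inverse) this hdc
  let Γx : ℝ → C(Angle, ℝ) := fun ε =>
    (yK (U ε) + ε • polyK p.a (U ε)) * (U ε * Ring.inverse (denK p (ε, U ε)))
  let Γy : ℝ → C(Angle, ℝ) := fun ε =>
    (xK (U ε) - xK (U ε) ^ 3 + ε • polyK p.b (U ε)) * (U ε * Ring.inverse (denK p (ε, U ε)))
  have hΓx : ContinuousAt Γx 0 :=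
    (hyc.add (continuousAt_id.smul (hpc _))).mul (hUa.continuousAt.mul hic)
  have hΓy : ContinuousAt Γy 0 :=
    ((hxc.sub (hxc.pow 3)).add (continuousAt_id.smul (hpc _))).mul (hUa.continuousAt.mul hic)
  have hpair : ∀ {α β : Type} [TopologicalSpace α] [TopologicalSpace β] {F : ℝ → C(Angle, α)}
      {G : ℝ → C(Angle, β)}, ContinuousAt F 0 → ContinuousAt G 0 →
      ContinuousAt (fun ε => (F ε).prodMk (G ε)) 0 := by
    intro α β _ _ F G hF hG
    exact ContinuousAt.comp (g := fun q : C(Angle, α) × C(Angle, β) => q.1.prodMk q.2)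
      (ContinuousMap.continuous_of_continuous_uncurry _ (by
        simp only [Function.uncurry_def, ContinuousMap.prod_eval]; fun_prop)).continuousAt
      (hF.prodMk hG)
  refine ⟨fun ε => ((xK (U ε)).prodMk (yK (U ε))).prodMk ((Γx ε).prodMk (Γy ε)),
    hpair (hpair hxc hyc) (hpair hΓx hΓy), ?_, ?_⟩
  · intro t
    have hx : xK (U 0) t = ovalX h t := by rw [hU0]; rfl
    have hy : yK (U 0) t = ovalZ h t := by rw [hU0]; rfl
    have hu : U 0 t = radius h := by rw [hU0]; rfl
    have hr := (radius_pos hh).ne'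
    have hden : radius h * (denK p (0, U 0) t)⁻¹ = (√2 * ovalX h t)⁻¹ := by
      have : denK p (0, U 0) t = √2 * (radius h * ovalX h t) := by
        simp [denK, ← hx, hu]
      rw [this, mul_inv, mul_inv, mul_inv]
      field_simp
    simp only [ContinuousMap.prod_eval, Γx, Γy, ContinuousMap.mul_apply,
      ContinuousMap.sub_apply, ContinuousMap.pow_apply, zero_smul, ringInverse_apply hd0, hx, hy,
      hu, hden, add_zero]
  · filter_upwards [hev] with ε hε
    obtain ⟨h1, x, y, x', y', h2, h3, h4, h5, h6, h7⟩ := main ε hε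
    have hd : h + displacement p 1 h ε = U ε π2 ^ 2 - 1 / 4 := by
      rw [h1.displacement_eq (by norm_num)]; ring
    refine ⟨⟨_, h1⟩, by rw [hd]; exact h1.1, x, y, x', y', h2, fun t => ?_, h4, h5,
      by rw [hd]; exact h6, h7⟩
    obtain ⟨k1, k2, k3, k4⟩ := h3 t
    simp only [ContinuousMap.prod_eval, Γx, Γy, ContinuousMap.mul_apply, ContinuousMap.add_apply,
      ContinuousMap.sub_apply, ContinuousMap.pow_apply, ContinuousMap.smul_apply, smul_eq_mul,
      ringInverse_apply hε.2.1, k1, k2, k3, k4]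

/-! ### The recursive procedure for the first nonvanishing coefficient -/

open Asymptotics

/-- The limit at 0 removes the constant term, and division by ε lowers the degree. The one-sided
neighbourhood allows the use for expansions in the radius r > 0. -/
theorem coeff_eq_zero_of_isLittleO (n : ℕ) : ∀ c : ℕ → ℝ,
    (fun ε : ℝ => ∑ j ∈ Finset.range (n + 1), c j * ε ^ j) =o[𝓝[>] 0] (fun ε : ℝ => ε ^ n) →
    ∀ j ≤ n, c j = 0 := by
  have hc0 : ∀ (n : ℕ) (c : ℕ → ℝ),
      (fun ε : ℝ => ∑ j ∈ Finset.range (n + 1), c j * ε ^ j) =o[𝓝[>] 0] (fun ε : ℝ => ε ^ n) →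
      c 0 = 0 := by
    intro n c h
    have h1 : Tendsto (fun ε : ℝ => ∑ j ∈ Finset.range (n + 1), c j * ε ^ j) (𝓝[>] 0)
        (𝓝 (∑ j ∈ Finset.range (n + 1), c j * (0 : ℝ) ^ j)) :=
      (Continuous.tendsto (by fun_prop) 0).mono_left nhdsWithin_le_nhds
    have h2 : (fun ε : ℝ => ε ^ n) =O[𝓝[>] 0] (fun _ => (1 : ℝ)) := by
      refine Tendsto.isBigO_one ℝ (c := (0 : ℝ) ^ n) ?_
      exact (Continuous.tendsto (by fun_prop) 0).mono_left nhdsWithin_le_nhds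
    have h3 := (isLittleO_one_iff ℝ).1 (h.trans_isBigO h2)
    have h4 := tendsto_nhds_unique h1 h3
    rw [Finset.sum_range_succ'] at h4
    simpa using h4
  induction n with
  | zero => intro c h j hj; rw [Nat.le_zero.1 hj]; exact hc0 0 c h
  | succ n ih =>
    intro c h j hj
    have h0 := hc0 _ c h
    rcases j with _ | j
    · exact h0
    · refine ih (fun j => c (j + 1)) ?_ j (by omega)
      have hinv := h.mul_isBigO (isBigO_refl (fun ε : ℝ => ε⁻¹) (𝓝[>] 0))
      refine hinv.congr' ?_ ?_
      · filter_upwards [self_mem_nhdsWithin] with ε hε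
        have hε' : ε ≠ 0 := (mem_Ioi.1 hε).ne'
        rw [Finset.sum_range_succ', h0, zero_mul, add_zero, Finset.sum_mul]
        refine Finset.sum_congr rfl fun i _ => ?_
        rw [pow_succ]; field_simp
      · filter_upwards [self_mem_nhdsWithin] with ε hε
        have hε' : ε ≠ 0 := (mem_Ioi.1 hε).ne'
        rw [pow_succ]; field_simp

theorem taylor_isBigO {d : ℝ → ℝ} (hd : AnalyticAt ℝ d 0) (n : ℕ) :
    (fun ε => d ε - ∑ j ∈ Finset.range n, iteratedDeriv j d 0 / (j.factorial : ℝ) * ε ^ j)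
      =O[𝓝 0] (fun ε : ℝ => ε ^ n) := by
  have h := hd.hasFPowerSeriesAt.isBigO_sub_partialSum_pow n
  have h2 : (fun ε : ℝ => ‖ε‖ ^ n) =O[𝓝 0] (fun ε : ℝ => ε ^ n) :=
    IsBigO.of_bound 1 (Eventually.of_forall fun ε => by simp)
  refine (h.congr_left fun ε => ?_).trans h2
  simp [FormalMultilinearSeries.partialSum, FormalMultilinearSeries.ofScalars, mul_comm]

/-- The difference with the Taylor polynomial is a polynomial of degree at most n that is o(ε^n),
hence zero. -/
theorem coeff_of_isLittleO {d : ℝ → ℝ} (hd : AnalyticAt ℝ d 0) {n : ℕ} {c : ℝ}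
    (h : (fun ε => d ε - c * ε ^ n) =o[𝓝 0] (fun ε : ℝ => ε ^ n)) :
    (∀ j < n, iteratedDeriv j d 0 / (j.factorial : ℝ) = 0) ∧
      iteratedDeriv n d 0 / (n.factorial : ℝ) = c := by
  set m : ℕ → ℝ := fun j => iteratedDeriv j d 0 / (j.factorial : ℝ)
  have h1 : (fun ε => d ε - ∑ j ∈ Finset.range (n + 1), m j * ε ^ j)
      =o[𝓝 0] (fun ε : ℝ => ε ^ n) :=
    (taylor_isBigO hd (n + 1)).trans_isLittleO (isLittleO_pow_pow (Nat.lt_succ_self n))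
  have h2 := coeff_eq_zero_of_isLittleO n (fun j => m j - if j = n then c else 0)
    (((h.sub h1).congr_left fun ε => by
      simp only [sub_mul, Finset.sum_sub_distrib, ite_mul, zero_mul, Finset.sum_ite_eq',
        Finset.mem_range, Nat.lt_succ_self, if_true]
      ring).mono nhdsWithin_le_nhds)
  refine ⟨fun j hj => ?_, ?_⟩
  · have := h2 j hj.le
    rwa [if_neg hj.ne, sub_zero] at this
  · have := h2 n le_rfl
    rwa [if_pos rfl, sub_eq_zero] at this

/-- One step of the recursive procedure for the Melnikov functions: `q ω = dQ + q' dH`, where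
`ω = g dx - f dy`. -/
def IsStep (p : CubicPerturbation) (q Q q' : ℝ → ℝ → ℝ) : Prop :=
  ∀ (x y : ℝ → ℝ) (x' y' t : ℝ), HasDerivAt x x' t → HasDerivAt y y' t →
    HasDerivAt (fun s => Q (x s) (y s))
      (q (x t) (y t) * (p.g (x t) (y t) * x' - p.f (x t) (y t) * y')
        - q' (x t) (y t) * ((x t ^ 3 - x t) * x' + y t * y')) t

/-- The derivative of `ovalX`. -/
def ovalX' (h θ : ℝ) : ℝ := ovalZ h θ * (√2 * ovalX h θ)⁻¹
/-- The derivative of `ovalZ`. -/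
def ovalZ' (h θ : ℝ) : ℝ := (ovalX h θ - ovalX h θ ^ 3) * (√2 * ovalX h θ)⁻¹

/-- The Hamiltonian. -/
def Ham (x y : ℝ) : ℝ := y ^ 2 / 2 - x ^ 2 / 2 + x ^ 4 / 4

theorem Ham_xR {h : ℝ} (hh : -(1 / 4) ≤ h) : Ham (xR h) 0 = h := by
  have h1 : √(1 + 4 * h) ^ 2 = 1 + 4 * h := Real.sq_sqrt (by linarith)
  have h2 : xR h ^ 2 = 1 + √(1 + 4 * h) := Real.sq_sqrt (by positivity)
  have h3 : xR h ^ 4 = (1 + √(1 + 4 * h)) ^ 2 := by rw [← h2]; ring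
  rw [Ham, h3, h2]
  linear_combination h1 / 4

theorem differentiableAt_xR {h : ℝ} (hh : -(1 / 4) < h) : DifferentiableAt ℝ xR h := by
  have h1 : 1 + 4 * h ≠ 0 := by linarith
  have h2 : 1 + √(1 + 4 * h) ≠ 0 := by positivity
  unfold xR
  exact (((differentiableAt_id.const_mul 4).const_add 1).sqrt h1 |>.const_add 1).sqrt h2

theorem continuous_f (p : CubicPerturbation) : Continuous fun z : ℝ × ℝ => p.f z.1 z.2 := by
  simp only [p.f_eq]; fun_prop

theorem continuous_g (p : CubicPerturbation) : Continuous fun z : ℝ × ℝ => p.g z.1 z.2 := by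
  simp only [p.g_eq]; fun_prop

/-- The first nonvanishing coefficient of the displacement map. -/
theorem melnikov_of_chain (p : CubicPerturbation) (k : ℕ) (q Q : ℕ → ℝ → ℝ → ℝ)
    (hq0 : ∀ x y, q 0 x y = 1) (hqc : Continuous fun z : ℝ × ℝ => q k z.1 z.2)
    (hstep : ∀ i < k, IsStep p (q i) (Q i) (q (i + 1))) {h : ℝ} (hh : h ∈ Sig) :
    (∀ j ≤ k, M p j h = 0) ∧
    M p (k + 1) h = ∫ θ in (0 : ℝ)..(2 * Real.pi), q k (ovalX h θ) (ovalZ h θ) *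
      (p.g (ovalX h θ) (ovalZ h θ) * ovalX' h θ - p.f (ovalX h θ) (ovalZ h θ) * ovalZ' h θ) := by
  obtain ⟨hda, Γ, hΓc, hΓ0, hev⟩ := exists_orbit p hh
  set d : ℝ → ℝ := fun ε => displacement p 1 h ε with hd
  let A : (ℝ × ℝ) × (ℝ × ℝ) → ℝ := fun z =>
    q k z.1.1 z.1.2 * (p.g z.1.1 z.1.2 * z.2.1 - p.f z.1.1 z.1.2 * z.2.2)
  have hA : Continuous A := by
    have h1 := (continuous_f p).comp (continuous_fst (X := ℝ × ℝ) (Y := ℝ × ℝ))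
    have h2 := (continuous_g p).comp (continuous_fst (X := ℝ × ℝ) (Y := ℝ × ℝ))
    have h3 := hqc.comp (continuous_fst (X := ℝ × ℝ) (Y := ℝ × ℝ))
    exact h3.mul ((h2.mul (by fun_prop)).sub (h1.mul (by fun_prop)))
  let π2 : Angle := ⟨2 * Real.pi, two_pi_nonneg, le_rfl⟩
  let J : ℝ → ℝ := fun ε => volterra _ two_pi_nonneg ((⟨A, hA⟩ : C(_, ℝ)).comp (Γ ε)) π2
  have hJc : ContinuousAt J 0 := by
    have h1 : ContinuousAt (fun ε => (⟨A, hA⟩ : C(_, ℝ)).comp (Γ ε)) 0 :=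
      ((ContinuousMap.continuous_postcomp _).continuousAt (x := Γ 0)).comp hΓc
    have h2 := (volterra _ two_pi_nonneg).continuous.continuousAt.comp h1
    exact (ContinuousEvalConst.continuous_eval_const π2).continuousAt.comp h2
  have hJ : ∀ ε, J ε = ∫ θ in (0 : ℝ)..(2 * Real.pi), A (Γ ε (projIcc 0 _ two_pi_nonneg θ)) :=
    fun ε => rfl
  have hJ0 : J 0 = ∫ θ in (0 : ℝ)..(2 * Real.pi), q k (ovalX h θ) (ovalZ h θ) *
      (p.g (ovalX h θ) (ovalZ h θ) * ovalX' h θ - p.f (ovalX h θ) (ovalZ h θ) * ovalZ' h θ) := by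
    rw [hJ]
    refine intervalIntegral.integral_congr fun θ hθ => ?_
    rw [uIcc_of_le two_pi_nonneg] at hθ
    simp only [projIcc_of_mem _ hθ, hΓ0]
    rfl
  rw [← hJ0]
  -- Both ends of the arc lie on y = 0, so the change of `Q i` over one turn depends on ε only
  -- through the displacement.
  let D : ℕ → ℝ → ℝ := fun i e => Q i (xR (h + e)) 0 - Q i (xR h) 0
  have hident : ∀ᶠ ε in 𝓝 (0 : ℝ),
      d ε - ∑ i ∈ Finset.range k, ε ^ (i + 1) * D i (d ε) = ε ^ (k + 1) * J ε := by
    filter_upwards [hev] with ε hε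
    obtain ⟨-, hgt, x, y, x', y', harc, hΓε, hx0, hy0, hx1, hy1⟩ := hε
    -- Since dH = εω and dQ_i = q_i ω − q_{i+1} dH on the orbit, the derivative telescopes to
    -- ε^{k+1} q_k ω.
    let Kf : ℝ → ℝ := fun θ => Ham (x θ) (y θ)
      - ∑ i ∈ Finset.range k, ε ^ (i + 1) * Q i (x θ) (y θ)
    have hKd : ∀ t : Angle, HasDerivAt Kf (ε ^ (k + 1) * A (Γ ε t)) t := by
      intro t
      have hx := harc.hx t t.2
      have hy := harc.hy t t.2
      have hH : HasDerivAt (fun θ => Ham (x θ) (y θ))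
          ((x t ^ 3 - x t) * x' t + y t * y' t) t := by
        refine ((((hy.fun_pow 2).div_const 2).fun_sub ((hx.fun_pow 2).div_const 2)).fun_add
          ((hx.fun_pow 4).div_const 4)).congr_deriv ?_
        norm_num; ring
      have hS := HasDerivAt.fun_sum (u := Finset.range k) fun i hi =>
        (hstep i (Finset.mem_range.1 hi) x y _ _ t hx hy).const_mul (ε ^ (i + 1))
      refine (hH.fun_sub hS).congr_deriv ?_
      have hen := harc.energy t t.2
      rw [hΓε]
      set W := p.g (x t) (y t) * x' t - p.f (x t) (y t) * y' t
      simp only [hen]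
      have htel : ∀ n, ∑ i ∈ Finset.range n, ε ^ (i + 1) * (q i (x t) (y t) * W
          - q (i + 1) (x t) (y t) * (ε * W)) = ε * W - ε ^ (n + 1) * (q n (x t) (y t) * W) := by
        intro n
        induction n with
        | zero => simp [hq0]
        | succ n ih => rw [Finset.sum_range_succ, ih]; ring
      rw [htel]
      simp only [A, W]
      ring
    have hint : ∫ θ in (0 : ℝ)..(2 * Real.pi), ε ^ (k + 1) * A (Γ ε (projIcc 0 _ two_pi_nonneg θ))
        = Kf (2 * Real.pi) - Kf 0 := by
      refine intervalIntegral.integral_eq_sub_of_hasDerivAt (fun θ hθ => ?_) ?_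
      · rw [uIcc_of_le two_pi_nonneg] at hθ
        rw [projIcc_of_mem _ hθ]
        exact hKd ⟨θ, hθ⟩
      · refine Continuous.intervalIntegrable ?_ _ _
        exact continuous_const.mul (hA.comp ((Γ ε).continuous.comp continuous_projIcc))
    rw [intervalIntegral.integral_const_mul, ← hJ] at hint
    rw [hint]
    simp only [Kf, hx0, hy0, hx1, hy1, D]
    rw [Ham_xR hgt.le, Ham_xR hh.1.le]
    simp only [mul_sub, Finset.sum_sub_distrib]
    ring
  have hd0 : d 0 = 0 := by
    have := hident.self_of_nhds
    simpa using this
  have hdt : Tendsto d (𝓝 0) (𝓝 0) := by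
    have := hda.continuousAt.tendsto
    rwa [show d 0 = 0 from hd0] at this
  -- `D i` vanishes at 0 and is differentiable there, so the corrections ε^{i+1} D_i(d) are o(d).
  have hD : ∀ i < k, (fun ε => D i (d ε)) =O[𝓝 0] d := by
    intro i hi
    have hx : HasDerivAt (fun e => xR (h + e)) (deriv xR (h + 0)) 0 := by
      have h1 : HasDerivAt xR (deriv xR (h + 0)) (h + 0) :=
        (differentiableAt_xR (by rw [add_zero]; exact hh.1)).hasDerivAt
      exact HasDerivAt.comp_const_add h 0 h1
    have h2 := (hstep i hi _ _ _ _ 0 hx (hasDerivAt_const (0 : ℝ) (0 : ℝ))).differentiableAt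
    have h3 := h2.isBigO_sub
    have h4 : (fun e => D i e) =O[𝓝 0] (fun e => e) := by
      refine (h3.congr_left fun e => ?_).congr_right fun e => sub_zero e
      simp [D]
    exact h4.comp_tendsto hdt
  have hR : (fun ε => ∑ i ∈ Finset.range k, ε ^ (i + 1) * D i (d ε)) =o[𝓝 0] d := by
    refine IsLittleO.fun_sum fun i hi => ?_
    have h1 : (fun ε : ℝ => ε ^ (i + 1)) =o[𝓝 0] (fun _ => (1 : ℝ)) := by
      refine (isLittleO_one_iff ℝ).2 ?_
      exact (continuous_pow (i + 1)).tendsto' _ _ (by simp)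
    simpa using h1.mul_isBigO (hD i (Finset.mem_range.1 hi))
  have hsub : (fun ε => d ε - ∑ i ∈ Finset.range k, ε ^ (i + 1) * D i (d ε))
      =O[𝓝 0] (fun ε : ℝ => ε ^ (k + 1)) := by
    have h1 : (fun ε : ℝ => ε ^ (k + 1) * J ε) =O[𝓝 0] (fun ε : ℝ => ε ^ (k + 1)) := by
      simpa using (isBigO_refl (fun ε : ℝ => ε ^ (k + 1)) (𝓝 0)).mul
        (hJc.tendsto.isBigO_one ℝ)
    exact h1.congr' (hident.mono fun ε h => h.symm) EventuallyEq.rfl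
  -- Removing o(d) does not change the order of d; once d = O(ε^{k+1}), the corrections are
  -- o(ε^{k+1}) and the leading coefficient is `J 0`.
  have hdO : d =O[𝓝 0] (fun ε : ℝ => ε ^ (k + 1)) := hR.right_isBigO_sub.trans hsub
  have hfin : (fun ε => d ε - J 0 * ε ^ (k + 1)) =o[𝓝 0] (fun ε : ℝ => ε ^ (k + 1)) := by
    have h1 := hR.trans_isBigO hdO
    have h2 : (fun ε : ℝ => ε ^ (k + 1) * (J ε - J 0)) =o[𝓝 0] (fun ε : ℝ => ε ^ (k + 1)) := by
      have h3 : (fun ε => J ε - J 0) =o[𝓝 0] (fun _ => (1 : ℝ)) := by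
        refine (isLittleO_one_iff ℝ).2 ?_
        simpa using hJc.tendsto.sub_const (J 0)
      simpa using (isBigO_refl (fun ε : ℝ => ε ^ (k + 1)) (𝓝 0)).mul_isLittleO h3
    refine (h1.add h2).congr' ?_ EventuallyEq.rfl
    filter_upwards [hident] with ε hε
    rw [mul_sub, ← hε]; ring
  obtain ⟨r1, r2⟩ := coeff_of_isLittleO hda hfin
  exact ⟨fun j hj => r1 j (by omega), r2⟩

/-- The Taylor series of the displacement; its zeroth term is removed by the chain of length zero.
-/
theorem eventually_hasSum_displacement (p : CubicPerturbation) {h : ℝ} (hh : h ∈ Sig) :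
    ∀ᶠ ε in 𝓝 (0 : ℝ), (∃ h', IsFirstReturn p 1 ε h h') ∧
      HasSum (fun k : ℕ => ε ^ (k + 1) * M p (k + 1) h) (displacement p 1 h ε) := by
  obtain ⟨hda, Γ, hΓc, hΓ0, hev⟩ := exists_orbit p hh
  have h0 : M p 0 h = 0 :=
    (melnikov_of_chain p 0 (fun _ _ _ => 1) (fun _ _ _ => 0) (fun _ _ => rfl) continuous_const
      (fun i hi => absurd hi (Nat.not_lt_zero i)) hh).1 0 le_rfl
  have hs := hda.hasFPowerSeriesAt.eventually_hasSum
  filter_upwards [hev, hs] with ε h1 h2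
  refine ⟨h1.1, ?_⟩
  have h3 : HasSum (fun k : ℕ => ε ^ k * M p k h) (displacement p 1 h ε) := by
    rw [zero_add] at h2
    simpa [FormalMultilinearSeries.ofScalars, M, melnikov, mul_comm] using h2
  rw [hasSum_nat_add_iff (f := fun k : ℕ => ε ^ k * M p k h) 1]
  simpa [h0] using h3

/-! ### The ovals and the integrals I_k in polar coordinates -/

theorem ovalX_pos {h : ℝ} (hh : h ∈ Sig) (θ : ℝ) : 0 < ovalX h θ :=
  Real.sqrt_pos.2 (abs_two_mul_cos_lt (radius_pos hh) (radius_lt hh) θ)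

theorem ovalX_sq {h : ℝ} (hh : h ∈ Sig) (θ : ℝ) :
    ovalX h θ ^ 2 = 1 + 2 * (radius h * Real.cos θ) :=
  Real.sq_sqrt (abs_two_mul_cos_lt (radius_pos hh) (radius_lt hh) θ).le

theorem ovalZ_sq (h θ : ℝ) : ovalZ h θ ^ 2 = 2 * (radius h * Real.sin θ) ^ 2 := by
  rw [ovalZ, mul_pow, neg_sq, Real.sq_sqrt (by norm_num)]

theorem Ham_oval {h : ℝ} (hh : h ∈ Sig) (θ : ℝ) : Ham (ovalX h θ) (ovalZ h θ) = h := by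
  have h4 : ovalX h θ ^ 4 = (1 + 2 * (radius h * Real.cos θ)) ^ 2 := by
    rw [← ovalX_sq hh]; ring
  rw [Ham, h4, ovalX_sq hh, ovalZ_sq]
  have := radius_sq hh
  linear_combination radius h ^ 2 * Real.sin_sq_add_cos_sq θ + this

theorem hasDerivAt_ovalX {h : ℝ} (hh : h ∈ Sig) (θ : ℝ) :
    HasDerivAt (ovalX h) (ovalX' h θ) θ := by
  have hw := abs_two_mul_cos_lt (radius_pos hh) (radius_lt hh) θ
  refine (((((Real.hasDerivAt_cos θ).const_mul (radius h)).const_mul 2).const_add 1).sqrt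
    hw.ne').congr_deriv ?_
  have hx := ovalX_pos hh θ
  have h2 : √2 ^ 2 = (2 : ℝ) := Real.sq_sqrt (by norm_num)
  have h2p : 0 < √(2 : ℝ) := by positivity
  change _ / (2 * ovalX h θ) = _
  rw [ovalX', ovalZ]
  field_simp

theorem hasDerivAt_ovalZ {h : ℝ} (hh : h ∈ Sig) (θ : ℝ) :
    HasDerivAt (ovalZ h) (ovalZ' h θ) θ := by
  refine (((Real.hasDerivAt_sin θ).const_mul (radius h)).const_mul (-√2)).congr_deriv ?_
  have hx := ovalX_pos hh θ
  have h2 : √2 ^ 2 = (2 : ℝ) := Real.sq_sqrt (by norm_num)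
  have h2p : 0 < √(2 : ℝ) := by positivity
  rw [ovalZ']
  field_simp
  rw [h2, ovalX_sq hh]
  ring

theorem continuous_ovalX (h : ℝ) : Continuous (ovalX h) := by unfold ovalX; fun_prop
theorem continuous_ovalZ (h : ℝ) : Continuous (ovalZ h) := by unfold ovalZ; fun_prop

theorem continuous_ovalX' {h : ℝ} (hh : h ∈ Sig) : Continuous (ovalX' h) := by
  have h1 := continuous_ovalX h
  have h2 := continuous_ovalZ h
  unfold ovalX'
  exact h2.mul ((continuous_const.mul h1).inv₀ fun θ =>
    mul_ne_zero (by positivity) (ovalX_pos hh θ).ne')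

theorem continuous_ovalZ' {h : ℝ} (hh : h ∈ Sig) : Continuous (ovalZ' h) := by
  have h1 := continuous_ovalX h
  unfold ovalZ'
  exact (h1.sub (h1.pow 3)).mul ((continuous_const.mul h1).inv₀ fun θ =>
    mul_ne_zero (by positivity) (ovalX_pos hh θ).ne')

theorem ovalY_ovalX {h : ℝ} (hh : h ∈ Sig) (θ : ℝ) : ovalY h (ovalX h θ) = |ovalZ h θ| := by
  have := Ham_oval hh θ
  rw [Ham] at this
  rw [ovalY, ← Real.sqrt_sq_eq_abs]
  congr 1
  linarith

/-- `I_k` in polar coordinates. -/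
theorem I_eq (k : ℕ) {h : ℝ} (hh : h ∈ Sig) :
    I k h = ∫ θ in (0 : ℝ)..(2 * Real.pi), ovalX h θ ^ k * ovalZ h θ * ovalX' h θ := by
  let F : ℝ → ℝ := fun x => x ^ k * ovalY h x
  have hF : Continuous F := by unfold F ovalY; fun_prop
  have hc := continuous_ovalX' hh
  have hsub : ∀ a b : ℝ, ∫ θ in a..b, F (ovalX h θ) * ovalX' h θ
      = ∫ x in (ovalX h a)..(ovalX h b), F x := fun a b =>
    intervalIntegral.integral_comp_mul_deriv (fun θ _ => hasDerivAt_ovalX hh θ) hc.continuousOn hF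
  have hr := radius_pos hh
  have hs4 : √(1 + 4 * h) = 2 * radius h := by
    rw [show 1 + 4 * h = (2 * radius h) ^ 2 by rw [mul_pow, radius_sq hh]; ring,
      Real.sqrt_sq (by linarith)]
  have e0 : ovalX h 0 = xR h := by simp [ovalX, xR, hs4]
  have e1 : ovalX h Real.pi = xL h := by simp [ovalX, xL, hs4, sub_eq_add_neg]
  have e2 : ovalX h (2 * Real.pi) = xR h := by simp [ovalX, xR, hs4]
  have hcont : Continuous fun θ => ovalX h θ ^ k * ovalZ h θ * ovalX' h θ :=
    (((continuous_ovalX h).pow k).mul (continuous_ovalZ h)).mul hc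
  have hint : ∀ a b : ℝ, IntervalIntegrable (fun θ => ovalX h θ ^ k * ovalZ h θ * ovalX' h θ)
    MeasureTheory.volume a b := fun a b => hcont.intervalIntegrable a b
  -- The arc 0 ≤ θ ≤ π is the lower half of the oval, run from right to left; the arc π ≤ θ ≤ 2π is
  -- the upper half, run from left to right.
  have h1 : ∫ θ in (0 : ℝ)..Real.pi, ovalX h θ ^ k * ovalZ h θ * ovalX' h θ
      = ∫ x in (xL h)..(xR h), F x := by
    rw [intervalIntegral.integral_symm, ← e0, ← e1, ← hsub, ← intervalIntegral.integral_neg]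
    refine intervalIntegral.integral_congr fun θ hθ => ?_
    rw [uIcc_comm, uIcc_of_le Real.pi_pos.le] at hθ
    have hs := Real.sin_nonneg_of_mem_Icc hθ
    have hz : ovalZ h θ ≤ 0 := by
      unfold ovalZ
      have : 0 ≤ √2 * (radius h * Real.sin θ) := by positivity
      linarith
    simp only [F, ovalY_ovalX hh, abs_of_nonpos hz]
    ring
  have h2 : ∫ θ in Real.pi..(2 * Real.pi), ovalX h θ ^ k * ovalZ h θ * ovalX' h θ
      = ∫ x in (xL h)..(xR h), F x := by
    rw [← e1, ← e2, ← hsub]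
    refine intervalIntegral.integral_congr fun θ hθ => ?_
    rw [uIcc_of_le (by linarith [Real.pi_pos])] at hθ
    have hs : Real.sin θ ≤ 0 := by
      rw [← Real.sin_sub_two_pi]
      exact Real.sin_nonpos_of_nonpos_of_neg_pi_le (by linarith [hθ.2]) (by linarith [hθ.1])
    have hz : 0 ≤ ovalZ h θ := by
      unfold ovalZ
      have : 0 ≤ √2 * (radius h * -Real.sin θ) :=
        mul_nonneg (by positivity) (mul_nonneg hr.le (by linarith))
      linarith
    simp only [F, ovalY_ovalX hh, abs_of_nonneg hz]
  rw [← intervalIntegral.integral_add_adjacent_intervals (hint 0 Real.pi) (hint _ _), h1, h2, I,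
    ovalIntegral]
  rw [← intervalIntegral.integral_add (hF.intervalIntegrable _ _) (hF.intervalIntegrable _ _)]
  refine intervalIntegral.integral_congr fun x _ => ?_
  simp only [F]
  ring

theorem level_oval (h θ : ℝ) :
    (ovalX h θ ^ 3 - ovalX h θ) * ovalX' h θ + ovalZ h θ * ovalZ' h θ = 0 := by
  rw [ovalX', ovalZ']; ring

/-- The first nonvanishing coefficient of the displacement map, as a combination of the integrals
`I₀, I₁, I₂`. -/
theorem melnikov_value (p : CubicPerturbation) (k : ℕ) (q Q : ℕ → ℝ → ℝ → ℝ)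
    (hq0 : ∀ x y, q 0 x y = 1) (hqc : Continuous fun z : ℝ × ℝ => q k z.1 z.2)
    (hstep : ∀ i < k, IsStep p (q i) (Q i) (q (i + 1))) {h : ℝ} (hh : h ∈ Sig)
    (R : ℝ → ℝ → ℝ) (c₀ c₁ c₂ : ℝ)
    (hR : ∀ (x y : ℝ → ℝ) (x' y' t : ℝ), HasDerivAt x x' t → HasDerivAt y y' t →
      (x t ^ 3 - x t) * x' + y t * y' = 0 → Ham (x t) (y t) = h →
      HasDerivAt (fun s => R (x s) (y s))
        (q k (x t) (y t) * (p.g (x t) (y t) * x' - p.f (x t) (y t) * y')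
          - (c₀ + c₁ * x t + c₂ * x t ^ 2) * y t * x') t) :
    (∀ j ≤ k, M p j h = 0) ∧ M p (k + 1) h = c₀ * I 0 h + c₁ * I 1 h + c₂ * I 2 h := by
  obtain ⟨h1, h2⟩ := melnikov_of_chain p k q Q hq0 hqc hstep hh
  refine ⟨h1, ?_⟩
  have hX := continuous_ovalX h
  have hZ := continuous_ovalZ h
  have hX' := continuous_ovalX' hh
  have hZ' := continuous_ovalZ' hh
  have hcI : ∀ k : ℕ, IntervalIntegrable (fun θ => ovalX h θ ^ k * ovalZ h θ * ovalX' h θ)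
      MeasureTheory.volume 0 (2 * Real.pi) := fun k =>
    (((hX.pow k).mul hZ).mul hX').intervalIntegrable _ _
  rw [h2, I_eq 0 hh, I_eq 1 hh, I_eq 2 hh, ← intervalIntegral.integral_const_mul,
    ← intervalIntegral.integral_const_mul, ← intervalIntegral.integral_const_mul,
    ← intervalIntegral.integral_add ((hcI 0).const_mul _) ((hcI 1).const_mul _),
    ← intervalIntegral.integral_add (((hcI 0).const_mul _).add ((hcI 1).const_mul _))
      ((hcI 2).const_mul _), ← sub_eq_zero, ← intervalIntegral.integral_sub]
  -- `R` takes the same value at both ends of the closed oval, so its derivative integrates to zero.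
  · have hd := fun θ => hR (ovalX h) (ovalZ h) _ _ θ (hasDerivAt_ovalX hh θ)
      (hasDerivAt_ovalZ hh θ) (level_oval h θ) (Ham_oval hh θ)
    have hint : ∫ θ in (0 : ℝ)..(2 * Real.pi), (q k (ovalX h θ) (ovalZ h θ)
        * (p.g (ovalX h θ) (ovalZ h θ) * ovalX' h θ - p.f (ovalX h θ) (ovalZ h θ) * ovalZ' h θ)
        - (c₀ + c₁ * ovalX h θ + c₂ * ovalX h θ ^ 2) * ovalZ h θ * ovalX' h θ)
        = R (ovalX h (2 * Real.pi)) (ovalZ h (2 * Real.pi)) - R (ovalX h 0) (ovalZ h 0) := by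
      refine intervalIntegral.integral_eq_sub_of_hasDerivAt
        (f := fun s => R (ovalX h s) (ovalZ h s)) (fun θ _ => hd θ) ?_
      refine Continuous.intervalIntegrable ?_ _ _
      have hf := (continuous_f p).comp (hX.prodMk hZ)
      have hg := (continuous_g p).comp (hX.prodMk hZ)
      have hq := hqc.comp (hX.prodMk hZ)
      simp only [Function.comp_def] at hf hg hq
      fun_prop
    have e : ovalX h (2 * Real.pi) = ovalX h 0 := by simp [ovalX]
    have e' : ovalZ h (2 * Real.pi) = ovalZ h 0 := by simp [ovalZ]
    rw [e, e', sub_self] at hint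
    refine Eq.trans (intervalIntegral.integral_congr fun θ _ => ?_) hint
    ring
  · refine Continuous.intervalIntegrable ?_ _ _
    have hf := (continuous_f p).comp (hX.prodMk hZ)
    have hg := (continuous_g p).comp (hX.prodMk hZ)
    have hq := hqc.comp (hX.prodMk hZ)
    simp only [Function.comp_def] at hf hg hq
    fun_prop
  · exact ((((hcI 0).const_mul _).add ((hcI 1).const_mul _)).add ((hcI 2).const_mul _))

/-! ### Primitives and the first four coefficients for the annulus around (1, 0) -/

theorem HasDerivAt.pow_succ' {x : ℝ → ℝ} {x' t : ℝ} (hx : HasDerivAt x x' t) (n : ℕ) :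
    HasDerivAt (fun s => x s ^ (n + 1)) (((n : ℝ) + 1) * x t ^ n * x') t := by
  simpa using hx.fun_pow (n + 1)

/-- The primitive of `f` with respect to `y`. -/
def primF (p : CubicPerturbation) (x y : ℝ) : ℝ :=
  p.a 0 0 * y + p.a 0 1 * (y ^ 2 / 2) + p.a 0 2 * (y ^ 3 / 3) + p.a 0 3 * (y ^ 4 / 4)
    + p.a 1 0 * (x * y) + p.a 1 1 * (x * y ^ 2 / 2) + p.a 1 2 * (x * y ^ 3 / 3)
    + p.a 2 0 * (x ^ 2 * y) + p.a 2 1 * (x ^ 2 * y ^ 2 / 2) + p.a 3 0 * (x ^ 3 * y)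

/-- The primitive of `g(x,0)`. -/
def primB (p : CubicPerturbation) (x : ℝ) : ℝ :=
  p.b 0 0 * x + p.b 1 0 * (x ^ 2 / 2) + p.b 2 0 * (x ^ 3 / 3) + p.b 3 0 * (x ^ 4 / 4)

/-- The primitive of `λ + μ x`. -/
def primL (p : CubicPerturbation) (x : ℝ) : ℝ := p.lam * x + p.mu * (x ^ 2 / 2)

/-- The primitive of `(λ + μ x) (x² - x⁴/2)`. -/
def primE (p : CubicPerturbation) (x : ℝ) : ℝ :=
  p.lam * (x ^ 3 / 3 - x ^ 5 / 10) + p.mu * (x ^ 4 / 4 - x ^ 6 / 12)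

/-- After f dy is integrated by parts, the terms even in y are exact on a level, because y² = 2h +
x² − x⁴/2 there. Of the odd ones only y³ dx is not yet an integrand of some I_k; it is eliminated by
d(xy³) = 7y³ dx − (12h + 3x²) y dx. -/
theorem M_one (p : CubicPerturbation) {h : ℝ} (hh : h ∈ Sig) :
    M p 1 h = (p.a 1 0 + p.b 0 1 + 4 / 7 * (p.a 1 2 + 3 * p.b 0 3) * h) * I 0 h
      + (2 * p.a 2 0 + p.b 1 1) * I 1 h
      + (3 * p.a 3 0 + p.b 2 1 + 1 / 7 * (p.a 1 2 + 3 * p.b 0 3)) * I 2 h := by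
  refine (melnikov_value p 0 (fun _ _ _ => 1) (fun _ _ _ => 0) (fun _ _ => rfl) continuous_const
    (fun i hi => absurd hi (Nat.not_lt_zero i)) hh
    (fun x y => -primF p x y + primB p x + 2 * h * primL p x + primE p x
      + (p.b 0 3 + p.a 1 2 / 3) * (x * y ^ 3 / 7)) _ _ _ ?_).2
  intro x y x' y' t hx hy hl hH
  simp only [primF, primB, primL, primE]
  apply HasDerivAt.congr_deriv
  · repeat' first
      | exact hx | exact hy | apply hasDerivAt_const | apply HasDerivAt.fun_add
      | apply HasDerivAt.fun_sub | apply HasDerivAt.fun_neg | apply HasDerivAt.div_const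
      | apply HasDerivAt.pow_succ' | apply HasDerivAt.fun_mul
  · rw [p.f_eq, p.g_eq, CubicPerturbation.lam, CubicPerturbation.mu]
    rw [Ham] at hH
    push_cast
    linear_combination (-2 * (p.a 1 1 / 2 + p.b 0 2 + (p.a 2 1 + p.b 1 2) * x t) * x'
      - 12 / 7 * (p.b 0 3 + p.a 1 2 / 3) * x' * y t) * hH
      + 3 / 7 * (p.b 0 3 + p.a 1 2 / 3) * x t * y t * hl

/-- The conditions for the vanishing of the first Melnikov function. -/
structure M1Condition (p : CubicPerturbation) : Prop where
  h01 : p.a 1 0 + p.b 0 1 = 0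
  h03 : p.a 1 2 + 3 * p.b 0 3 = 0
  h11 : 2 * p.a 2 0 + p.b 1 1 = 0
  h21 : 3 * p.a 3 0 + p.b 2 1 = 0

/-- `∫_0^x e`. -/
def antideriv (e : ℝ → ℝ) (x : ℝ) : ℝ := ∫ s in (0 : ℝ)..x, e s

theorem hasDerivAt_antideriv {e : ℝ → ℝ} (he : Continuous e) {x : ℝ → ℝ} {x' t : ℝ}
    (hx : HasDerivAt x x' t) :
    HasDerivAt (fun s => antideriv e (x s)) (e (x t) * x') t :=
  (intervalIntegral.integral_hasDerivAt_right (he.intervalIntegrable _ _)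
    (he.stronglyMeasurableAtFilter _ _) he.continuousAt).comp t hx

theorem continuous_antideriv {e : ℝ → ℝ} (he : Continuous e) : Continuous (antideriv e) :=
  intervalIntegral.continuous_primitive (fun _ _ => he.intervalIntegrable _ _) 0

theorem hasDerivAt_Ham {x y : ℝ → ℝ} {x' y' t : ℝ} (hx : HasDerivAt x x' t)
    (hy : HasDerivAt y y' t) : HasDerivAt (fun s => Ham (x s) (y s))
      ((x t ^ 3 - x t) * x' + y t * y') t := by
  refine ((((hy.fun_pow 2).div_const 2).fun_sub ((hx.fun_pow 2).div_const 2)).fun_add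
    ((hx.fun_pow 4).div_const 4)).congr_deriv ?_
  norm_num; ring

section Primitives

variable (p : CubicPerturbation) {x y : ℝ → ℝ} {x' y' t : ℝ}

theorem hasDerivAt_primL (hx : HasDerivAt x x' t) :
    HasDerivAt (fun s => primL p (x s)) ((p.lam + p.mu * x t) * x') t := by
  simp only [primL]
  apply HasDerivAt.congr_deriv
  · repeat' first
      | exact hx | apply hasDerivAt_const | apply HasDerivAt.fun_add | apply HasDerivAt.div_const
      | apply HasDerivAt.pow_succ' | apply HasDerivAt.fun_mul
  · push_cast; ring

theorem hasDerivAt_primE (hx : HasDerivAt x x' t) :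
    HasDerivAt (fun s => primE p (x s))
      ((p.lam + p.mu * x t) * (x t ^ 2 - x t ^ 4 / 2) * x') t := by
  simp only [primE]
  apply HasDerivAt.congr_deriv
  · repeat' first
      | exact hx | apply hasDerivAt_const | apply HasDerivAt.fun_sub | apply HasDerivAt.fun_add
      | apply HasDerivAt.div_const | apply HasDerivAt.pow_succ' | apply HasDerivAt.fun_mul
  · push_cast; ring

theorem hasDerivAt_primB (hx : HasDerivAt x x' t) :
    HasDerivAt (fun s => primB p (x s))
      ((p.b 0 0 + p.b 1 0 * x t + p.b 2 0 * x t ^ 2 + p.b 3 0 * x t ^ 3) * x') t := by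
  simp only [primB]
  apply HasDerivAt.congr_deriv
  · repeat' first
      | exact hx | apply hasDerivAt_const | apply HasDerivAt.fun_add
      | apply HasDerivAt.div_const | apply HasDerivAt.pow_succ' | apply HasDerivAt.fun_mul
  · push_cast; ring

theorem continuous_primL : Continuous (primL p) := by unfold primL; fun_prop
theorem continuous_primE : Continuous (primE p) := by unfold primE; fun_prop
theorem continuous_primB : Continuous (primB p) := by unfold primB; fun_prop

end Primitives

/-- The primitive of `ω` modulo `dH`, if `M₁ = 0`. -/
def primQ (p : CubicPerturbation) (x y : ℝ) : ℝ :=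
  -primF p x y + primB p x + 2 * Ham x y * primL p x + primE p x

/-- With F = `primF`, the four conditions kill the odd part of g + ∂F/∂x. What remains is g(x, 0) dx
+ (λ + μx) y² dx; in it y² = 2H + x² − x⁴/2, and with L = `primL` the term 2H dL = d(2HL) − 2L dH
produces q₁ = −2L. -/
theorem isStep_primQ {p : CubicPerturbation} (hp : M1Condition p) :
    IsStep p (fun _ _ => 1) (primQ p) (fun x _ => -2 * primL p x) := by
  intro x y x' y' t hx hy
  have hL := hasDerivAt_primL p hx
  have hE := hasDerivAt_primE p hx
  have hB := hasDerivAt_primB p hx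
  have hH := hasDerivAt_Ham hx hy
  simp only [primQ, primF]
  apply HasDerivAt.congr_deriv
  · repeat' first
      | exact hx | exact hy | exact hL | exact hE | exact hB | exact hH
      | apply hasDerivAt_const | apply HasDerivAt.fun_add
      | apply HasDerivAt.fun_sub | apply HasDerivAt.fun_neg | apply HasDerivAt.div_const
      | apply HasDerivAt.pow_succ' | apply HasDerivAt.fun_mul
  · rw [p.f_eq, p.g_eq, CubicPerturbation.lam, CubicPerturbation.mu, Ham]
    push_cast
    linear_combination (-(y t) * x') * hp.h01 - (1 / 3 * y t ^ 3 * x') * hp.h03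
      - (x t * y t * x') * hp.h11 - (x t ^ 2 * y t * x') * hp.h21

/-- `a₀₁ + a₁₁ x + a₂₁ x²`. -/
def al (p : CubicPerturbation) (x : ℝ) : ℝ := p.a 0 1 + p.a 1 1 * x + p.a 2 1 * x ^ 2

/-- On a level ∮ q₁ω = −2 ∮ L dQ = 2 ∮ (λ + μx) Q dx, with L = `primL` and Q = `primQ`. The even
part of Q goes into the antiderivative of `e`; in the odd part, x³y, x⁴y and the monomials x^i y³
are reduced by the differentials of y³, xy³, x²y³, x³y³. -/
theorem M_two {p : CubicPerturbation} (hp : M1Condition p) {h : ℝ} (hh : h ∈ Sig) :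
    M p 2 h = (-2 * p.a 0 0 * p.lam + (-(8 / 7) * p.a 0 2 * p.lam
        - (8 / 7 * p.a 3 0 + 8 / 63 * p.a 1 2) * p.mu) * h) * I 0 h
      + (-2 * (p.a 1 0 + p.a 3 0 + 1 / 8 * p.a 1 2) * p.lam
          - 2 * (p.a 0 0 + p.a 2 0 + 1 / 8 * p.a 0 2) * p.mu
          + (-p.a 1 2 * p.lam - p.a 0 2 * p.mu) * h) * I 1 h
      + (-2 * (p.a 2 0 + 1 / 7 * p.a 0 2) * p.lam
          - 2 * (p.a 1 0 + 8 / 7 * p.a 3 0 + 8 / 63 * p.a 1 2) * p.mu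
          + -(8 / 9) * p.a 1 2 * p.mu * h) * I 2 h := by
  have hLc := continuous_primL p
  have hEc := continuous_primE p
  have hBc := continuous_primB p
  let e : ℝ → ℝ := fun x => 2 * (p.lam + p.mu * x) * (primB p x + 2 * h * primL p x + primE p x
    - al p x / 2 * (2 * h + x ^ 2 - x ^ 4 / 2) - p.a 0 3 / 4 * (2 * h + x ^ 2 - x ^ 4 / 2) ^ 2)
  have he : Continuous e := by unfold e al; fun_prop
  refine (melnikov_value p 1 (fun i x _ => if i = 0 then 1 else -2 * primL p x)
    (fun _ => primQ p) (fun _ _ => rfl) ?_ ?_ hh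
    (fun x y => -2 * primL p x * primQ p x y + antideriv e x
      + (-2 * (p.lam * p.a 3 0 + p.mu * p.a 2 0)) * (-y ^ 3 / 3)
      + (-2 * p.mu * p.a 3 0) * (-2 * (x * y ^ 3) / 7)
      + (-2 / 3 * p.lam * p.a 0 2) * (x * y ^ 3 / 7)
      + (-2 / 3 * (p.lam * p.a 1 2 + p.mu * p.a 0 2)) * (x ^ 2 * y ^ 3 / 8 - y ^ 3 / 8)
      + (-2 / 3 * p.mu * p.a 1 2) * (x ^ 3 * y ^ 3 / 9 - 2 * (x * y ^ 3) / 21)) _ _ _ ?_).2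
  · exact continuous_const.mul (hLc.comp continuous_fst)
  · intro i hi
    obtain rfl : i = 0 := by omega
    simpa using isStep_primQ hp
  intro x y x' y' t hx hy hl hH
  have hL := hasDerivAt_primL p hx
  have hA := hasDerivAt_antideriv he hx
  have hQ := isStep_primQ hp x y x' y' t hx hy
  apply HasDerivAt.congr_deriv
  · repeat' first
      | exact hx | exact hy | exact hL | exact hA | exact hQ
      | apply hasDerivAt_const | apply HasDerivAt.fun_add
      | apply HasDerivAt.fun_sub | apply HasDerivAt.fun_neg | apply HasDerivAt.div_const
      | apply HasDerivAt.pow_succ' | apply HasDerivAt.fun_mul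
  · simp only [e, al, primQ, primF, one_ne_zero, if_false]
    rw [← hH, Ham]
    push_cast
    linear_combination (-4 * primL p (x t) ^ 2
      + 2 * (p.lam * p.a 3 0 + p.mu * p.a 2 0) * y t
      + (-2 * p.mu * p.a 3 0) * (-6 / 7 * x t * y t)
      + (-2 / 3 * p.lam * p.a 0 2) * (3 / 7 * x t * y t)
      + (-2 / 3 * (p.lam * p.a 1 2 + p.mu * p.a 0 2)) * (3 / 8 * x t ^ 2 * y t - 3 / 8 * y t)
      + (-2 / 3 * p.mu * p.a 1 2) * (1 / 3 * x t ^ 3 * y t - 2 / 7 * x t * y t)) * hl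

/-- The factor of `y` in the odd part of `primQ`, if `M₂ = 0`. -/
def cP (p : CubicPerturbation) (x : ℝ) : ℝ :=
  -(p.a 0 0 + p.a 1 0 * x + p.a 2 0 * x ^ 2 + p.a 3 0 * x ^ 3)

/-- The conditions for the vanishing of the first two Melnikov functions, with the trivial case
`λ = μ = 0` excluded. -/
structure M2Nontrivial (p : CubicPerturbation) : Prop extends M1Condition p where
  h02 : p.a 0 2 = 0
  h12 : p.a 1 2 = 0
  hc : ∀ x, 2 * (p.lam + p.mu * x) * cP p x = p.m * (x ^ 3 - x)

/-- A primitive of `2 (λ + μ x)(a₀₁ + a₁₁ x + a₂₁ x²)`. -/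
def primN (p : CubicPerturbation) (x : ℝ) : ℝ :=
  2 * (p.lam * p.a 0 1 * x + (p.lam * p.a 1 1 + p.mu * p.a 0 1) * (x ^ 2 / 2)
    + (p.lam * p.a 2 1 + p.mu * p.a 1 1) * (x ^ 3 / 3) + p.mu * p.a 2 1 * (x ^ 4 / 4))

theorem hasDerivAt_primN (p : CubicPerturbation) {x : ℝ → ℝ} {x' t : ℝ} (hx : HasDerivAt x x' t) :
    HasDerivAt (fun s => primN p (x s)) (2 * (p.lam + p.mu * x t) * al p (x t) * x') t := by
  simp only [primN, al]
  apply HasDerivAt.congr_deriv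
  · repeat' first
      | exact hx | apply hasDerivAt_const | apply HasDerivAt.fun_add
      | apply HasDerivAt.div_const | apply HasDerivAt.pow_succ' | apply HasDerivAt.fun_mul
  · push_cast; ring

theorem hasDerivAt_cP (p : CubicPerturbation) {x : ℝ → ℝ} {x' t : ℝ} (hx : HasDerivAt x x' t) :
    HasDerivAt (fun s => cP p (x s))
      (-(p.a 1 0 + 2 * p.a 2 0 * x t + 3 * p.a 3 0 * x t ^ 2) * x') t := by
  simp only [cP]
  apply HasDerivAt.congr_deriv
  · repeat' first
      | exact hx | apply hasDerivAt_const | apply HasDerivAt.fun_neg | apply HasDerivAt.fun_add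
      | apply HasDerivAt.div_const | apply HasDerivAt.pow_succ' | apply HasDerivAt.fun_mul
  · push_cast; ring

theorem hasDerivAt_al (p : CubicPerturbation) {x : ℝ → ℝ} {x' t : ℝ} (hx : HasDerivAt x x' t) :
    HasDerivAt (fun s => al p (x s)) ((p.a 1 1 + 2 * p.a 2 1 * x t) * x') t := by
  simp only [al]
  apply HasDerivAt.congr_deriv
  · repeat' first
      | exact hx | apply hasDerivAt_const | apply HasDerivAt.fun_add
      | apply HasDerivAt.div_const | apply HasDerivAt.pow_succ' | apply HasDerivAt.fun_mul
  · push_cast; ring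

theorem continuous_primN (p : CubicPerturbation) : Continuous (primN p) := by
  unfold primN; fun_prop
theorem continuous_cP (p : CubicPerturbation) : Continuous (cP p) := by unfold cP; fun_prop
theorem continuous_al (p : CubicPerturbation) : Continuous (al p) := by unfold al; fun_prop
theorem continuous_Ham : Continuous fun z : ℝ × ℝ => Ham z.1 z.2 := by unfold Ham; fun_prop

/-- The coefficients, as a polynomial in `H`, of the even part of `primQ`. -/
def kQ0 (p : CubicPerturbation) (x : ℝ) : ℝ := primB p x + primE p x
  - al p x * (x ^ 2 - x ^ 4 / 2) / 2 - p.a 0 3 * (x ^ 2 - x ^ 4 / 2) ^ 2 / 4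
/-- The coefficient of `H` of the even part of `primQ`. -/
def kQ1 (p : CubicPerturbation) (x : ℝ) : ℝ :=
  2 * primL p x - al p x - p.a 0 3 * (x ^ 2 - x ^ 4 / 2)

theorem continuous_kQ0 (p : CubicPerturbation) : Continuous (kQ0 p) := by
  have := continuous_primB p; have := continuous_primE p; have := continuous_al p
  unfold kQ0; fun_prop
theorem continuous_kQ1 (p : CubicPerturbation) : Continuous (kQ1 p) := by
  have := continuous_primL p; have := continuous_al p
  unfold kQ1; fun_prop

theorem primQ_eq {p : CubicPerturbation} (hp : M2Nontrivial p) (x y : ℝ) :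
    primQ p x y = cP p x * y + kQ0 p x + kQ1 p x * Ham x y - p.a 0 3 * Ham x y ^ 2 := by
  simp only [primQ, primF, cP, kQ0, kQ1, hp.h02, hp.h12, al, Ham]
  ring

/-- The function `q₂` of the recursive procedure. -/
def q2 (p : CubicPerturbation) (x y : ℝ) : ℝ :=
  2 * primL p x ^ 2 + primN p x + 2 * p.a 0 3 * primE p x + 4 * p.a 0 3 * Ham x y * primL p x
    + p.m * y

/-- The function `Q₂` of the recursive procedure. -/
def Q2 (p : CubicPerturbation) (x y : ℝ) : ℝ :=
  -2 * primL p x * primQ p x y - p.m * (y ^ 3 / 3)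
    + antideriv (fun s => 2 * (p.lam + p.mu * s) * kQ0 p s) x
    + Ham x y * (2 * primL p x ^ 2 - primN p x - 2 * p.a 0 3 * primE p x)
    + Ham x y ^ 2 * (-2 * p.a 0 3 * primL p x)

/-- The relation `hc` gives 2(λ + μx) c y dx = m(x³ − x) y dx = m(y dH − y² dy): hence the term m y
of `q2` and the term m y³/3 of `Q2`. The even part of `primQ` is a polynomial in H over functions of
x (`primQ_eq`), and its terms are integrated by parts against powers of H. -/
theorem isStep_Q2 {p : CubicPerturbation} (hp : M2Nontrivial p) :
    IsStep p (fun x _ => -2 * primL p x) (Q2 p) (q2 p) := by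
  intro x y x' y' t hx hy
  have hL := hasDerivAt_primL p hx
  have hE := hasDerivAt_primE p hx
  have hN := hasDerivAt_primN p hx
  have hH := hasDerivAt_Ham hx hy
  have hQ := isStep_primQ hp.toM1Condition x y x' y' t hx hy
  have hk := continuous_kQ0 p
  have hA := hasDerivAt_antideriv (e := fun s => 2 * (p.lam + p.mu * s) * kQ0 p s)
    (by fun_prop) hx
  simp only [Q2]
  apply HasDerivAt.congr_deriv
  · repeat' first
      | exact hx | exact hy | exact hL | exact hE | exact hN | exact hH | exact hQ | exact hA
      | apply hasDerivAt_const | apply HasDerivAt.fun_sub | apply HasDerivAt.fun_add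
      | apply HasDerivAt.fun_neg | apply HasDerivAt.div_const
      | apply HasDerivAt.pow_succ' | apply HasDerivAt.fun_mul
  · rw [primQ_eq hp]
    have hc := hp.hc (x t)
    simp only [q2, kQ1, Ham]
    push_cast
    linear_combination (-(x' * y t)) * hc

theorem continuous_q2 (p : CubicPerturbation) : Continuous fun z : ℝ × ℝ => q2 p z.1 z.2 := by
  have h1 := (continuous_primL p).comp (continuous_fst (X := ℝ) (Y := ℝ))
  have h2 := (continuous_primN p).comp (continuous_fst (X := ℝ) (Y := ℝ))
  have h3 := (continuous_primE p).comp (continuous_fst (X := ℝ) (Y := ℝ))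
  have h4 := continuous_Ham
  simp only [Function.comp_def] at h1 h2 h3
  unfold q2
  fun_prop

/-- The sequence of the functions `q_i`. -/
def qChain (p : CubicPerturbation) (q3 : ℝ → ℝ → ℝ) : ℕ → ℝ → ℝ → ℝ
  | 0 => fun _ _ => 1
  | 1 => fun x _ => -2 * primL p x
  | 2 => q2 p
  | _ => q3

/-- The sequence of the functions `Q_i`. -/
def QChain (p : CubicPerturbation) (Q3 : ℝ → ℝ → ℝ) : ℕ → ℝ → ℝ → ℝ
  | 0 => primQ p
  | 1 => Q2 p
  | _ => Q3

theorem isStep_chain {p : CubicPerturbation} (hp : M2Nontrivial p) {q3 Q3 : ℝ → ℝ → ℝ}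
    (h3 : IsStep p (q2 p) Q3 q3) :
    ∀ i < 3, IsStep p (qChain p q3 i) (QChain p Q3 i) (qChain p q3 (i + 1)) := by
  intro i hi
  interval_cases i
  · exact isStep_primQ hp.toM1Condition
  · exact isStep_Q2 hp
  · exact h3

/-- The derivative of the even part of `primQ` along a curve. -/
theorem hasDerivAt_even {p : CubicPerturbation} (hp : M2Nontrivial p) {x y : ℝ → ℝ} {x' y' t : ℝ}
    (hx : HasDerivAt x x' t) (hy : HasDerivAt y y' t) :
    HasDerivAt (fun s => primQ p (x s) (y s) - cP p (x s) * y s)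
      ((p.b 0 0 + p.b 1 0 * x t + p.b 2 0 * x t ^ 2 + p.b 3 0 * x t ^ 3
        + y t ^ 2 * (p.lam + p.mu * x t - (p.a 1 1 + 2 * p.a 2 1 * x t) / 2)) * x'
        + 2 * primL p (x t) * ((x t ^ 3 - x t) * x' + y t * y')
        - (al p (x t) + p.a 0 3 * y t ^ 2) * (y t * y')) t := by
  have hL := hasDerivAt_primL p hx
  have hE := hasDerivAt_primE p hx
  have hB := hasDerivAt_primB p hx
  have hH := hasDerivAt_Ham hx hy
  have ha := hasDerivAt_al p hx
  have h0 : (fun s => primQ p (x s) (y s) - cP p (x s) * y s) = fun s => primB p (x s)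
      + primE p (x s) + 2 * Ham (x s) (y s) * primL p (x s) - al p (x s) * (y s ^ 2 / 2)
      - p.a 0 3 * (y s ^ 4 / 4) := by
    funext s
    rw [primQ_eq hp]
    simp only [kQ0, kQ1, Ham]
    ring
  rw [h0]
  apply HasDerivAt.congr_deriv
  · repeat' first
      | exact hx | exact hy | exact hL | exact hE | exact hB | exact hH | exact ha
      | apply hasDerivAt_const | apply HasDerivAt.fun_sub | apply HasDerivAt.fun_add
      | apply HasDerivAt.div_const | apply HasDerivAt.pow_succ' | apply HasDerivAt.fun_mul
  · simp only [Ham]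
    push_cast
    ring

/-- On a level ∮ q₂ω = −∮ Q dq₂ with Q = `primQ`. The odd part c y of Q is handled by `hc`, and the
even part E meets the term m dy of dq₂, giving m ∮ y dE. Integration by parts leaves m ∮ [g(x, 0) y
+ (λ/3 − a₁₁/2 + (μ/3 − a₂₁) x) y³] dx. -/
theorem M_three_nontrivial {p : CubicPerturbation} (hp : M2Nontrivial p) {h : ℝ} (hh : h ∈ Sig) :
    M p 3 h = (p.m * p.b 0 0 + p.m * (4 / 7 * p.lam - 6 / 7 * p.a 1 1) * h) * I 0 h
      + (p.m * (p.b 1 0 + p.b 3 0 + 1 / 8 * p.mu - 3 / 8 * p.a 2 1)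
          + p.m * (1 / 2 * p.mu - 3 / 2 * p.a 2 1) * h) * I 1 h
      + p.m * (p.b 2 0 + 1 / 7 * p.lam - 3 / 14 * p.a 1 1) * I 2 h := by
  have hLc := continuous_primL p
  have hac := continuous_al p
  have hcc := continuous_cP p
  have hk0 := continuous_kQ0 p
  have hk1 := continuous_kQ1 p
  let e : ℝ → ℝ := fun x => p.m * cP p x * (x ^ 3 - x)
    - (kQ0 p x + kQ1 p x * h - p.a 0 3 * h ^ 2) * (p.lam + p.mu * x)
      * (4 * primL p x + 2 * al p x + 2 * p.a 0 3 * (2 * h + x ^ 2 - x ^ 4 / 2))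
  have he : Continuous e := by unfold e; fun_prop
  refine (melnikov_value p 2 (qChain p 0) (QChain p 0) (fun _ _ => rfl) (continuous_q2 p)
    ?_ hh
    (fun x y => q2 p x y * primQ p x y + 2 / 3 * p.m * primL p x * y ^ 3
      - p.m * (primQ p x y - cP p x * y) * y + antideriv e x
      + p.m * p.b 3 0 * (-y ^ 3 / 3)
      + p.m * (p.lam / 3 - p.a 1 1 / 2) * (x * y ^ 3 / 7)
      + p.m * (p.mu / 3 - p.a 2 1) * (x ^ 2 * y ^ 3 / 8 - y ^ 3 / 8)) _ _ _ ?_).2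
  · intro i hi
    interval_cases i
    · exact isStep_primQ hp.toM1Condition
    · exact isStep_Q2 hp
  intro x y x' y' t hx hy hl hH
  have hL := hasDerivAt_primL p hx
  have hE := hasDerivAt_primE p hx
  have hN := hasDerivAt_primN p hx
  have hB := hasDerivAt_primB p hx
  have hc' := hasDerivAt_cP p hx
  have hHd := hasDerivAt_Ham hx hy
  have hA := hasDerivAt_antideriv he hx
  have hQ := isStep_primQ hp.toM1Condition x y x' y' t hx hy
  -- the even part of `primQ`
  have hQe : HasDerivAt (fun s => primQ p (x s) (y s) - cP p (x s) * y s)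
      ((p.b 0 0 + p.b 1 0 * x t + p.b 2 0 * x t ^ 2 + p.b 3 0 * x t ^ 3
        + y t ^ 2 * (p.lam + p.mu * x t - (p.a 1 1 + 2 * p.a 2 1 * x t) / 2)) * x'
        + 2 * primL p (x t) * ((x t ^ 3 - x t) * x' + y t * y')
        - (al p (x t) + p.a 0 3 * y t ^ 2) * (y t * y')) t := hasDerivAt_even hp hx hy
  simp only [q2]
  apply HasDerivAt.congr_deriv
  · repeat' first
      | exact hx | exact hy | exact hL | exact hE | exact hN | exact hA | exact hHd | exact hQ
      | exact hQe | apply hasDerivAt_const | apply HasDerivAt.fun_sub | apply HasDerivAt.fun_add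
      | apply HasDerivAt.fun_neg | apply HasDerivAt.div_const
      | apply HasDerivAt.pow_succ' | apply HasDerivAt.fun_mul
  · rw [primQ_eq hp]
    simp only [e]
    rw [← hH]
    have hc := hp.hc (x t)
    push_cast
    linear_combination (norm := (simp only [qChain, q2, primQ_eq hp, kQ1, Ham]; ring)) ((2 * primL p (x t) + al p (x t) + p.a 0 3 * y t ^ 2) * (y t * x')) * hc
      + (2 * primL p (x t) * q2 p (x t) (y t) + 4 * p.a 0 3 * primL p (x t) * primQ p (x t) (y t)
        + p.m * cP p (x t) + p.m * y t * (al p (x t) + p.a 0 3 * y t ^ 2)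
        - p.m * p.b 3 0 * y t + p.m * (p.lam / 3 - p.a 1 1 / 2) * (3 / 7 * x t * y t)
        + p.m * (p.mu / 3 - p.a 2 1) * (3 / 8 * x t ^ 2 * y t - 3 / 8 * y t)) * hl

/-- The conditions for the vanishing of the first three Melnikov functions, with the trivial case
`λ = μ = 0` excluded. -/
structure M3Nontrivial (p : CubicPerturbation) : Prop extends M2Nontrivial p where
  m0 : p.m * p.b 0 0 = 0
  m2 : p.m * p.b 2 0 = 0
  m13 : p.m * (p.b 1 0 + p.b 3 0) = 0
  mL : p.m * (p.lam / 3 - p.a 1 1 / 2) = 0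
  mM : p.m * (p.mu / 3 - p.a 2 1) = 0

/-- The derivative of `q₂` along the level curves is `(λ + μ x) (primW + 4 a₀₃ H)`, up to the
term that is odd in `y`. -/
def primW (p : CubicPerturbation) (x : ℝ) : ℝ :=
  4 * primL p x + 2 * al p x + 2 * p.a 0 3 * (x ^ 2 - x ^ 4 / 2)

theorem continuous_primW (p : CubicPerturbation) : Continuous (primW p) := by
  have := continuous_primL p; have := continuous_al p
  unfold primW; fun_prop

/-- The coefficients of the powers of `H` of the even part of `-(λ + μ x) (primW + 4 a₀₃ H) Q₁`. -/
def coefG (p : CubicPerturbation) : ℕ → ℝ → ℝ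
  | 0 => fun x => -((p.lam + p.mu * x) * (kQ0 p x * primW p x))
  | 1 => fun x => -((p.lam + p.mu * x) * (kQ0 p x * (4 * p.a 0 3) + kQ1 p x * primW p x))
  | 2 => fun x => -((p.lam + p.mu * x) * (kQ1 p x * (4 * p.a 0 3) - p.a 0 3 * primW p x))
  | _ => fun x => -((p.lam + p.mu * x) * (-p.a 0 3 * (4 * p.a 0 3)))

theorem continuous_coefG (p : CubicPerturbation) : ∀ i, Continuous (coefG p i)
  | 0 | 1 | 2 | _ + 3 => by
    have := continuous_primW p; have := continuous_kQ0 p; have := continuous_kQ1 p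
    unfold coefG; fun_prop

/-- The function `Q₃` of the recursive procedure. -/
def Q3 (p : CubicPerturbation) (x y : ℝ) : ℝ :=
  q2 p x y * primQ p x y + 2 / 3 * p.m * primL p x * y ^ 3
    - p.m * (primQ p x y - cP p x * y) * y + antideriv (fun s => p.m * cP p s * (s ^ 3 - s)) x
    + antideriv (coefG p 0) x + Ham x y * antideriv (coefG p 1) x
    + Ham x y ^ 2 * antideriv (coefG p 2) x + Ham x y ^ 3 * antideriv (coefG p 3) x
    + p.m * p.b 1 0 * (y ^ 3 / 3)

/-- The function `q₃` of the recursive procedure. -/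
def q3 (p : CubicPerturbation) (x y : ℝ) : ℝ :=
  -2 * primL p x * q2 p x y - p.m / 2 * (y * (primW p x + 4 * p.a 0 3 * Ham x y))
    - 4 * p.a 0 3 * primL p x * primQ p x y - p.m * cP p x
    - (antideriv (coefG p 1) x + 2 * Ham x y * antideriv (coefG p 2) x
      + 3 * Ham x y ^ 2 * antideriv (coefG p 3) x)
    + 2 * p.m * primL p x * y - p.m * p.b 1 0 * y

theorem hasDerivAt_q2 (p : CubicPerturbation) {x y : ℝ → ℝ} {x' y' t : ℝ}
    (hx : HasDerivAt x x' t) (hy : HasDerivAt y y' t) :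
    HasDerivAt (fun s => q2 p (x s) (y s))
      ((p.lam + p.mu * x t) * (primW p (x t) + 4 * p.a 0 3 * Ham (x t) (y t)) * x'
        + 4 * p.a 0 3 * primL p (x t) * ((x t ^ 3 - x t) * x' + y t * y') + p.m * y') t := by
  have hL := hasDerivAt_primL p hx
  have hE := hasDerivAt_primE p hx
  have hN := hasDerivAt_primN p hx
  have hHd := hasDerivAt_Ham hx hy
  simp only [q2]
  apply HasDerivAt.congr_deriv
  · repeat' first
      | exact hx | exact hy | exact hL | exact hE | exact hN | exact hHd
      | apply hasDerivAt_const | apply HasDerivAt.fun_sub | apply HasDerivAt.fun_add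
      | apply HasDerivAt.fun_neg | apply HasDerivAt.div_const
      | apply HasDerivAt.pow_succ' | apply HasDerivAt.fun_mul
  · simp only [primW]
    push_cast
    ring

/-- The integration by parts of `M_three_nontrivial`, now keeping track of dH. Under the five
conditions the remaining odd form is m b₁₀ (x − x³) y dx = −m b₁₀ (y dH − y² dy). -/
theorem isStep_Q3 {p : CubicPerturbation} (hp : M3Nontrivial p) :
    IsStep p (q2 p) (Q3 p) (q3 p) := by
  intro x y x' y' t hx hy
  have hL := hasDerivAt_primL p hx
  have hc' := hasDerivAt_cP p hx
  have hHd := hasDerivAt_Ham hx hy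
  have hcc := continuous_cP p
  have hA := hasDerivAt_antideriv (e := fun s => p.m * cP p s * (s ^ 3 - s)) (by fun_prop) hx
  have hG := fun i => hasDerivAt_antideriv (continuous_coefG p i) hx
  have hQ := isStep_primQ hp.toM1Condition x y x' y' t hx hy
  have hQe := hasDerivAt_even hp.toM2Nontrivial hx hy
  have hq := hasDerivAt_q2 p hx hy
  simp only [Q3]
  apply HasDerivAt.congr_deriv
  · repeat' first
      | exact hx | exact hy | exact hL | exact hA | exact hHd | exact hQ | exact hG _ | exact hq
      | exact hQe | apply hasDerivAt_const | apply HasDerivAt.fun_sub | apply HasDerivAt.fun_add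
      | apply HasDerivAt.fun_neg | apply HasDerivAt.div_const
      | apply HasDerivAt.pow_succ' | apply HasDerivAt.fun_mul
  · have hc := hp.hc (x t)
    push_cast
    linear_combination (norm := (simp only [q3, primQ_eq hp.toM2Nontrivial, coefG, primW, Ham]; ring))
      ((primW p (x t) + 4 * p.a 0 3 * Ham (x t) (y t)) / 2 * (y t * x')) * hc
      - (y t * x') * hp.m0 - (y t * x' * x t ^ 2) * hp.m2 - (y t * x' * x t ^ 3) * hp.m13
      - (y t ^ 3 * x') * hp.mL - (y t ^ 3 * x t * x') * hp.mM

theorem continuous_primQ {p : CubicPerturbation} (hp : M2Nontrivial p) :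
    Continuous fun z : ℝ × ℝ => primQ p z.1 z.2 := by
  have h1 := (continuous_cP p).comp (continuous_fst (X := ℝ) (Y := ℝ))
  have h2 := (continuous_kQ0 p).comp (continuous_fst (X := ℝ) (Y := ℝ))
  have h3 := (continuous_kQ1 p).comp (continuous_fst (X := ℝ) (Y := ℝ))
  have h4 := continuous_Ham
  simp only [Function.comp_def] at h1 h2 h3
  simp only [primQ_eq hp]
  fun_prop

theorem continuous_q3 {p : CubicPerturbation} (hp : M2Nontrivial p) :
    Continuous fun z : ℝ × ℝ => q3 p z.1 z.2 := by
  have h1 := (continuous_cP p).comp (continuous_fst (X := ℝ) (Y := ℝ))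
  have h2 := (continuous_primW p).comp (continuous_fst (X := ℝ) (Y := ℝ))
  have h3 := (continuous_primL p).comp (continuous_fst (X := ℝ) (Y := ℝ))
  have h5 := fun i => (continuous_antideriv (continuous_coefG p i)).comp
    (continuous_fst (X := ℝ) (Y := ℝ))
  have h51 := h5 1
  have h52 := h5 2
  have h53 := h5 3
  have h4 := continuous_Ham
  have h6 := continuous_primQ hp
  have h7 := continuous_q2 p
  simp only [Function.comp_def] at h1 h2 h3 h51 h52 h53
  unfold q3
  fun_prop

/-- The even part of `q₂` on the level `H = h`. -/
def evenq2 (p : CubicPerturbation) (h x : ℝ) : ℝ :=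
  2 * primL p x ^ 2 + primN p x + 2 * p.a 0 3 * primE p x + 4 * p.a 0 3 * h * primL p x

/-- The even part of `q₃` on the level `H = h`. -/
def evenq3 (p : CubicPerturbation) (h x : ℝ) : ℝ :=
  -2 * primL p x * evenq2 p h x
    - 4 * p.a 0 3 * primL p x * (kQ0 p x + kQ1 p x * h - p.a 0 3 * h ^ 2) - p.m * cP p x
    - (antideriv (coefG p 1) x + 2 * h * antideriv (coefG p 2) x
      + 3 * h ^ 2 * antideriv (coefG p 3) x)

/-- The odd part of `q₃` on the level `H = h`, divided by `y`. -/
def oddq3 (p : CubicPerturbation) (h x : ℝ) : ℝ :=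
  -(p.m / 2) * (primW p x + 4 * p.a 0 3 * h) - 4 * p.a 0 3 * primL p x * cP p x - p.m * p.b 1 0

theorem q3_eq {p : CubicPerturbation} (hp : M2Nontrivial p) (x y : ℝ) :
    q3 p x y = evenq3 p (Ham x y) x + y * oddq3 p (Ham x y) x := by
  simp only [q3, evenq3, oddq3, evenq2, q2, primQ_eq hp]
  ring

theorem hasDerivAt_evenq2 (p : CubicPerturbation) (h : ℝ) {x : ℝ → ℝ} {x' t : ℝ}
    (hx : HasDerivAt x x' t) : HasDerivAt (fun s => evenq2 p h (x s))
      ((p.lam + p.mu * x t) * (primW p (x t) + 4 * p.a 0 3 * h) * x') t := by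
  have hL := hasDerivAt_primL p hx
  have hE := hasDerivAt_primE p hx
  have hN := hasDerivAt_primN p hx
  simp only [evenq2]
  apply HasDerivAt.congr_deriv
  · repeat' first
      | exact hL | exact hE | exact hN
      | apply hasDerivAt_const | apply HasDerivAt.fun_sub | apply HasDerivAt.fun_add
      | apply HasDerivAt.pow_succ' | apply HasDerivAt.fun_mul
  · simp only [primW]
    push_cast
    ring

theorem hasDerivAt_kQ0 (p : CubicPerturbation) {x : ℝ → ℝ} {x' t : ℝ} (hx : HasDerivAt x x' t) :
    HasDerivAt (fun s => kQ0 p (x s))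
      ((p.b 0 0 + p.b 1 0 * x t + p.b 2 0 * x t ^ 2 + p.b 3 0 * x t ^ 3
        + (x t ^ 2 - x t ^ 4 / 2) * (p.lam + p.mu * x t - (p.a 1 1 + 2 * p.a 2 1 * x t) / 2)
        + (al p (x t) + p.a 0 3 * (x t ^ 2 - x t ^ 4 / 2)) * (x t ^ 3 - x t)) * x') t := by
  have hB := hasDerivAt_primB p hx
  have hE := hasDerivAt_primE p hx
  have ha := hasDerivAt_al p hx
  simp only [kQ0]
  apply HasDerivAt.congr_deriv
  · repeat' first
      | exact hx | exact hB | exact hE | exact ha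
      | apply hasDerivAt_const | apply HasDerivAt.fun_sub | apply HasDerivAt.fun_add
      | apply HasDerivAt.div_const | apply HasDerivAt.pow_succ' | apply HasDerivAt.fun_mul
  · push_cast
    ring

theorem hasDerivAt_kQ1 (p : CubicPerturbation) {x : ℝ → ℝ} {x' t : ℝ} (hx : HasDerivAt x x' t) :
    HasDerivAt (fun s => kQ1 p (x s))
      ((2 * (p.lam + p.mu * x t) - (p.a 1 1 + 2 * p.a 2 1 * x t)
        + 2 * p.a 0 3 * (x t ^ 3 - x t)) * x') t := by
  have hL := hasDerivAt_primL p hx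
  have ha := hasDerivAt_al p hx
  simp only [kQ1]
  apply HasDerivAt.congr_deriv
  · repeat' first
      | exact hx | exact hL | exact ha
      | apply hasDerivAt_const | apply HasDerivAt.fun_sub | apply HasDerivAt.fun_add
      | apply HasDerivAt.div_const | apply HasDerivAt.pow_succ' | apply HasDerivAt.fun_mul
  · push_cast
    ring

theorem hasDerivAt_evenq3 (p : CubicPerturbation) (h : ℝ) {x : ℝ → ℝ} {x' t : ℝ}
    (hx : HasDerivAt x x' t) : HasDerivAt (fun s => evenq3 p h (x s))
      ((-(p.lam + p.mu * x t) * (2 * evenq2 p h (x t)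
          + (al p (x t) + p.a 0 3 * (2 * h + x t ^ 2 - x t ^ 4 / 2))
            * (primW p (x t) + 4 * p.a 0 3 * h))
        - 4 * p.a 0 3 * primL p (x t)
          * (p.b 0 0 + p.b 1 0 * x t + p.b 2 0 * x t ^ 2 + p.b 3 0 * x t ^ 3
            + (2 * h + x t ^ 2 - x t ^ 4 / 2)
              * (p.lam + p.mu * x t - (p.a 1 1 + 2 * p.a 2 1 * x t) / 2)
            + (al p (x t) + p.a 0 3 * (2 * h + x t ^ 2 - x t ^ 4 / 2)) * (x t ^ 3 - x t))
        + p.m * (p.a 1 0 + 2 * p.a 2 0 * x t + 3 * p.a 3 0 * x t ^ 2)) * x') t := by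
  have hL := hasDerivAt_primL p hx
  have h2 := hasDerivAt_evenq2 p h hx
  have hk0 := hasDerivAt_kQ0 p hx
  have hk1 := hasDerivAt_kQ1 p hx
  have hc := hasDerivAt_cP p hx
  have hG := fun i => hasDerivAt_antideriv (continuous_coefG p i) hx
  simp only [evenq3]
  apply HasDerivAt.congr_deriv
  · repeat' first
      | exact hx | exact hL | exact h2 | exact hk0 | exact hk1 | exact hc | exact hG _
      | apply hasDerivAt_const | apply HasDerivAt.fun_sub | apply HasDerivAt.fun_add
      | apply HasDerivAt.pow_succ' | apply HasDerivAt.fun_mul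
  · simp only [coefG, primW, kQ1, evenq2]
    ring

theorem continuous_evenq3 (p : CubicPerturbation) (h : ℝ) : Continuous (evenq3 p h) := by
  rw [continuous_iff_continuousAt]
  exact fun x => (hasDerivAt_evenq3 p h (hasDerivAt_id x)).continuousAt

theorem continuous_oddq3 (p : CubicPerturbation) (h : ℝ) : Continuous (oddq3 p h) := by
  have := continuous_primW p; have := continuous_primL p; have := continuous_cP p
  unfold oddq3; fun_prop

/-- The reduction of the fourth Melnikov function to `m ∮ c c' y dx`. -/
theorem M_four_nontrivial {p : CubicPerturbation} (hp : M3Nontrivial p) {h : ℝ} (hh : h ∈ Sig)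
    (R : ℝ → ℝ → ℝ) (c₀ c₁ c₂ : ℝ)
    (hR : ∀ (x y : ℝ → ℝ) (x' y' t : ℝ), HasDerivAt x x' t → HasDerivAt y y' t →
      (x t ^ 3 - x t) * x' + y t * y' = 0 → Ham (x t) (y t) = h →
      HasDerivAt (fun s => R (x s) (y s))
        ((p.m * cP p (x t) * -(p.a 1 0 + 2 * p.a 2 0 * x t + 3 * p.a 3 0 * x t ^ 2)
          - (c₀ + c₁ * x t + c₂ * x t ^ 2)) * y t * x') t) :
    M p 4 h = c₀ * I 0 h + c₁ * I 1 h + c₂ * I 2 h := by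
  have hac := continuous_al p
  have hcc := continuous_cP p
  have hec := continuous_evenq3 p h
  have hoc := continuous_oddq3 p h
  let e : ℝ → ℝ := fun x => evenq3 p h x
      * (p.b 0 0 + p.b 1 0 * x + p.b 2 0 * x ^ 2 + p.b 3 0 * x ^ 3
        + (2 * h + x ^ 2 - x ^ 4 / 2) * (p.lam + p.mu * x - (p.a 1 1 + 2 * p.a 2 1 * x) / 2)
        + (al p x + p.a 0 3 * (2 * h + x ^ 2 - x ^ 4 / 2)) * (x ^ 3 - x))
    - oddq3 p h x * (p.a 1 0 + 2 * p.a 2 0 * x + 3 * p.a 3 0 * x ^ 2) * (2 * h + x ^ 2 - x ^ 4 / 2)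
    - oddq3 p h x * cP p x * (x ^ 3 - x)
  have he : Continuous e := by unfold e; fun_prop
  refine (melnikov_value p 3 (qChain p (q3 p)) (QChain p (Q3 p)) (fun _ _ => rfl)
    (continuous_q3 hp.toM2Nontrivial) (isStep_chain hp.toM2Nontrivial (isStep_Q3 hp)) hh
    -- On the level write q₃ = E + yO and Q = c y + K with E, O, K functions of x. The odd part of
    -- q₃ dQ is E d(cy) + yO dK. By parts, E d(cy) becomes −c y dE, and the term −m c of E
    -- contributes m c c' y dx; everything else is exact, with a primitive proportional to y³.
    (fun x y => evenq3 p h x * (cP p x * y) + antideriv e x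
      - p.m / 3 * (y ^ 3 * (evenq2 p h x + 2 * p.b 1 0 * primL p x + p.b 1 0 ^ 2))
      + R x y) _ _ _ ?_).2
  intro x y x' y' t hx hy hl hH
  have hL := hasDerivAt_primL p hx
  have hc' := hasDerivAt_cP p hx
  have hA := hasDerivAt_antideriv he hx
  have h2 := hasDerivAt_evenq2 p h hx
  have h3 := hasDerivAt_evenq3 p h hx
  have hRd := hR x y x' y' t hx hy hl hH
  have hQ := isStep_primQ hp.toM1Condition x y x' y' t hx hy
  have hQe := hasDerivAt_even hp.toM2Nontrivial hx hy
  have hw := (hQ.fun_sub (hc'.fun_mul hy)).unique hQe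
  apply HasDerivAt.congr_deriv
  · repeat' first
      | exact hx | exact hy | exact hL | exact hA | exact h2 | exact h3 | exact hRd | exact hc'
      | apply hasDerivAt_const | apply HasDerivAt.fun_sub | apply HasDerivAt.fun_add
      | apply HasDerivAt.pow_succ' | apply HasDerivAt.fun_mul
  · have hc := hp.hc (x t)
    have h3e : qChain p (q3 p) 3 (x t) (y t) = _ := q3_eq hp.toM2Nontrivial (x t) (y t)
    rw [h3e]
    simp only [e]
    rw [← hH]
    push_cast
    linear_combination (norm := (simp only [evenq2, oddq3, primW, Ham]; ring))
      -(evenq3 p (Ham (x t) (y t)) (x t) + y t * oddq3 p (Ham (x t) (y t)) (x t)) * hw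
      + ((evenq3 p (Ham (x t) (y t)) (x t) + y t * oddq3 p (Ham (x t) (y t)) (x t))
          * (al p (x t) + p.a 0 3 * y t ^ 2)
        - oddq3 p (Ham (x t) (y t)) (x t) * cP p (x t)
        - p.m * y t * (evenq2 p (Ham (x t) (y t)) (x t) + 2 * p.b 1 0 * primL p (x t)
          + p.b 1 0 ^ 2)) * hl
      - (evenq2 p (Ham (x t) (y t)) (x t) + (al p (x t) + p.a 0 3 * y t ^ 2)
          * (primW p (x t) + 4 * p.a 0 3 * Ham (x t) (y t)) / 2) * (y t * x') * hc
      + ((primW p (x t) + 4 * p.a 0 3 * Ham (x t) (y t)) / 2 + p.b 1 0) * (y t * x')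
        * (hp.m0 + x t ^ 2 * hp.m2 + x t ^ 3 * hp.m13 + y t ^ 2 * hp.mL + y t ^ 2 * x t * hp.mM)

/-! ### Expansions at the center and linear independence -/

open Asymptotics

/-- Since g − P = (g² − P²)/(g + P) with a denominator close to 2, a Taylor estimate for a square
root follows from an algebraic identity for its square. -/
theorem sub_isBigO_of_sq_sub {g P k : ℝ → ℝ} (hg : ContinuousAt g 0) (hP : ContinuousAt P 0)
    (hk : ContinuousAt k 0) (hg0 : g 0 = 1) (hP0 : P 0 = 1) (n : ℕ)
    (h : ∀ᶠ u in 𝓝 (0 : ℝ), g u ^ 2 - P u ^ 2 = u ^ n * k u) :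
    (fun u => g u - P u) =O[𝓝 0] (fun u : ℝ => u ^ n) := by
  have hs : ContinuousAt (fun u => g u + P u) 0 := hg.add hP
  have hne : ∀ᶠ u in 𝓝 (0 : ℝ), g u + P u ≠ 0 := hs.eventually_ne (by rw [hg0, hP0]; norm_num)
  have h1 : (fun u => g u - P u) =ᶠ[𝓝 0] fun u => u ^ n * (k u / (g u + P u)) := by
    filter_upwards [h, hne] with u h1 h2
    rw [mul_div_assoc', eq_div_iff h2, ← h1]
    ring
  have h2 : ContinuousAt (fun u => k u / (g u + P u)) 0 :=
    hk.div hs (by rw [hg0, hP0]; norm_num)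
  refine h1.trans_isBigO ?_
  simpa using (isBigO_refl (fun u : ℝ => u ^ n) (𝓝 0)).mul (h2.isBigO_one ℝ)

/-- `∫ cos^n` over a period. -/
def cosInt (n : ℕ) : ℝ := ∫ θ in (0 : ℝ)..(2 * Real.pi), Real.cos θ ^ n

theorem cosInt_zero : cosInt 0 = 2 * Real.pi := by simp [cosInt]
theorem cosInt_one : cosInt 1 = 0 := by simp [cosInt]
theorem cosInt_add_two (n : ℕ) : cosInt (n + 2) = (n + 1) / (n + 2) * cosInt n := by
  rw [cosInt, integral_cos_pow]; simp [cosInt]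

theorem integral_sin_sq_mul_cos_pow (n : ℕ) :
    ∫ θ in (0 : ℝ)..(2 * Real.pi), Real.sin θ ^ 2 * Real.cos θ ^ n = 1 / (n + 2) * cosInt n := by
  have h : ∀ θ, Real.sin θ ^ 2 * Real.cos θ ^ n = Real.cos θ ^ n - Real.cos θ ^ (n + 2) := by
    intro θ; rw [Real.sin_sq]; ring
  simp only [h]
  rw [intervalIntegral.integral_sub (Continuous.intervalIntegrable (by fun_prop) _ _)
    (Continuous.intervalIntegrable (by fun_prop) _ _)]
  have h2 := cosInt_add_two n
  simp only [cosInt] at *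
  rw [h2]
  field_simp
  ring

/-- The Taylor polynomial is evaluated at u = 2r cos θ and integrated term by term; |u| ≤ 2r makes
the remainder uniform in θ. -/
theorem integral_expansion {g : ℝ → ℝ} (hg : ContinuousOn g (Ioo (-1) 1)) (c : ℕ → ℝ) (n : ℕ)
    (h : (fun u => g u - ∑ j ∈ Finset.range n, c j * u ^ j) =O[𝓝 0] (fun u : ℝ => u ^ n)) :
    (fun r => (∫ θ in (0 : ℝ)..(2 * Real.pi), Real.sin θ ^ 2 * g (2 * (r * Real.cos θ)))
        - ∑ j ∈ Finset.range n, c j * (2 ^ j / (j + 2) * cosInt j) * r ^ j)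
      =O[𝓝[>] 0] (fun r : ℝ => r ^ n) := by
  obtain ⟨C, hC0, hC⟩ := h.exists_pos
  obtain ⟨δ, hδ, hball⟩ := Metric.eventually_nhds_iff.1 hC.bound
  refine IsBigO.of_bound (C * 2 ^ n * (2 * Real.pi)) ?_
  have hlt : ∀ᶠ r in 𝓝[>] (0 : ℝ), r < min (δ / 2) (1 / 2) :=
    nhdsWithin_le_nhds (eventually_lt_nhds (by positivity))
  filter_upwards [hlt, self_mem_nhdsWithin] with r hr hr0
  have hr0 : 0 < r := hr0
  have hu : ∀ θ, |2 * (r * Real.cos θ)| ≤ 2 * r := fun θ => by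
    rw [abs_mul, abs_mul, abs_of_pos hr0, abs_two]
    have := mul_le_mul_of_nonneg_left (Real.abs_cos_le_one θ) hr0.le
    linarith
  have hr1 : 2 * r < δ := by have := hr.trans_le (min_le_left _ _); linarith
  have hr2 : 2 * r < 1 := by have := hr.trans_le (min_le_right _ _); linarith
  have hgc : Continuous fun θ => g (2 * (r * Real.cos θ)) :=
    hg.comp_continuous (by fun_prop) fun θ => abs_lt.1 ((hu θ).trans_lt hr2)
  have hsum : ∑ j ∈ Finset.range n, c j * (2 ^ j / (j + 2) * cosInt j) * r ^ j
      = ∫ θ in (0 : ℝ)..(2 * Real.pi), Real.sin θ ^ 2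
          * ∑ j ∈ Finset.range n, c j * (2 * (r * Real.cos θ)) ^ j := by
    simp only [Finset.mul_sum]
    rw [intervalIntegral.integral_finsetSum fun j _ =>
      Continuous.intervalIntegrable (by fun_prop) _ _]
    refine Finset.sum_congr rfl fun j _ => ?_
    have : ∀ θ, Real.sin θ ^ 2 * (c j * (2 * (r * Real.cos θ)) ^ j)
        = c j * 2 ^ j * r ^ j * (Real.sin θ ^ 2 * Real.cos θ ^ j) := fun θ => by
      rw [mul_pow, mul_pow]; ring
    simp only [this]
    rw [intervalIntegral.integral_const_mul, integral_sin_sq_mul_cos_pow]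
    ring
  have hgi : Continuous fun θ => Real.sin θ ^ 2 * g (2 * (r * Real.cos θ)) :=
    (Real.continuous_sin.pow 2).mul hgc
  rw [hsum, ← intervalIntegral.integral_sub (hgi.intervalIntegrable _ _)
    (Continuous.intervalIntegrable (by fun_prop) _ _)]
  have := intervalIntegral.norm_integral_le_of_norm_le_const (a := 0) (b := 2 * Real.pi)
    (f := fun θ => Real.sin θ ^ 2 * g (2 * (r * Real.cos θ))
      - Real.sin θ ^ 2 * ∑ j ∈ Finset.range n, c j * (2 * (r * Real.cos θ)) ^ j)
    (C := C * (2 * r) ^ n) ?_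
  · refine this.trans (le_of_eq ?_)
    rw [sub_zero, abs_of_pos Real.two_pi_pos, Real.norm_of_nonneg (by positivity), mul_pow]
    ring
  · intro θ _
    have h1 := hball (y := 2 * (r * Real.cos θ))
      (by rw [Real.dist_0_eq_abs]; exact (hu θ).trans_lt hr1)
    rw [← mul_sub, norm_mul]
    have hs : ‖Real.sin θ ^ 2‖ ≤ 1 := by
      rw [Real.norm_eq_abs, abs_of_nonneg (sq_nonneg _)]
      exact Real.sin_sq_le_one θ
    calc _ ≤ 1 * (C * ‖(2 * (r * Real.cos θ)) ^ n‖) :=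
          mul_le_mul hs h1 (norm_nonneg _) zero_le_one
      _ ≤ C * (2 * r) ^ n := by
          rw [one_mul, norm_pow, Real.norm_eq_abs]
          exact mul_le_mul_of_nonneg_left (pow_le_pow_left₀ (abs_nonneg _) (hu θ) n) hC0.le

/-- On the oval y dx/dθ = y²/(√2 x) = √2 r² sin² θ / x. Thus I₁ is elementary, while I₀ and I₂ are
averages of 1/x and x, with x = √(1 + 2r cos θ). -/
theorem I_polar (k : ℕ) {h : ℝ} (hh : h ∈ Sig) :
    I k h = √2 * radius h ^ 2 * ∫ θ in (0 : ℝ)..(2 * Real.pi),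
      Real.sin θ ^ 2 * (ovalX h θ ^ k * (ovalX h θ)⁻¹) := by
  rw [I_eq k hh, ← intervalIntegral.integral_const_mul]
  refine intervalIntegral.integral_congr fun θ _ => ?_
  have h2 : √2 * √2 = 2 := Real.mul_self_sqrt (by norm_num)
  simp only [ovalX', ovalZ, mul_inv]
  field_simp

theorem I_one {h : ℝ} (hh : h ∈ Sig) : I 1 h = √2 * radius h ^ 2 * Real.pi := by
  rw [I_polar 1 hh]
  congr 1
  have : ∀ θ, Real.sin θ ^ 2 * (ovalX h θ ^ 1 * (ovalX h θ)⁻¹)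
      = Real.sin θ ^ 2 * Real.cos θ ^ 0 := fun θ => by
    rw [pow_one, mul_inv_cancel₀ (ovalX_pos hh θ).ne', pow_zero]
  simp only [this]
  rw [integral_sin_sq_mul_cos_pow, cosInt_zero]
  push_cast
  ring

theorem radius_eq {r : ℝ} (hr : 0 ≤ r) : radius (r ^ 2 - 1 / 4) = r := by
  rw [radius, show r ^ 2 - 1 / 4 + 1 / 4 = r ^ 2 by ring, Real.sqrt_sq hr]

/-- The Taylor coefficients of `√(1 + u)`. -/
def sqrtCoef (j : ℕ) : ℝ := ([1, 1/2, -1/8, 1/16, -5/128, 7/256, -21/1024, 33/2048, -429/32768,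
  715/65536, -2431/262144] : List ℝ).getD j 0

/-- The Taylor coefficients of `1 / √(1 + u)`. -/
def invSqrtCoef (j : ℕ) : ℝ := ([1, -1/2, 3/8, -5/16, 35/128, -63/256, 231/1024, -429/2048,
  6435/32768, -12155/65536, 46189/262144] : List ℝ).getD j 0

theorem sqrt_expansion : (fun u => √(1 + u) - ∑ j ∈ Finset.range 11, sqrtCoef j * u ^ j)
    =O[𝓝 0] (fun u : ℝ => u ^ 11) := by
  -- `k` is the polynomial (1 + u − P(u)²)/u¹¹, where P is the Taylor polynomial.
  refine sub_isBigO_of_sq_sub (k := fun u => (4199/262144) + (-12597/2097152) * u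
    + (3553/1048576) * u ^ 2 + (-17765/8388608) * u ^ 3 + (46189/33554432) * u ^ 4
    + (-969969/1073741824) * u ^ 5 + (627627/1073741824) * u ^ 6 + (-388531/1073741824) * u ^ 7
    + (1738165/8589934592) * u ^ 8 + (-5909761/68719476736) * u ^ 9)
    (by fun_prop) (by fun_prop) (by fun_prop) (by simp) ?_ 11 ?_
  · simp [Finset.sum_range_succ, sqrtCoef]
  · filter_upwards [eventually_gt_nhds (show (-1 : ℝ) < 0 by norm_num)] with u hu
    rw [Real.sq_sqrt (by linarith)]
    simp only [Finset.sum_range_succ, Finset.sum_range_zero, sqrtCoef, List.getD_cons_zero,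
      List.getD_cons_succ]
    ring

theorem inv_sqrt_expansion :
    (fun u => (√(1 + u))⁻¹ - ∑ j ∈ Finset.range 11, invSqrtCoef j * u ^ j)
    =O[𝓝 0] (fun u : ℝ => u ^ 11) := by
  refine sub_isBigO_of_sq_sub (k := fun u => ((-88179/262144) + (323323/2097152) * u
    + (-223839/2097152) * u ^ 2 + (692835/8388608) * u ^ 3 + (-2263261/33554432) * u ^ 4
    + (61108047/1073741824) * u ^ 5 + (-13180167/268435456) * u ^ 6
    + (46235189/1073741824) * u ^ 7 + (-328513185/8589934592) * u ^ 8
    + (2357994639/68719476736) * u ^ 9 + (-2133423721/68719476736) * u ^ 10) / (1 + u))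
    ?_ (by fun_prop) ?_ (by simp) ?_ 11 ?_
  · exact ContinuousAt.inv₀ (by fun_prop) (by simp)
  · exact ContinuousAt.div (by fun_prop) (by fun_prop) (by norm_num)
  · simp [Finset.sum_range_succ, invSqrtCoef]
  · filter_upwards [eventually_gt_nhds (show (-1 : ℝ) < 0 by norm_num)] with u hu
    have hu' : 1 + u ≠ 0 := by linarith
    rw [inv_pow, Real.sq_sqrt (by linarith)]
    simp only [Finset.sum_range_succ, Finset.sum_range_zero, invSqrtCoef, List.getD_cons_zero,
      List.getD_cons_succ]
    field_simp
    ring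

theorem cosInt_values : cosInt 2 = Real.pi ∧ cosInt 3 = 0 ∧ cosInt 4 = 3 / 4 * Real.pi ∧
    cosInt 5 = 0 ∧ cosInt 6 = 5 / 8 * Real.pi ∧ cosInt 7 = 0 ∧ cosInt 8 = 35 / 64 * Real.pi ∧
    cosInt 9 = 0 ∧ cosInt 10 = 63 / 128 * Real.pi := by
  have c2 := cosInt_add_two 0
  have c3 := cosInt_add_two 1
  have c4 := cosInt_add_two 2
  have c5 := cosInt_add_two 3
  have c6 := cosInt_add_two 4
  have c7 := cosInt_add_two 5
  have c8 := cosInt_add_two 6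
  have c9 := cosInt_add_two 7
  have c10 := cosInt_add_two 8
  norm_num [cosInt_zero, cosInt_one] at c2 c3
  norm_num [c2, c3] at c4 c5
  norm_num [c4, c5] at c6 c7
  norm_num [c6, c7] at c8 c9
  norm_num [c8] at c10
  refine ⟨?_, c3, ?_, c5, ?_, c7, ?_, c9, ?_⟩ <;> linarith

theorem integral_sqrt_expansion :
    (fun r => (∫ θ in (0 : ℝ)..(2 * Real.pi), Real.sin θ ^ 2 * √(1 + 2 * (r * Real.cos θ)))
      - Real.pi * (1 - 1/8 * r ^ 2 - 5/64 * r ^ 4 - 105/1024 * r ^ 6 - 3003/16384 * r ^ 8 - 51051/131072 * r ^ 10))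
      =O[𝓝[>] 0] (fun r : ℝ => r ^ 11) := by
  have hS := integral_expansion (g := fun u => √(1 + u)) (by fun_prop) _ 11 sqrt_expansion
  obtain ⟨c2, c3, c4, c5, c6, c7, c8, c9, c10⟩ := cosInt_values
  norm_num [Finset.sum_range_succ, sqrtCoef, cosInt_zero, cosInt_one, c2, c3, c4, c5, c6, c7, c8,
    c9, c10] at hS
  exact hS.congr_left fun r => by ring

theorem integral_inv_sqrt_expansion :
    (fun r => (∫ θ in (0 : ℝ)..(2 * Real.pi), Real.sin θ ^ 2 * (√(1 + 2 * (r * Real.cos θ)))⁻¹)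
      - Real.pi * (1 + 3/8 * r ^ 2 + 35/64 * r ^ 4 + 1155/1024 * r ^ 6 + 45045/16384 * r ^ 8 + 969969/131072 * r ^ 10))
      =O[𝓝[>] 0] (fun r : ℝ => r ^ 11) := by
  have hD := integral_expansion (g := fun u => (√(1 + u))⁻¹)
    (ContinuousOn.inv₀ (by fun_prop) fun u hu => (Real.sqrt_pos.2 (by linarith [hu.1])).ne') _ 11
    inv_sqrt_expansion
  obtain ⟨c2, c3, c4, c5, c6, c7, c8, c9, c10⟩ := cosInt_values
  norm_num [Finset.sum_range_succ, invSqrtCoef, cosInt_zero, cosInt_one, c2, c3, c4, c5, c6, c7,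
    c8, c9, c10] at hD
  exact hD.congr_left fun r => by ring

/-- The functions `I₀, h I₀, I₁, h I₁, I₂, h I₂` are linearly independent. -/
theorem linearIndependent_I (α₀ α₁ β₀ β₁ γ₀ γ₁ : ℝ)
    (H : ∀ h ∈ Sig, (α₀ + α₁ * h) * I 0 h + (β₀ + β₁ * h) * I 1 h + (γ₀ + γ₁ * h) * I 2 h = 0) :
    α₀ = 0 ∧ α₁ = 0 ∧ β₀ = 0 ∧ β₁ = 0 ∧ γ₀ = 0 ∧ γ₁ = 0 := by
  -- The coefficients of r^j, j ≤ 10, of the combination divided by √2 π r², where h = r² − 1/4.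
  -- Only even powers occur, so order 10 provides six equations for the six unknowns.
  let c : ℕ → ℝ := fun j => ([(1) * (α₀ - α₁ / 4) + (1) * (β₀ - β₁ / 4) + (1) * (γ₀ - γ₁ / 4),
  0, (3/8) * (α₀ - α₁ / 4) + (1) * (α₁) + (1) * (β₁) + (-1/8) * (γ₀ - γ₁ / 4) + (1) * (γ₁), 0,
  (35/64) * (α₀ - α₁ / 4) + (3/8) * (α₁) + (-5/64) * (γ₀ - γ₁ / 4) + (-1/8) * (γ₁), 0,
  (1155/1024) * (α₀ - α₁ / 4) + (35/64) * (α₁) + (-105/1024) * (γ₀ - γ₁ / 4) + (-5/64) * (γ₁),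
  0, (45045/16384) * (α₀ - α₁ / 4) + (1155/1024) * (α₁) + (-3003/16384) * (γ₀ - γ₁ / 4) +
  (-105/1024) * (γ₁), 0, (969969/131072) * (α₀ - α₁ / 4) + (45045/16384) * (α₁) +
  (-51051/131072) * (γ₀ - γ₁ / 4) + (-3003/16384) * (γ₁)] : List ℝ).getD j 0
  -- The coefficient of r¹², the only excess power when the truncated series are multiplied by α₀ +
  -- α₁h and γ₀ + γ₁h.
  let k : ℝ := 969969/131072 * α₁ - 51051/131072 * γ₁
  let h : ℝ → ℝ := fun r => r ^ 2 - 1 / 4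
  have hb : ∀ a b : ℝ, (fun r => a + b * h r) =O[𝓝[>] 0] (fun _ : ℝ => (1 : ℝ)) := fun a b =>
    ((by unfold h; fun_prop : ContinuousAt (fun r => a + b * h r) 0).isBigO_one ℝ).mono nhdsWithin_le_nhds
  have h1 := ((hb α₀ α₁).mul integral_inv_sqrt_expansion).add
    ((hb γ₀ γ₁).mul integral_sqrt_expansion)
  have h2 : (fun r : ℝ => Real.pi * k * r ^ 12) =O[𝓝[>] 0] (fun r : ℝ => 1 * r ^ 11) := by
    have hr : (fun r : ℝ => Real.pi * k * r) =O[𝓝[>] 0] (fun _ : ℝ => (1 : ℝ)) :=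
      ((by fun_prop : ContinuousAt (fun r : ℝ => Real.pi * k * r) 0).isBigO_one ℝ).mono nhdsWithin_le_nhds
    exact (hr.mul (isBigO_refl (fun r : ℝ => r ^ 11) _)).congr_left fun r => by ring
  have h3 : (fun r : ℝ => ∑ j ∈ Finset.range (10 + 1), c j * r ^ j)
      =O[𝓝[>] 0] (fun r : ℝ => 1 * r ^ 11) := by
    refine ((h1.add h2).const_mul_left (-Real.pi⁻¹)).congr' ?_ EventuallyEq.rfl
    filter_upwards [self_mem_nhdsWithin, nhdsWithin_le_nhds
      (eventually_lt_nhds (show (0 : ℝ) < 1 / 2 by norm_num))] with r hr0 hr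
    have hr0 : 0 < r := hr0
    have hh : h r ∈ Sig := ⟨by simp only [h]; nlinarith, by simp only [h]; nlinarith⟩
    have hrad : radius (h r) = r := radius_eq hr0.le
    have hH := H (h r) hh
    have e0 : ∀ θ, Real.sin θ ^ 2 * (ovalX (h r) θ ^ 0 * (ovalX (h r) θ)⁻¹)
        = Real.sin θ ^ 2 * (√(1 + 2 * (r * Real.cos θ)))⁻¹ := fun θ => by
      rw [pow_zero, one_mul, ovalX, hrad]
    have e2 : ∀ θ, Real.sin θ ^ 2 * (ovalX (h r) θ ^ 2 * (ovalX (h r) θ)⁻¹)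
        = Real.sin θ ^ 2 * √(1 + 2 * (r * Real.cos θ)) := fun θ => by
      rw [pow_two (ovalX _ _), mul_inv_cancel_right₀ (ovalX_pos hh θ).ne', ovalX, hrad]
    rw [I_polar 0 hh, I_one hh, I_polar 2 hh, hrad] at hH
    simp only [e0, e2] at hH
    set D := ∫ θ in (0 : ℝ)..(2 * Real.pi), Real.sin θ ^ 2 * (√(1 + 2 * (r * Real.cos θ)))⁻¹
    set S := ∫ θ in (0 : ℝ)..(2 * Real.pi), Real.sin θ ^ 2 * √(1 + 2 * (r * Real.cos θ))
    have hr2 : √2 * r ^ 2 ≠ 0 := by positivity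
    have hH' : (α₀ + α₁ * h r) * D + (β₀ + β₁ * h r) * Real.pi + (γ₀ + γ₁ * h r) * S = 0 := by
      apply mul_left_cancel₀ hr2
      linear_combination hH
    simp only [Finset.sum_range_succ, Finset.sum_range_zero, c, k, List.getD_cons_zero,
      List.getD_cons_succ]
    have hpi : Real.pi⁻¹ * Real.pi = 1 := inv_mul_cancel₀ Real.pi_ne_zero
    linear_combination (norm := (simp only [h]; ring)) (-Real.pi⁻¹) * hH'
      + ((α₀ + α₁ * h r) * (1 + 3/8 * r ^ 2 + 35/64 * r ^ 4 + 1155/1024 * r ^ 6 + 45045/16384 * r ^ 8 + 969969/131072 * r ^ 10)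
        + (β₀ + β₁ * h r) + (γ₀ + γ₁ * h r) * (1 - 1/8 * r ^ 2 - 5/64 * r ^ 4 - 105/1024 * r ^ 6 - 3003/16384 * r ^ 8 - 51051/131072 * r ^ 10) - k * r ^ 12) * hpi
  have hc := coeff_eq_zero_of_isLittleO 10 c (h3.trans_isLittleO (by
    simpa using (isLittleO_pow_pow (𝕜 := ℝ) (show 10 < 11 by norm_num)).mono nhdsWithin_le_nhds))
  have e0 := hc 0 (by norm_num)
  have e1 := hc 2 (by norm_num)
  have e2 := hc 4 (by norm_num)
  have e3 := hc 6 (by norm_num)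
  have e4 := hc 8 (by norm_num)
  have e5 := hc 10 (by norm_num)
  simp only [c, List.getD_cons_zero, List.getD_cons_succ] at e0 e1 e2 e3 e4 e5
  -- The multipliers here and below are the rows of the inverse of the 6 × 6 matrix of the system.
  have a0 : α₀ - α₁ / 4 = 0 := by
    linear_combination (352/21) * e2 + (-3328/35) * e3 + (4096/49) * e4 + (-1114112/63063) * e5
  have a1 : α₁ = 0 := by
    linear_combination (-1450/21) * e2 + (13984/35) * e3 + (-52736/147) * e4 + (4886528/63063) *
    e5
  have b0 : β₀ - β₁ / 4 = 0 := by
    linear_combination (1) * e0 + (128) * e2 + (-4096/5) * e3 + (16384/21) * e4 + (-524288/3003)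
    * e5
  have b1 : β₁ = 0 := by
    linear_combination (1) * e1 + (96) * e2 + (-2304/5) * e3 + (8192/21) * e4 + (-81920/1001) *
    e5
  have g0 : γ₀ - γ₁ / 4 = 0 := by
    linear_combination (-3040/21) * e2 + (6400/7) * e3 + (-126976/147) * e4 + (12124160/63063) *
    e5
  have g1 : γ₁ = 0 := by
    linear_combination (-154/3) * e2 + (1056/5) * e3 + (-512/3) * e4 + (4096/117) * e5
  refine ⟨?_, a1, ?_, b1, ?_, g1⟩ <;> linarith

/-! ### The central symmetry and the annulus around (-1, 0) -/

/-- The perturbation obtained by the symmetry `(x, y) ↦ (-x, -y)`, which exchanges both annuli. -/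
def CubicPerturbation.reflect (p : CubicPerturbation) : CubicPerturbation where
  a i j := -((-1) ^ (i + j) * p.a i j)
  b i j := -((-1) ^ (i + j) * p.b i j)

namespace CubicPerturbation

variable (p : CubicPerturbation)

theorem reflect_reflect : p.reflect.reflect = p := by
  have h : ∀ n : ℕ, ∀ z : ℝ, -((-1) ^ n * -((-1) ^ n * z)) = z := fun n z => by
    rw [mul_neg, neg_neg, ← mul_assoc, ← mul_pow]; norm_num
  simp only [reflect, h]

theorem reflect_f (x y : ℝ) : p.reflect.f x y = -p.f (-x) (-y) := by
  simp only [f_eq, reflect]; ring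

theorem reflect_g (x y : ℝ) : p.reflect.g x y = -p.g (-x) (-y) := by
  simp only [g_eq, reflect]; ring

theorem reflect_field (ε : ℝ) (z : ℝ × ℝ) : p.reflect.field ε z = -p.field ε (-z) := by
  ext
  · simp only [field, reflect_f, Prod.fst_neg, Prod.snd_neg]; ring
  · simp only [field, reflect_g, Prod.fst_neg, Prod.snd_neg]; ring

theorem reflect_lam : p.reflect.lam = -p.lam := by
  simp only [lam, reflect]; ring

theorem reflect_mu : p.reflect.mu = p.mu := by
  simp only [mu, reflect]; ring

theorem reflect_m : p.reflect.m = -p.m := by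
  rw [m, reflect_mu, reflect_lam, m]; simp only [reflect]; ring

end CubicPerturbation

theorem IsFirstReturn.reflect {p : CubicPerturbation} {s ε h h' : ℝ}
    (H : IsFirstReturn p s ε h h') : IsFirstReturn p.reflect (-s) ε h h' := by
  obtain ⟨h1, T, hT, γ, h0, hd, hn, hT'⟩ := H
  refine ⟨h1, T, hT, fun t => -γ t, ?_, fun t ht => ?_, fun t ht => ?_, ?_⟩
  · simp [h0, sectionPoint]
  · rw [p.reflect_field, neg_neg]
    exact (hd t ht).neg
  · simpa using hn t ht
  · simp [hT', sectionPoint]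

theorem isFirstReturn_reflect_iff {p : CubicPerturbation} {ε h h' : ℝ} :
    IsFirstReturn p.reflect 1 ε h h' ↔ IsFirstReturn p (-1) ε h h' := by
  refine ⟨fun H => ?_, fun H => ?_⟩
  · simpa [p.reflect_reflect] using H.reflect
  · simpa using H.reflect

theorem displacement_neg_one (p : CubicPerturbation) (h ε : ℝ) :
    displacement p (-1) h ε = displacement p.reflect 1 h ε := by
  by_cases hr : ∃ h', IsFirstReturn p (-1) ε h h'
  · obtain ⟨h', H⟩ := hr
    rw [H.displacement_eq (by norm_num), (isFirstReturn_reflect_iff.2 H).displacement_eq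
      (by norm_num)]
  · have hr' : ¬∃ h', IsFirstReturn p.reflect 1 ε h h' := by
      simpa only [isFirstReturn_reflect_iff] using hr
    rw [displacement, dif_neg hr, displacement, dif_neg hr']

/-- The source of all starred formulas: λ and m change sign under the reflection, μ does not, and
the a_ij and b_ij get the sign −(−1)^{i+j}. -/
theorem Mstar_eq (p : CubicPerturbation) (k : ℕ) (h : ℝ) : Mstar p k h = M p.reflect k h := by
  simp only [Mstar, M, melnikov, displacement_neg_one]

theorem eventually_hasSum_displacement_star (p : CubicPerturbation) {h : ℝ} (hh : h ∈ Sig) :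
    ∀ᶠ ε in 𝓝 (0 : ℝ), (∃ h', IsFirstReturn p (-1) ε h h') ∧
      HasSum (fun k : ℕ => ε ^ (k + 1) * Mstar p (k + 1) h) (displacement p (-1) h ε) := by
  filter_upwards [eventually_hasSum_displacement p.reflect hh] with ε h
  simpa only [isFirstReturn_reflect_iff, displacement_neg_one, Mstar_eq] using h

theorem vanish_reflect {p : CubicPerturbation} {k : ℕ} (H : Vanish p k) : Vanish p.reflect k := by
  refine ⟨fun h hh => ?_, fun h hh => ?_⟩
  · rw [← Mstar_eq]; exact H.2 h hh
  · rw [Mstar_eq, p.reflect_reflect]; exact H.1 h hh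

/-! ### The first Melnikov function -/

theorem Mstar_one (p : CubicPerturbation) {h : ℝ} (hh : h ∈ Sig) :
    Mstar p 1 h = (p.a 1 0 + p.b 0 1 + 4 / 7 * (p.a 1 2 + 3 * p.b 0 3) * h) * I 0 h
      - (2 * p.a 2 0 + p.b 1 1) * I 1 h
      + (3 * p.a 3 0 + p.b 2 1 + 1 / 7 * (p.a 1 2 + 3 * p.b 0 3)) * I 2 h := by
  rw [Mstar_eq, M_one _ hh]
  simp only [CubicPerturbation.reflect]
  ring

theorem M_one_eq_zero_iff (p : CubicPerturbation) :
    (∀ h ∈ Sig, M p 1 h = 0) ↔ M1Condition p := by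
  refine ⟨fun H => ?_, fun hp h hh => ?_⟩
  · obtain ⟨h0, h1, h2, -, h4, -⟩ := linearIndependent_I (p.a 1 0 + p.b 0 1)
      (4 / 7 * (p.a 1 2 + 3 * p.b 0 3)) (2 * p.a 2 0 + p.b 1 1) 0
      (3 * p.a 3 0 + p.b 2 1 + 1 / 7 * (p.a 1 2 + 3 * p.b 0 3)) 0 fun h hh => by
        have := H h hh; rw [M_one p hh] at this; linear_combination this
    exact ⟨h0, by linarith, h2, by linarith⟩
  · rw [M_one p hh, hp.h01, hp.h03, hp.h11, hp.h21]; ring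

theorem M1Condition.reflect {p : CubicPerturbation} (hp : M1Condition p) :
    M1Condition p.reflect := by
  obtain ⟨h1, h2, h3, h4⟩ := hp
  constructor <;> simp only [CubicPerturbation.reflect] <;> norm_num <;> linarith

theorem M1Condition_reflect_iff {p : CubicPerturbation} :
    M1Condition p.reflect ↔ M1Condition p :=
  ⟨fun h => by simpa only [p.reflect_reflect] using h.reflect, fun h => h.reflect⟩

theorem Mstar_one_eq_zero_iff (p : CubicPerturbation) :
    (∀ h ∈ Sig, Mstar p 1 h = 0) ↔ M1Condition p := by
  simp only [Mstar_eq]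
  rw [M_one_eq_zero_iff, M1Condition_reflect_iff]

theorem vanish_one_iff {p : CubicPerturbation} : Vanish p 1 ↔ M1Condition p := by
  rw [Vanish, M_one_eq_zero_iff, Mstar_one_eq_zero_iff, and_self]

theorem M1Condition_iff {p : CubicPerturbation} : M1Condition p ↔
    p.a 1 0 + p.b 0 1 = 0 ∧ p.a 1 2 + 3 * p.b 0 3 = 0 ∧ 2 * p.a 2 0 + p.b 1 1 = 0 ∧
      3 * p.a 3 0 + p.b 2 1 = 0 :=
  ⟨fun h => ⟨h.h01, h.h03, h.h11, h.h21⟩, fun ⟨h1, h2, h3, h4⟩ => ⟨h1, h2, h3, h4⟩⟩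

/-! ### The second Melnikov function -/

theorem Mstar_two {p : CubicPerturbation} (hp : M1Condition p) {h : ℝ} (hh : h ∈ Sig) :
    Mstar p 2 h = (-2 * p.a 0 0 * p.lam + (-(8 / 7) * p.a 0 2 * p.lam
        - (8 / 7 * p.a 3 0 + 8 / 63 * p.a 1 2) * p.mu) * h) * I 0 h
      - (-2 * (p.a 1 0 + p.a 3 0 + 1 / 8 * p.a 1 2) * p.lam
          - 2 * (p.a 0 0 + p.a 2 0 + 1 / 8 * p.a 0 2) * p.mu
          + (-p.a 1 2 * p.lam - p.a 0 2 * p.mu) * h) * I 1 h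
      + (-2 * (p.a 2 0 + 1 / 7 * p.a 0 2) * p.lam
          - 2 * (p.a 1 0 + 8 / 7 * p.a 3 0 + 8 / 63 * p.a 1 2) * p.mu
          + -(8 / 9) * p.a 1 2 * p.mu * h) * I 2 h := by
  rw [Mstar_eq, M_two hp.reflect hh, p.reflect_lam, p.reflect_mu]
  simp only [CubicPerturbation.reflect]
  ring

/-- The conditions for the vanishing of the coefficients of `M₂`, with the case `λ = μ = 0`
excluded. -/
structure M2Coefficients (p : CubicPerturbation) : Prop where
  h02 : p.a 0 2 = 0
  h12 : p.a 1 2 = 0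
  h00 : p.a 0 0 * p.lam = 0
  h30 : p.a 3 0 * p.mu = 0
  hβ : (p.a 1 0 + p.a 3 0) * p.lam + (p.a 0 0 + p.a 2 0) * p.mu = 0
  hγ : p.a 2 0 * p.lam + p.a 1 0 * p.mu = 0

theorem M2Coefficients.nontrivial {p : CubicPerturbation} (h1 : M1Condition p)
    (h : M2Coefficients p) : M2Nontrivial p where
  toM1Condition := h1
  h02 := h.h02
  h12 := h.h12
  hc x := by
    simp only [cP, CubicPerturbation.m]
    linear_combination (-2) * h.h00 - 2 * x ^ 4 * h.h30 - 2 * x ^ 2 * h.hγ - 2 * x ^ 3 * h.hβ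

/-- Unless λ = μ = 0, the coefficients of hI₀, hI₁, hI₂ force a₁₂ = a₀₂ = 0. The remaining equations
say that (λ + μx)(a₀₀ + a₁₀x + a₂₀x² + a₃₀x³) is a multiple of x³ − x. -/
theorem M_two_eq_zero_iff_coefficients {p : CubicPerturbation} (hp : M1Condition p) :
    (∀ h ∈ Sig, M p 2 h = 0) ↔ (p.lam = 0 ∧ p.mu = 0) ∨ M2Coefficients p := by
  constructor
  · intro H
    obtain ⟨h0, h1, h2, h3, h4, h5⟩ := linearIndependent_I _ _ _ _ _ _
      fun h hh => (M_two hp hh).symm.trans (H h hh)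
    have h5' : p.a 1 2 * p.mu = 0 := by linear_combination (-9 / 8) * h5
    by_cases hmu : p.mu = 0
    · by_cases hl : p.lam = 0
      · exact Or.inl ⟨hl, hmu⟩
      · have h12 : p.a 1 2 = 0 := by
          have : p.a 1 2 * p.lam = 0 := by rw [hmu] at h3; linear_combination -h3
          exact (mul_eq_zero.1 this).resolve_right hl
        have h02 : p.a 0 2 = 0 := by
          have : p.a 0 2 * p.lam = 0 := by rw [hmu] at h1; linear_combination (-7 / 8) * h1
          exact (mul_eq_zero.1 this).resolve_right hl
        rw [h12, h02] at h1 h2 h4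
        exact Or.inr ⟨h02, h12, by linear_combination (-1 / 2) * h0, by rw [hmu, mul_zero],
          by linear_combination (-1 / 2) * h2, by rw [hmu] at h4 ⊢; linear_combination (-1 / 2) * h4⟩
    · have h12 : p.a 1 2 = 0 := (mul_eq_zero.1 h5').resolve_right hmu
      have h02 : p.a 0 2 = 0 := by
        have : p.a 0 2 * p.mu = 0 := by rw [h12] at h3; linear_combination -h3
        exact (mul_eq_zero.1 this).resolve_right hmu
      rw [h12, h02] at h1 h2 h4
      have h30 : p.a 3 0 * p.mu = 0 := by linear_combination (-7 / 8) * h1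
      exact Or.inr ⟨h02, h12, by linear_combination (-1 / 2) * h0, h30,
        by linear_combination (-1 / 2) * h2, by linear_combination (-1 / 2) * h4 - 8 / 7 * h30⟩
  · rintro (⟨hl, hmu⟩ | ⟨h02, h12, h00, h30, hβ, hγ⟩) h hh
    · rw [M_two hp hh, hl, hmu]; ring
    · rw [M_two hp hh, h02, h12]
      linear_combination (-2 * I 0 h) * h00 - (8 / 7 * h * I 0 h + 16 / 7 * I 2 h) * h30
        - 2 * I 1 h * hβ - 2 * I 2 h * hγ

theorem CubicPerturbation.Q1_coefficients {p : CubicPerturbation} {q₀ q₁ q₂ q₃ : ℝ}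
    (H : ∀ x y, p.Q1 x y = (q₀ + q₁ * x + q₂ * x ^ 2 + q₃ * x ^ 3) * y) :
    p.a 0 0 = -q₀ ∧ p.a 1 0 = -q₁ ∧ p.a 2 0 = -q₂ ∧ p.a 3 0 = -q₃ ∧ p.a 0 2 = 0 ∧ p.a 1 2 = 0 := by
  simp only [Q1] at H
  have h1 := H 0 1
  have h2 := H 0 2
  have h3 := H 1 1
  have h4 := H 1 2
  have h5 := H (-1) 1
  have h6 := H 2 1
  norm_num at h1 h2 h3 h4 h5 h6
  refine ⟨?_, ?_, ?_, ?_, ?_, ?_⟩ <;> linarith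

/-- The cases correspond to the way in which λ + μx divides x(x − 1)(x + 1): its root is 0 for λ =
0, −1 for μ = λ, 1 for μ = −λ, and for μ = 0 it is a constant. If the root is none of these, the
cubic cofactor must vanish. -/
theorem M2Condition_iff (p : CubicPerturbation) :
    M2Condition p ↔ (p.lam = 0 ∧ p.mu = 0) ∨ M2Coefficients p := by
  constructor
  · rintro (h | ⟨h, hl⟩ | ⟨h, hl⟩ | ⟨h, hl⟩ | ⟨h, hl⟩ | ⟨h, hl⟩)
    · exact Or.inl h
    · obtain ⟨h1, h2, h3, h4, h5, h6⟩ := CubicPerturbation.Q1_coefficients (p := p)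
        (q₀ := -p.a 0 0) (q₁ := 0) (q₂ := p.a 0 0) (q₃ := 0) fun x y => by rw [h]; ring
      right; constructor <;> simp only [h2, h3, h4, h5, h6, hl] <;> ring
    · obtain ⟨h1, h2, h3, h4, h5, h6⟩ := CubicPerturbation.Q1_coefficients (p := p)
        (q₀ := 0) (q₁ := -p.a 1 0) (q₂ := 0) (q₃ := p.a 1 0) fun x y => by rw [h]; ring
      right; constructor <;> simp only [h1, h3, h4, h5, h6, hl] <;> ring
    · obtain ⟨h1, h2, h3, h4, h5, h6⟩ := CubicPerturbation.Q1_coefficients (p := p)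
        (q₀ := 0) (q₁ := -p.a 1 0) (q₂ := p.a 1 0) (q₃ := 0) fun x y => by rw [h]; ring
      right; constructor <;> simp only [h1, h3, h4, h5, h6, hl] <;> ring
    · obtain ⟨h1, h2, h3, h4, h5, h6⟩ := CubicPerturbation.Q1_coefficients (p := p)
        (q₀ := 0) (q₁ := -p.a 1 0) (q₂ := -p.a 1 0) (q₃ := 0) fun x y => by rw [h]; ring
      right; constructor <;> simp only [h1, h3, h4, h5, h6, hl] <;> ring
    · obtain ⟨h1, h2, h3, h4, h5, h6⟩ := CubicPerturbation.Q1_coefficients (p := p)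
        (q₀ := 0) (q₁ := 0) (q₂ := 0) (q₃ := 0) fun x y => by rw [h]; ring
      right; constructor <;> simp only [h1, h2, h3, h4, h5, h6] <;> ring
  · rintro (h | ⟨h02, h12, h00, h30, hβ, hγ⟩)
    · exact Or.inl h
    simp only [M2Condition, CubicPerturbation.Q1, h02, h12]
    by_cases hl : p.lam = 0
    · by_cases hmu : p.mu = 0
      · exact Or.inl ⟨hl, hmu⟩
      · have h30' := (mul_eq_zero.1 h30).resolve_right hmu
        rw [hl] at hβ hγ
        have h10 : p.a 1 0 = 0 :=
          (mul_eq_zero.1 (show p.a 1 0 * p.mu = 0 by linarith)).resolve_right hmu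
        have h20 : p.a 0 0 + p.a 2 0 = 0 :=
          (mul_eq_zero.1 (show (p.a 0 0 + p.a 2 0) * p.mu = 0 by linarith)).resolve_right hmu
        refine Or.inr (Or.inl ⟨fun x y => ?_, hl⟩)
        rw [h30', h10]
        linear_combination (-(x ^ 2) * y) * h20
    have h00' := (mul_eq_zero.1 h00).resolve_right hl
    by_cases hmu : p.mu = 0
    · rw [hmu] at hβ hγ
      have h20 : p.a 2 0 = 0 :=
        (mul_eq_zero.1 (show p.a 2 0 * p.lam = 0 by linarith)).resolve_right hl
      have h10 : p.a 1 0 + p.a 3 0 = 0 :=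
        (mul_eq_zero.1 (show (p.a 1 0 + p.a 3 0) * p.lam = 0 by linarith)).resolve_right hl
      refine Or.inr (Or.inr (Or.inl ⟨fun x y => ?_, hmu⟩))
      rw [h00', h20]
      linear_combination (-(x ^ 3) * y) * h10
    have h30' := (mul_eq_zero.1 h30).resolve_right hmu
    rw [h00', h30'] at hβ
    by_cases h1 : p.mu = p.lam
    · have h10 : p.a 1 0 + p.a 2 0 = 0 :=
        (mul_eq_zero.1 (show (p.a 1 0 + p.a 2 0) * p.lam = 0 by
          rw [h1] at hβ; linarith)).resolve_right hl
      refine Or.inr (Or.inr (Or.inr (Or.inl ⟨fun x y => ?_, h1⟩)))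
      rw [h00', h30']
      linear_combination (-(x ^ 2) * y) * h10
    by_cases h2 : p.mu = -p.lam
    · have h10 : p.a 1 0 - p.a 2 0 = 0 :=
        (mul_eq_zero.1 (show (p.a 1 0 - p.a 2 0) * p.lam = 0 by
          rw [h2] at hβ; linarith)).resolve_right hl
      refine Or.inr (Or.inr (Or.inr (Or.inr (Or.inl ⟨fun x y => ?_, h2⟩))))
      rw [h00', h30']
      linear_combination (x ^ 2 * y) * h10
    have hne : p.lam ^ 2 - p.mu ^ 2 ≠ 0 := by
      rw [show p.lam ^ 2 - p.mu ^ 2 = (p.lam - p.mu) * (p.lam + p.mu) by ring]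
      exact mul_ne_zero (fun h => h1 (by linarith)) fun h => h2 (by linarith)
    have h10 : p.a 1 0 = 0 := (mul_eq_zero.1 (show p.a 1 0 * (p.lam ^ 2 - p.mu ^ 2) = 0 by
      linear_combination p.lam * hβ - p.mu * hγ)).resolve_right hne
    have h20 : p.a 2 0 = 0 := (mul_eq_zero.1 (show p.a 2 0 * (p.lam ^ 2 - p.mu ^ 2) = 0 by
      linear_combination p.lam * hγ - p.mu * hβ)).resolve_right hne
    refine Or.inr (Or.inr (Or.inr (Or.inr (Or.inr ⟨fun x y => ?_,
      mul_ne_zero (mul_ne_zero hl hmu) hne⟩))))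
    rw [h00', h30', h10, h20]
    ring

theorem M2Coefficients.reflect {p : CubicPerturbation} (hp : M2Coefficients p) :
    M2Coefficients p.reflect := by
  obtain ⟨h1, h2, h3, h4, h5, h6⟩ := hp
  constructor <;> (try rw [p.reflect_lam]) <;> (try rw [p.reflect_mu]) <;>
    simp only [CubicPerturbation.reflect] <;> norm_num <;> (try assumption)
  all_goals first | exact mul_eq_zero.1 h3 | exact mul_eq_zero.1 h4 | linarith

theorem M_two_eq_zero_iff {p : CubicPerturbation} (hp : M1Condition p) :
    (∀ h ∈ Sig, M p 2 h = 0) ↔ M2Condition p := by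
  rw [M_two_eq_zero_iff_coefficients hp, M2Condition_iff]

theorem M2Coefficients_reflect_iff {p : CubicPerturbation} :
    (p.reflect.lam = 0 ∧ p.reflect.mu = 0) ∨ M2Coefficients p.reflect ↔
      (p.lam = 0 ∧ p.mu = 0) ∨ M2Coefficients p := by
  rw [p.reflect_lam, p.reflect_mu, neg_eq_zero]
  exact or_congr_right ⟨fun h => by simpa only [p.reflect_reflect] using h.reflect,
    fun h => h.reflect⟩

theorem Mstar_two_eq_zero_iff {p : CubicPerturbation} (hp : M1Condition p) :
    (∀ h ∈ Sig, Mstar p 2 h = 0) ↔ M2Condition p := by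
  simp only [Mstar_eq]
  rw [M_two_eq_zero_iff_coefficients hp.reflect, M2Coefficients_reflect_iff, M2Condition_iff]

/-- If `M₁ = 0` and `λ = μ = 0`, all the further Melnikov functions vanish. -/
theorem M_trivial {p : CubicPerturbation} (hp : M1Condition p) (hl : p.lam = 0) (hmu : p.mu = 0)
    (k : ℕ) {h : ℝ} (hh : h ∈ Sig) : M p (k + 2) h = 0 := by
  have hL : ∀ x, primL p x = 0 := fun x => by rw [primL, hl, hmu]; ring
  -- Since `primL` vanishes, q₁ = 0, and the chain can be continued by zeros to any length.
  refine ((melnikov_value p (k + 1) (fun i _ _ => if i = 0 then 1 else 0)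
    (fun i x y => if i = 0 then primQ p x y else 0) (fun _ _ => rfl) (by simp; fun_prop) ?_ hh
    (fun _ _ => 0) 0 0 0 ?_).2).trans (by ring)
  · intro i hi x y x' y' t hx hy
    rcases Nat.eq_zero_or_pos i with rfl | hi
    · simpa [hL] using isStep_primQ hp x y x' y' t hx hy
    · simpa [hi.ne'] using hasDerivAt_const t (0 : ℝ)
  · intro x y x' y' t hx hy _ _
    simpa using hasDerivAt_const t (0 : ℝ)

theorem trivial_or_nontrivial {p : CubicPerturbation} (h1 : Vanish p 1) (h2 : Vanish p 2) :
    M1Condition p ∧ ((p.lam = 0 ∧ p.mu = 0) ∨ M2Coefficients p) :=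
  have h := vanish_one_iff.1 h1
  ⟨h, (M_two_eq_zero_iff_coefficients h).1 h2.1⟩

theorem vanish_two_of_coefficients {p : CubicPerturbation} (h1 : M1Condition p)
    (h2 : M2Coefficients p) : Vanish p 2 := by
  have h := (M2Condition_iff p).2 (Or.inr h2)
  exact ⟨(M_two_eq_zero_iff h1).2 h, (Mstar_two_eq_zero_iff h1).2 h⟩

/-! ### The third Melnikov function -/

theorem M_three {p : CubicPerturbation} (h1 : Vanish p 1) (h2 : Vanish p 2) {h : ℝ}
    (hh : h ∈ Sig) :
    M p 3 h = (p.m * p.b 0 0 + p.m * (4 / 7 * p.lam - 6 / 7 * p.a 1 1) * h) * I 0 h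
      + (p.m * (p.b 1 0 + p.b 3 0 + 1 / 8 * p.mu - 3 / 8 * p.a 2 1)
          + p.m * (1 / 2 * p.mu - 3 / 2 * p.a 2 1) * h) * I 1 h
      + p.m * (p.b 2 0 + 1 / 7 * p.lam - 3 / 14 * p.a 1 1) * I 2 h := by
  obtain ⟨hp, ⟨hl, hmu⟩ | hc⟩ := trivial_or_nontrivial h1 h2
  · rw [M_trivial hp hl hmu 1 hh, CubicPerturbation.m, hl, hmu]; ring
  · exact M_three_nontrivial (hc.nontrivial hp) hh

theorem Mstar_three {p : CubicPerturbation} (h1 : Vanish p 1) (h2 : Vanish p 2) {h : ℝ}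
    (hh : h ∈ Sig) :
    Mstar p 3 h = (p.m * p.b 0 0 + p.m * (4 / 7 * p.lam - 6 / 7 * p.a 1 1) * h) * I 0 h
      - (p.m * (p.b 1 0 + p.b 3 0 + 1 / 8 * p.mu - 3 / 8 * p.a 2 1)
          + p.m * (1 / 2 * p.mu - 3 / 2 * p.a 2 1) * h) * I 1 h
      + p.m * (p.b 2 0 + 1 / 7 * p.lam - 3 / 14 * p.a 1 1) * I 2 h := by
  rw [Mstar_eq, M_three (vanish_reflect h1) (vanish_reflect h2) hh, p.reflect_lam, p.reflect_mu,
    p.reflect_m]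
  simp only [CubicPerturbation.reflect]
  ring

/-- These are the coefficients of M₃ before y³ dx and xy³ dx are reduced to the I_k, the form
required by `isStep_Q3`. The factor m is kept, so that m = 0 is included. -/
theorem M_three_coefficients {p : CubicPerturbation} (h1 : Vanish p 1) (h2 : Vanish p 2)
    (H : ∀ h ∈ Sig, M p 3 h = 0) :
    p.m * p.b 0 0 = 0 ∧ p.m * p.b 2 0 = 0 ∧ p.m * (p.b 1 0 + p.b 3 0) = 0 ∧
      p.m * (p.lam / 3 - p.a 1 1 / 2) = 0 ∧ p.m * (p.mu / 3 - p.a 2 1) = 0 := by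
  obtain ⟨e0, e1, e2, e3, e4, -⟩ := linearIndependent_I (p.m * p.b 0 0)
    (p.m * (4 / 7 * p.lam - 6 / 7 * p.a 1 1))
    (p.m * (p.b 1 0 + p.b 3 0 + 1 / 8 * p.mu - 3 / 8 * p.a 2 1))
    (p.m * (1 / 2 * p.mu - 3 / 2 * p.a 2 1))
    (p.m * (p.b 2 0 + 1 / 7 * p.lam - 3 / 14 * p.a 1 1)) 0 fun h hh => by
      have := H h hh; rw [M_three h1 h2 hh] at this; linear_combination this
  refine ⟨e0, ?_, ?_, ?_, ?_⟩
  · linear_combination e4 - 1 / 4 * e1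
  · linear_combination e2 - 1 / 4 * e3
  · linear_combination 7 / 12 * e1
  · linear_combination 2 / 3 * e3

theorem M_three_eq_zero_iff {p : CubicPerturbation} (h1 : Vanish p 1) (h2 : Vanish p 2)
    (hm : p.m ≠ 0) : (∀ h ∈ Sig, M p 3 h = 0) ↔
      p.b 0 0 = 0 ∧ p.b 2 0 = 0 ∧ p.b 1 0 + p.b 3 0 = 0 ∧
        2 * p.lam - 3 * p.a 1 1 = 0 ∧ p.mu - 3 * p.a 2 1 = 0 := by
  constructor
  · intro H
    obtain ⟨e0, e1, e2, e3, e4⟩ := M_three_coefficients h1 h2 H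
    simp only [mul_eq_zero, hm, false_or] at e0 e1 e2 e3 e4
    exact ⟨e0, e1, e2, by linarith, by linarith⟩
  · rintro ⟨e0, e1, e2, e3, e4⟩ h hh
    rw [M_three h1 h2 hh]
    linear_combination p.m * (I 0 h * e0 + I 2 h * e1 + I 1 h * e2
      + (2 / 7 * h * I 0 h + 1 / 14 * I 2 h) * e3 + (1 / 8 + 1 / 2 * h) * I 1 h * e4)

theorem Mstar_three_eq_zero_iff {p : CubicPerturbation} (h1 : Vanish p 1) (h2 : Vanish p 2)
    (hm : p.m ≠ 0) : (∀ h ∈ Sig, Mstar p 3 h = 0) ↔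
      p.b 0 0 = 0 ∧ p.b 2 0 = 0 ∧ p.b 1 0 + p.b 3 0 = 0 ∧
        2 * p.lam - 3 * p.a 1 1 = 0 ∧ p.mu - 3 * p.a 2 1 = 0 := by
  simp only [Mstar_eq]
  rw [M_three_eq_zero_iff (vanish_reflect h1) (vanish_reflect h2)
    (by rwa [p.reflect_m, neg_ne_zero]), p.reflect_lam, p.reflect_mu]
  simp only [CubicPerturbation.reflect]
  norm_num
  exact fun _ _ _ _ => ⟨fun h => by linarith, fun h => by linarith⟩

/-! ### The fourth Melnikov function -/

theorem M2Coefficients.m3 {p : CubicPerturbation} (h1 : Vanish p 1) (h2 : Vanish p 2)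
    (h3 : Vanish p 3) (hc : M2Coefficients p) : M3Nontrivial p := by
  obtain ⟨e0, e1, e2, e3, e4⟩ := M_three_coefficients h1 h2 h3.1
  exact ⟨hc.nontrivial (vanish_one_iff.1 h1), e0, e1, e2, e3, e4⟩

section MFour

variable {p : CubicPerturbation} (h1 : Vanish p 1) (h2 : Vanish p 2) (h3 : Vanish p 3)
  {h : ℝ} (hh : h ∈ Sig)

include h1 h2 h3 hh

/-- Here c = a₀₀(x² − 1), and c c' y dx = 2a₀₀²(x³ − x) y dx is −2a₀₀² y² dy on a level, which is
exact. -/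
theorem M_four_of_lam_eq_zero (hl : p.lam = 0) : M p 4 h = 0 := by
  obtain ⟨hp, ⟨hl, hmu⟩ | hc⟩ := trivial_or_nontrivial h1 h2
  · exact M_trivial hp hl hmu 2 hh
  by_cases hmu : p.mu = 0
  · exact M_trivial hp hl hmu 2 hh
  obtain ⟨-, -, -, h30, hβ, hγ⟩ := id hc
  rw [hl] at hβ hγ
  have h30' := (mul_eq_zero.1 h30).resolve_right hmu
  have h10 : p.a 1 0 = 0 :=
    (mul_eq_zero.1 (show p.a 1 0 * p.mu = 0 by linarith)).resolve_right hmu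
  have h20 : p.a 2 0 = -p.a 0 0 := by
    have := (mul_eq_zero.1 (show (p.a 0 0 + p.a 2 0) * p.mu = 0 by linarith)).resolve_right hmu
    linarith
  refine (M_four_nontrivial (hc.m3 h1 h2 h3) hh
    (fun x y => -(2 / 3) * p.m * p.a 0 0 ^ 2 * y ^ 3) 0 0 0 ?_).trans (by ring)
  intro x y x' y' t hx hy hl' hH
  apply HasDerivAt.congr_deriv
  · repeat' first
      | exact hx | exact hy | apply hasDerivAt_const | apply HasDerivAt.fun_add
      | apply HasDerivAt.pow_succ' | apply HasDerivAt.fun_mul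
  · simp only [cP, h30', h10, h20]
    push_cast
    linear_combination (-2 * p.m * p.a 0 0 ^ 2 * y t) * hl'

/-- Here c = a₁₀(x³ − x), so c y dx = −a₁₀ y² dy on a level. By parts, ∮ c c' y dx = 2a₁₀² ∮ x y³
dx, and ∮ x y³ dx = (3/2)(1/4 + h) I₁. -/
theorem M_four_of_mu_eq_zero (hmu : p.mu = 0) :
    M p 4 h = 6 * p.a 1 0 ^ 3 * p.lam * (1 / 4 + h) * I 1 h := by
  by_cases hl : p.lam = 0
  · rw [M_four_of_lam_eq_zero h1 h2 h3 hh hl, hl]; ring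
  obtain ⟨hp, ⟨hl', -⟩ | hc⟩ := trivial_or_nontrivial h1 h2
  · exact absurd hl' hl
  obtain ⟨-, -, h00, -, hβ, hγ⟩ := id hc
  have h00' := (mul_eq_zero.1 h00).resolve_right hl
  rw [hmu] at hβ hγ
  have h20 : p.a 2 0 = 0 :=
    (mul_eq_zero.1 (show p.a 2 0 * p.lam = 0 by linarith)).resolve_right hl
  have h30 : p.a 3 0 = -p.a 1 0 := by
    have := (mul_eq_zero.1 (show (p.a 1 0 + p.a 3 0) * p.lam = 0 by linarith)).resolve_right hl
    linarith
  have hm : p.m = 2 * p.a 1 0 * p.lam := by rw [CubicPerturbation.m, hmu]; ring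
  refine (M_four_nontrivial (hc.m3 h1 h2 h3) hh
    (fun x y => -(p.m * p.a 1 0 ^ 2 / 3) * ((3 * x ^ 2 - 1) * y ^ 3)
      + 2 * p.m * p.a 1 0 ^ 2 * (x ^ 2 * y ^ 3 / 8 - y ^ 3 / 8))
    0 (3 * p.m * p.a 1 0 ^ 2 * (1 / 4 + h)) 0 ?_).trans (by rw [hm]; ring)
  intro x y x' y' t hx hy hl' hH
  apply HasDerivAt.congr_deriv
  · repeat' first
      | exact hx | exact hy | apply hasDerivAt_const | apply HasDerivAt.fun_sub
      | apply HasDerivAt.fun_add | apply HasDerivAt.div_const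
      | apply HasDerivAt.pow_succ' | apply HasDerivAt.fun_mul
  · simp only [cP, h30, h00', h20]
    rw [← hH, Ham]
    push_cast
    linear_combination (-(p.m * p.a 1 0 ^ 2) * (3 * x t ^ 2 - 1) * y t
      + 2 * p.m * p.a 1 0 ^ 2 * (3 / 8 * x t ^ 2 * y t - 3 / 8 * y t)) * hl'

/-- The parameter s = ±1 treats both signs at once. Here c = −a₁₀(x − s x²), and c c' = a₁₀²(x − 3s
x² + 2x³) is 3a₁₀²(x − s x²) modulo x³ − x, whose product with y dx is exact on a level. -/
theorem M_four_of_mu_eq {s : ℝ} (hs : s ^ 2 = 1) (hmu : p.mu = s * p.lam) :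
    M p 4 h = 6 * p.a 1 0 ^ 3 * p.lam * (I 1 h - s * I 2 h) := by
  by_cases hl : p.lam = 0
  · rw [M_four_of_lam_eq_zero h1 h2 h3 hh hl, hl]; ring
  have hs0 : s ≠ 0 := by rintro rfl; norm_num at hs
  have hmu0 : p.mu ≠ 0 := by rw [hmu]; exact mul_ne_zero hs0 hl
  obtain ⟨hp, ⟨hl', -⟩ | hc⟩ := trivial_or_nontrivial h1 h2
  · exact absurd hl' hl
  obtain ⟨-, -, h00, h30, hβ, hγ⟩ := id hc
  have h00' := (mul_eq_zero.1 h00).resolve_right hl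
  have h30' := (mul_eq_zero.1 h30).resolve_right hmu0
  rw [hmu] at hγ
  have h20 : p.a 2 0 = -s * p.a 1 0 := by
    have := (mul_eq_zero.1 (show (p.a 2 0 + s * p.a 1 0) * p.lam = 0 by linarith)).resolve_right hl
    linarith
  have hm : p.m = 2 * p.a 1 0 * p.lam := by rw [CubicPerturbation.m, h00']; ring
  refine (M_four_nontrivial (hc.m3 h1 h2 h3) hh
    (fun x y => -(2 / 3) * p.m * p.a 1 0 ^ 2 * y ^ 3)
    0 (3 * p.m * p.a 1 0 ^ 2) (-3 * s * p.m * p.a 1 0 ^ 2) ?_).trans (by rw [hm]; ring)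
  intro x y x' y' t hx hy hl' hH
  apply HasDerivAt.congr_deriv
  · repeat' first
      | exact hx | exact hy | apply hasDerivAt_const | apply HasDerivAt.fun_add
      | apply HasDerivAt.pow_succ' | apply HasDerivAt.fun_mul
  · simp only [cP, h30', h00', h20]
    push_cast
    linear_combination (-2 * p.m * p.a 1 0 ^ 2 * y t) * hl'
      - (2 * p.m * p.a 1 0 ^ 2 * x t ^ 3 * y t * x') * hs

theorem M_four_generic (hne : p.lam * p.mu * (p.lam ^ 2 - p.mu ^ 2) ≠ 0) : M p 4 h = 0 := by
  have hl : p.lam ≠ 0 := fun h => hne (by rw [h]; ring)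
  have hmu : p.mu ≠ 0 := fun h => hne (by rw [h]; ring)
  have hd : p.lam ^ 2 - p.mu ^ 2 ≠ 0 := fun h => hne (by rw [h]; ring)
  obtain ⟨hp, ⟨hl', -⟩ | hc⟩ := trivial_or_nontrivial h1 h2
  · exact absurd hl' hl
  obtain ⟨-, -, h00, h30, hβ, hγ⟩ := id hc
  have h00' := (mul_eq_zero.1 h00).resolve_right hl
  have h30' := (mul_eq_zero.1 h30).resolve_right hmu
  rw [h00', h30'] at hβ
  have h10 : p.a 1 0 = 0 := (mul_eq_zero.1 (show p.a 1 0 * (p.lam ^ 2 - p.mu ^ 2) = 0 by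
    linear_combination p.lam * hβ - p.mu * hγ)).resolve_right hd
  have h20 : p.a 2 0 = 0 := (mul_eq_zero.1 (show p.a 2 0 * (p.lam ^ 2 - p.mu ^ 2) = 0 by
    linear_combination p.lam * hγ - p.mu * hβ)).resolve_right hd
  refine (M_four_nontrivial (hc.m3 h1 h2 h3) hh (fun _ _ => 0) 0 0 0 ?_).trans (by ring)
  intro x y x' y' t hx hy hl' hH
  simpa [cP, h30', h00', h10, h20] using hasDerivAt_const t (0 : ℝ)

end MFour

section MFourStar

variable {p : CubicPerturbation} (h1 : Vanish p 1) (h2 : Vanish p 2) (h3 : Vanish p 3)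
  {h : ℝ} (hh : h ∈ Sig)

include h1 h2 h3 hh

theorem Mstar_four_of_lam_eq_zero (hl : p.lam = 0) : Mstar p 4 h = 0 := by
  rw [Mstar_eq]
  exact M_four_of_lam_eq_zero (vanish_reflect h1) (vanish_reflect h2) (vanish_reflect h3) hh
    (by rw [p.reflect_lam, hl, neg_zero])

theorem Mstar_four_of_mu_eq_zero (hmu : p.mu = 0) :
    Mstar p 4 h = -6 * p.a 1 0 ^ 3 * p.lam * (1 / 4 + h) * I 1 h := by
  rw [Mstar_eq, M_four_of_mu_eq_zero (vanish_reflect h1) (vanish_reflect h2) (vanish_reflect h3)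
    hh (by rw [p.reflect_mu, hmu]), p.reflect_lam]
  simp [CubicPerturbation.reflect]

theorem Mstar_four_of_mu_eq {s : ℝ} (hs : s ^ 2 = 1) (hmu : p.mu = s * p.lam) :
    Mstar p 4 h = -6 * p.a 1 0 ^ 3 * p.lam * (I 1 h + s * I 2 h) := by
  rw [Mstar_eq, M_four_of_mu_eq (vanish_reflect h1) (vanish_reflect h2) (vanish_reflect h3)
    hh (s := -s) (by rw [neg_sq, hs]) (by rw [p.reflect_mu, p.reflect_lam, hmu]; ring),
    p.reflect_lam]
  simp [CubicPerturbation.reflect]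

theorem Mstar_four_generic (hne : p.lam * p.mu * (p.lam ^ 2 - p.mu ^ 2) ≠ 0) :
    Mstar p 4 h = 0 := by
  rw [Mstar_eq]
  refine M_four_generic (vanish_reflect h1) (vanish_reflect h2) (vanish_reflect h3) hh ?_
  rw [p.reflect_lam, p.reflect_mu]
  intro h
  exact hne (by linear_combination -h)

end MFourStar

/-! ### Realization of all coefficients -/

theorem vanish_three_of_conditions {p : CubicPerturbation} (h1 : Vanish p 1) (h2 : Vanish p 2)
    (e0 : p.b 0 0 = 0) (e1 : p.b 2 0 = 0) (e2 : p.b 1 0 + p.b 3 0 = 0)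
    (e3 : 2 * p.lam - 3 * p.a 1 1 = 0) (e4 : p.mu - 3 * p.a 2 1 = 0) : Vanish p 3 := by
  refine ⟨fun h hh => ?_, fun h hh => ?_⟩
  · rw [M_three h1 h2 hh]
    linear_combination p.m * (I 0 h * e0 + I 2 h * e1 + I 1 h * e2
      + (2 / 7 * h * I 0 h + 1 / 14 * I 2 h) * e3 + (1 / 8 + 1 / 2 * h) * I 1 h * e4)
  · rw [Mstar_three h1 h2 hh]
    linear_combination p.m * (I 0 h * e0 + I 2 h * e1 - I 1 h * e2
      + (2 / 7 * h * I 0 h + 1 / 14 * I 2 h) * e3 - (1 / 8 + 1 / 2 * h) * I 1 h * e4)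

theorem M_one_free (α₀ α₁ β₀ γ₀ : ℝ) : ∃ p : CubicPerturbation, ∀ h ∈ Sig,
    M p 1 h = (α₀ + α₁ * h) * I 0 h + β₀ * I 1 h + γ₀ * I 2 h := by
  let p : CubicPerturbation := ⟨fun _ _ => 0, fun
    | 0, 1 => α₀
    | 0, 3 => 7 / 12 * α₁
    | 1, 1 => β₀
    | 2, 1 => γ₀ - α₁ / 4
    | _, _ => 0⟩
  refine ⟨p, fun h hh => ?_⟩
  rw [M_one _ hh]
  simp only [p]
  ring

/-- With λ = 1, μ = 2 the equations are solved successively for a₁₂, a₀₂, a₃₀, a₀₀. They leave a₁₀ +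
2a₂₀ = u and 2a₁₀ + a₂₀ = v, which is solvable because λ² ≠ μ². -/
theorem M_two_free (α₀ α₁ β₀ β₁ γ₀ γ₁ : ℝ) : ∃ p : CubicPerturbation, Vanish p 1 ∧ ∀ h ∈ Sig,
    M p 2 h = (α₀ + α₁ * h) * I 0 h + (β₀ + β₁ * h) * I 1 h + (γ₀ + γ₁ * h) * I 2 h := by
  let a00 := -α₀ / 2
  let a12 := -(9 / 16) * γ₁
  let a02 := -(β₁ + a12) / 2
  let a30 := -(7 / 16) * (α₁ + 8 / 7 * a02) - a12 / 9
  let u := -β₀ / 2 - a30 - a12 / 8 - 2 * a00 - a02 / 4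
  let v := -γ₀ / 2 - a02 / 7 - 2 * (8 / 7 * a30 + 8 / 63 * a12)
  let a10 := (2 * v - u) / 3
  let a20 := (2 * u - v) / 3
  let p : CubicPerturbation := ⟨fun
    | 0, 0 => a00
    | 1, 0 => a10
    | 2, 0 => a20
    | 3, 0 => a30
    | 0, 2 => a02
    | 1, 2 => a12
    | _, _ => 0, fun
    | 0, 1 => -a10
    | 0, 3 => -a12 / 3
    | 1, 1 => -2 * a20
    | 2, 1 => -3 * a30
    | 0, 2 => 1
    | 1, 2 => 2
    | _, _ => 0⟩
  have h1 : M1Condition p := ⟨by simp [p], by simp only [p]; ring, by simp [p], by simp [p]⟩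
  have hl : p.lam = 1 := by simp [p, CubicPerturbation.lam]
  have hmu : p.mu = 2 := by simp [p, CubicPerturbation.mu]
  refine ⟨p, vanish_one_iff.2 h1, fun h hh => ?_⟩
  rw [M_two h1 hh, hl, hmu]
  simp only [p, a20, a10, u, v, a30, a02, a12, a00]
  ring

/-- The case μ = 0, λ = 1, c = (x³ − x)/2, so that m = 1. The parameters a₁₁, a₂₁, b₀₀, b₁₀, b₂₀
stay free; b₀₂ and b₁₂ compensate to keep λ and μ. -/
theorem M_three_free (α₀ α₁ β₀ β₁ γ₀ : ℝ) : ∃ p : CubicPerturbation, Vanish p 1 ∧ Vanish p 2 ∧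
    p.m ≠ 0 ∧ ∀ h ∈ Sig,
      M p 3 h = (α₀ + α₁ * h) * I 0 h + (β₀ + β₁ * h) * I 1 h + γ₀ * I 2 h := by
  let a11 := 2 / 3 - 7 / 6 * α₁
  let a21 := -(2 / 3) * β₁
  let p : CubicPerturbation := ⟨fun
    | 1, 0 => 1 / 2
    | 3, 0 => -1 / 2
    | 1, 1 => a11
    | 2, 1 => a21
    | _, _ => 0, fun
    | 0, 1 => -1 / 2
    | 2, 1 => 3 / 2
    | 0, 2 => 1 - a11 / 2
    | 1, 2 => -a21
    | 0, 0 => α₀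
    | 1, 0 => β₀ - β₁ / 4
    | 2, 0 => γ₀ - 1 / 7 + 3 / 14 * a11
    | _, _ => 0⟩
  have h1 : M1Condition p := by constructor <;> simp only [p] <;> norm_num
  have hl : p.lam = 1 := by simp [p, CubicPerturbation.lam]
  have hmu : p.mu = 0 := by simp [p, CubicPerturbation.mu]
  have hm : p.m = 1 := by rw [CubicPerturbation.m, hl, hmu]; simp [p]
  have h2 : M2Coefficients p := by 
    constructor <;> (try simp only [hl, hmu]) <;> simp only [p] <;> norm_num
  have hv1 := vanish_one_iff.2 h1
  have hv2 := vanish_two_of_coefficients h1 h2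
  refine ⟨p, hv1, hv2, by rw [hm]; exact one_ne_zero, fun h hh => ?_⟩
  rw [M_three hv1 hv2 hh, hm, hl, hmu]
  simp only [p, a11, a21]
  ring

/-- Here a₁₀ = 1 and 6λ = c, and a₁₁ = 2λ/3 is imposed by M₃ = 0. -/
theorem M_four_free_mu_eq_zero (c : ℝ) : ∃ p : CubicPerturbation, Vanish p 1 ∧ Vanish p 2 ∧
    Vanish p 3 ∧ ∀ h ∈ Sig, M p 4 h = c * ((1 / 4 + h) * I 1 h) := by
  let p : CubicPerturbation := ⟨fun
    | 1, 0 => 1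
    | 3, 0 => -1
    | 1, 1 => c / 9
    | _, _ => 0, fun
    | 0, 1 => -1
    | 2, 1 => 3
    | 0, 2 => c / 9
    | _, _ => 0⟩
  have h1 : M1Condition p := by constructor <;> simp only [p] <;> norm_num
  have hl : p.lam = c / 6 := by simp only [p, CubicPerturbation.lam]; ring
  have hmu : p.mu = 0 := by simp [p, CubicPerturbation.mu]
  have h2 : M2Coefficients p := by 
    constructor <;> (try simp only [hl, hmu]) <;> simp only [p] <;> norm_num
  have hv1 := vanish_one_iff.2 h1
  have hv2 := vanish_two_of_coefficients h1 h2
  have hv3 := vanish_three_of_conditions hv1 hv2 rfl rfl (by simp [p])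
    (by rw [hl]; simp only [p]; ring) (by rw [hmu]; simp [p])
  refine ⟨p, hv1, hv2, hv3, fun h hh => ?_⟩
  rw [M_four_of_mu_eq_zero hv1 hv2 hv3 hh hmu, hl]
  simp only [p]
  ring

theorem M_four_free_mu_eq {s : ℝ} (hs : s ^ 2 = 1) (c : ℝ) : ∃ p : CubicPerturbation,
    Vanish p 1 ∧ Vanish p 2 ∧ Vanish p 3 ∧ ∀ h ∈ Sig, M p 4 h = c * (I 1 h - s * I 2 h) := by
  let p : CubicPerturbation := ⟨fun
    | 1, 0 => 1
    | 2, 0 => -s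
    | 1, 1 => c / 9
    | 2, 1 => s * c / 18
    | _, _ => 0, fun
    | 0, 1 => -1
    | 1, 1 => 2 * s
    | 0, 2 => c / 9
    | 1, 2 => s * c / 9
    | _, _ => 0⟩
  have h1 : M1Condition p := by constructor <;> simp only [p] <;> ring
  have hl : p.lam = c / 6 := by simp only [p, CubicPerturbation.lam]; ring
  have hmu : p.mu = s * p.lam := by rw [hl]; simp only [p, CubicPerturbation.mu]; ring
  have h2 : M2Coefficients p := by
    constructor <;> (try simp only [hmu, hl]) <;> simp only [p]
    · ring
    · ring
    · linear_combination (-c / 6) * hs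
    · ring
  have hv1 := vanish_one_iff.2 h1
  have hv2 := vanish_two_of_coefficients h1 h2
  have hv3 := vanish_three_of_conditions hv1 hv2 rfl rfl (by simp [p])
    (by rw [hl]; simp only [p]; ring) (by rw [hmu, hl]; simp only [p]; ring)
  refine ⟨p, hv1, hv2, hv3, fun h hh => ?_⟩
  rw [M_four_of_mu_eq hv1 hv2 hv3 hh hs hmu, hl]
  simp only [p]
  ring

/-! ### Closed level curves and centers -/

/-- The point with polar coordinates `(r, -θ)` around `c`. -/
def polarPt (c : ℝ × ℝ) (r θ : ℝ) : ℝ × ℝ := (c.1 + r * Real.cos θ, c.2 - r * Real.sin θ)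

theorem polarPt_mem_ball {c : ℝ × ℝ} {r ρ : ℝ} (θ : ℝ) (h0 : 0 ≤ r) (hr : r < ρ) :
    polarPt c r θ ∈ Metric.ball c ρ := by
  have h1 := mul_le_mul_of_nonneg_left (Real.abs_cos_le_one θ) h0
  have h2 := mul_le_mul_of_nonneg_left (Real.abs_sin_le_one θ) h0
  rw [Metric.mem_ball, Prod.dist_eq, max_lt_iff, Real.dist_eq, Real.dist_eq]
  simp only [polarPt, add_sub_cancel_left, sub_sub_cancel_left, abs_neg, abs_mul, abs_of_nonneg h0]
  constructor <;> linarith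

theorem exists_polarPt (c z : ℝ × ℝ) :
    ∃ θ, z = polarPt c (√((z.1 - c.1) ^ 2 + (z.2 - c.2) ^ 2)) θ := by
  let w : ℂ := ⟨z.1 - c.1, -(z.2 - c.2)⟩
  have hw : ‖w‖ = √((z.1 - c.1) ^ 2 + (z.2 - c.2) ^ 2) := by
    rw [Complex.norm_eq_sqrt_sq_add_sq]; simp only [w, neg_sq]
  refine ⟨w.arg, ?_⟩
  rw [← hw]
  ext
  · simp [polarPt, Complex.norm_mul_cos_arg, w]
  · simp [polarPt, Complex.norm_mul_sin_arg, w]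

theorem exists_forall_le_of_periodic {w : ℝ → ℝ} (hw : Continuous w)
    (hp : Function.Periodic w (2 * Real.pi)) : ∃ s, ∀ θ, w θ ≤ w s := by
  obtain ⟨s, -, hs⟩ := isCompact_Icc.exists_isMaxOn (nonempty_Icc.2 Real.two_pi_pos.le)
    hw.continuousOn
  refine ⟨s, fun θ => ?_⟩
  obtain ⟨θ', hθ', h⟩ := hp.exists_mem_Ico₀ Real.two_pi_pos θ
  rw [h]
  exact hs (Ico_subset_Icc_self hθ')

section Center

variable {X : ℝ × ℝ → ℝ × ℝ} {c : ℝ × ℝ} {ρ : ℝ} {G : ℝ × ℝ → ℝ}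
  (hG : ∀ z ∈ Metric.ball c ρ, AnalyticAt ℝ G z)
  (hdG : ∀ z ∈ Metric.ball c ρ, ∃ κ > 0, ∀ v : ℝ × ℝ,
    fderiv ℝ G z v = κ * ((X z).1 * v.2 - (X z).2 * v.1))
  (hS : ∀ z ∈ Metric.ball c ρ, z ≠ c → 0 < (z.2 - c.2) * (X z).1 - (z.1 - c.1) * (X z).2)

include hG in
theorem hasDerivAt_radial {r θ : ℝ} (h0 : 0 ≤ r) (hr : r < ρ) :
    HasDerivAt (fun s => G (polarPt c s θ))
      (fderiv ℝ G (polarPt c r θ) (Real.cos θ, -Real.sin θ)) r := by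
  have h1 : HasDerivAt (fun s => polarPt c s θ) (Real.cos θ, -Real.sin θ) r := by
    simp only [polarPt]
    refine (((hasDerivAt_id r).mul_const _).const_add _).prodMk
      (((hasDerivAt_id r).mul_const _).const_sub _) |>.congr_deriv ?_
    simp
  exact ((hG _ (polarPt_mem_ball θ h0 hr)).differentiableAt.hasFDerivAt).comp_hasDerivAt r h1

theorem polarPt_ne {r : ℝ} (h0 : 0 < r) (θ : ℝ) : polarPt c r θ ≠ c := by
  intro h
  have h1 := congrArg Prod.fst h
  have h2 := congrArg Prod.snd h
  simp only [polarPt, add_eq_left, sub_eq_self, mul_eq_zero, h0.ne', false_or] at h1 h2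
  have := Real.sin_sq_add_cos_sq θ
  rw [h1, h2] at this
  norm_num at this

-- The radial derivative is κ/r times the expression in `hS`, and that expression is r² times the
-- angular velocity in the clockwise direction of increasing θ.
include hdG hS in
theorem radial_pos {r θ : ℝ} (h0 : 0 < r) (hr : r < ρ) :
    0 < fderiv ℝ G (polarPt c r θ) (Real.cos θ, -Real.sin θ) := by
  have hz := polarPt_mem_ball (c := c) θ h0.le hr
  obtain ⟨κ, hκ, h⟩ := hdG _ hz
  have hs := hS _ hz (polarPt_ne h0 θ)
  rw [h]
  refine mul_pos hκ ?_
  simp only [polarPt] at hs ⊢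
  refine pos_of_mul_pos_right (a := r) ?_ h0.le
  linarith

include hG hdG hS in
theorem radial_strictMonoOn {R : ℝ} (hR : R < ρ) (θ : ℝ) :
    StrictMonoOn (fun s => G (polarPt c s θ)) (Icc 0 R) := by
  refine strictMonoOn_of_deriv_pos (convex_Icc 0 R)
    (fun s hs => (hasDerivAt_radial hG hs.1 (hs.2.trans_lt hR)).continuousAt.continuousWithinAt)
    fun s hs => ?_
  rw [interior_Icc] at hs
  rw [(hasDerivAt_radial hG hs.1.le (hs.2.trans hR)).deriv]
  exact radial_pos hdG hS hs.1 (hs.2.trans hR)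

include hG hdG hS in
/-- The level curves around `c` in polar coordinates. -/
theorem exists_level_curve {R ℓ : ℝ} (hR0 : 0 < R) (hR : R < ρ) (hc : G c < ℓ)
    (hℓ : ∀ θ, ℓ < G (polarPt c R θ)) :
    ∃ r : ℝ → ℝ, (∀ θ, 0 < r θ ∧ r θ < R ∧ G (polarPt c (r θ) θ) = ℓ) ∧ Differentiable ℝ r ∧
      Function.Periodic r (2 * Real.pi) ∧
      ∀ θ s, 0 < s → s < R → G (polarPt c s θ) = ℓ → s = r θ := by
  have hex : ∀ θ, ∃ s, 0 < s ∧ s < R ∧ G (polarPt c s θ) = ℓ := by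
    intro θ
    have hcont : ContinuousOn (fun s => G (polarPt c s θ)) (Icc 0 R) := fun s hs =>
      (hasDerivAt_radial hG hs.1 (hs.2.trans_lt hR)).continuousAt.continuousWithinAt
    obtain ⟨s, hs, h⟩ := intermediate_value_Ioo hR0.le hcont
      (show ℓ ∈ Ioo _ _ from ⟨by simpa [polarPt] using hc, hℓ θ⟩)
    exact ⟨s, hs.1, hs.2, h⟩
  choose r h1 h2 h3 using hex
  have huniq : ∀ θ s, 0 < s → s < R → G (polarPt c s θ) = ℓ → s = r θ := fun θ s hs hs' h =>
    (radial_strictMonoOn hG hdG hS hR θ).injOn ⟨hs.le, hs'.le⟩ ⟨(h1 θ).le, (h2 θ).le⟩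
      (h.trans (h3 θ).symm)
  refine ⟨r, fun θ => ⟨h1 θ, h2 θ, h3 θ⟩, fun θ₁ => ?_, fun θ => ?_, huniq⟩
  · set D := fderiv ℝ G (polarPt c (r θ₁) θ₁) (Real.cos θ₁, -Real.sin θ₁) with hD
    have hD0 : 0 < D := radial_pos hdG hS (h1 θ₁) ((h2 θ₁).trans hR)
    -- The factor D⁻¹ normalises the radial derivative to 1, as the implicit function theorem
    -- requires.
    let Φ : ℝ × ℝ → ℝ := fun w => D⁻¹ * (G (polarPt c w.2 w.1) - ℓ)
    have hpt : AnalyticAt ℝ (fun w : ℝ × ℝ => polarPt c w.2 w.1) (θ₁, r θ₁) := by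
      have hcos : AnalyticAt ℝ (fun w : ℝ × ℝ => Real.cos w.1) (θ₁, r θ₁) :=
        Real.analyticAt_cos.fun_comp analyticAt_fst
      have hsin : AnalyticAt ℝ (fun w : ℝ × ℝ => Real.sin w.1) (θ₁, r θ₁) :=
        Real.analyticAt_sin.fun_comp analyticAt_fst
      exact (analyticAt_const.add (analyticAt_snd.mul hcos)).prod
        (analyticAt_const.sub (analyticAt_snd.mul hsin))
    have hΦ : AnalyticAt ℝ Φ (θ₁, r θ₁) := by
      refine analyticAt_const.mul (AnalyticAt.sub ?_ analyticAt_const)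
      exact (hG _ (polarPt_mem_ball θ₁ (h1 θ₁).le ((h2 θ₁).trans hR))).comp_of_eq hpt rfl
    have hdΦ : ∀ v, fderiv ℝ Φ (θ₁, r θ₁) (0, v) = v := by
      intro v
      have e1 : HasDerivAt (fun s : ℝ => ((θ₁, r θ₁ + s * v) : ℝ × ℝ)) (0, v) 0 := by
        refine ((hasDerivAt_const _ _).prodMk
          (((hasDerivAt_id (0 : ℝ)).mul_const v).const_add _)).congr_deriv ?_
        simp
      have e2 : HasDerivAt (fun s => Φ (θ₁, r θ₁ + s * v)) (fderiv ℝ Φ (θ₁, r θ₁) (0, v)) 0 := by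
        have := hΦ.differentiableAt.hasFDerivAt
        exact HasFDerivAt.comp_hasDerivAt (f := fun s : ℝ => ((θ₁, r θ₁ + s * v) : ℝ × ℝ)) 0
          (by simpa using this) e1
      have e3 : HasDerivAt (fun s => Φ (θ₁, r θ₁ + s * v)) v 0 := by
        have h := hasDerivAt_radial hG (θ := θ₁) (h1 θ₁).le ((h2 θ₁).trans hR)
        have h' : HasDerivAt (fun s : ℝ => r θ₁ + s * v) v 0 := by
          simpa using ((hasDerivAt_id (0 : ℝ)).mul_const v).const_add (r θ₁)
        have h'' := HasDerivAt.comp (h := fun s : ℝ => r θ₁ + s * v) 0 (by simpa using h) h'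
        refine ((h''.sub_const ℓ).const_mul D⁻¹).congr_deriv ?_
        rw [← hD, ← mul_assoc, inv_mul_cancel₀ hD0.ne', one_mul]
      exact e2.unique e3
    obtain ⟨ψ, hψa, hψ0, -, hψ⟩ := exists_analytic_implicit hΦ (by simp [Φ, h3]) hdΦ
    have hev : r =ᶠ[𝓝 θ₁] ψ := by
      have hp : ∀ᶠ θ in 𝓝 θ₁, 0 < ψ θ := hψa.continuousAt.eventually_const_lt (by
        rw [hψ0]; exact h1 θ₁)
      have hp' : ∀ᶠ θ in 𝓝 θ₁, ψ θ < R := hψa.continuousAt.eventually_lt_const (by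
        rw [hψ0]; exact h2 θ₁)
      filter_upwards [hψ, hp, hp'] with θ a1 a2 a3
      refine (huniq θ _ a2 a3 ?_).symm
      have := (mul_eq_zero.1 a1).resolve_left (inv_ne_zero hD0.ne')
      linarith [this]
    exact hψa.differentiableAt.congr_of_eventuallyEq hev
  · refine huniq θ _ (h1 _) (h2 _) ?_
    have := h3 (θ + 2 * Real.pi)
    simpa [polarPt] using this

-- G increases along every ray from c, so each nearby level is a closed curve r = r(θ). The field is
-- tangent to it and turns with positive angular velocity, so a change of time makes it a periodic
-- orbit whose period is the duration of one turn.
include hG hdG hS in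
theorem isCenter_of_integral (hρ : 0 < ρ) (hXc : X c = 0)
    (hX : ContinuousOn X (Metric.ball c ρ)) : IsCenter X c := by
  refine ⟨hXc, fun V hV => ?_⟩
  obtain ⟨δ, hδ, hball⟩ := Metric.mem_nhds_iff.1 hV
  obtain ⟨R, hR0, hR⟩ := exists_between (lt_min hρ hδ)
  have hRρ := hR.trans_le (min_le_left _ _)
  have hRδ := hR.trans_le (min_le_right _ _)
  have hpol : ∀ r : ℝ, 0 ≤ r → r < ρ → Continuous fun θ => G (polarPt c r θ) := fun r h0 h =>
    continuous_iff_continuousAt.2 fun θ =>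
      (hG _ (polarPt_mem_ball θ h0 h)).continuousAt.comp (f := fun θ => polarPt c r θ)
        (by unfold polarPt; fun_prop)
  have hper : Function.Periodic (fun θ => -G (polarPt c R θ)) (2 * Real.pi) := fun θ => by
    simp [polarPt]
  -- The minimum of G on the circle of radius R: level curves with lower values stay inside this
  -- circle.
  obtain ⟨s, hs⟩ := exists_forall_le_of_periodic (hpol R hR0.le hRρ).neg hper
  have hc0 : ∀ {r : ℝ} (θ : ℝ), 0 < r → r ≤ R → G c < G (polarPt c r θ) := fun {r} θ h0 hr => by
    have := radial_strictMonoOn hG hdG hS hRρ θ (left_mem_Icc.2 hR0.le) ⟨h0.le, hr⟩ h0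
    simpa [polarPt] using this
  let D : ℝ × ℝ → ℝ := fun z => (z.1 - c.1) ^ 2 + (z.2 - c.2) ^ 2
  have hU1 : ∀ᶠ z in 𝓝 c, D z < R ^ 2 :=
    (by unfold D; fun_prop : ContinuousAt D c).eventually_lt_const (by simp [D]; positivity)
  have hU2 : ∀ᶠ z in 𝓝 c, G z < G (polarPt c R s) :=
    (hG c (Metric.mem_ball_self hρ)).continuousAt.eventually_lt_const (hc0 s hR0 le_rfl)
  refine ⟨_, hU1.and hU2, fun z hz hzc => ?_⟩
  obtain ⟨hz1, hz2⟩ := hz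
  obtain ⟨θ₀, hθ₀⟩ := exists_polarPt c z
  set r₀ := √((z.1 - c.1) ^ 2 + (z.2 - c.2) ^ 2) with hr₀
  have hr₀R : r₀ < R := (Real.sqrt_lt' hR0).2 hz1
  have hr₀0 : 0 < r₀ := (Real.sqrt_nonneg _).lt_of_ne fun h => hzc (by
    rw [← hr₀] at h; rw [hθ₀, ← h]; simp [polarPt])
  have hzρ : z ∈ Metric.ball c ρ := by
    rw [hθ₀]; exact polarPt_mem_ball _ hr₀0.le (hr₀R.trans hRρ)
  obtain ⟨r, hr, hrd, hrp, huniq⟩ := exists_level_curve hG hdG hS hR0 hRρ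
    (ℓ := G z) (by rw [hθ₀]; exact hc0 θ₀ hr₀0 hr₀R.le) fun θ => hz2.trans_le (neg_le_neg_iff.1 (hs θ))
  have hr₁ : r θ₀ = r₀ := (huniq θ₀ r₀ hr₀0 hr₀R (by rw [← hθ₀])).symm
  let Γ : ℝ → ℝ × ℝ := fun θ => polarPt c (r θ) θ
  have hΓb : ∀ θ, Γ θ ∈ Metric.ball c ρ := fun θ =>
    polarPt_mem_ball θ (hr θ).1.le ((hr θ).2.1.trans hRρ)
  have hΓd : ∀ θ, HasDerivAt Γ (deriv r θ * Real.cos θ - r θ * Real.sin θ,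
      -(deriv r θ * Real.sin θ + r θ * Real.cos θ)) θ := fun θ => by
    have h := (hrd θ).hasDerivAt
    refine (((h.fun_mul (Real.hasDerivAt_cos θ)).const_add _).prodMk
      ((h.fun_mul (Real.hasDerivAt_sin θ)).const_sub _)).congr_deriv ?_
    ext
    · simp; ring
    · simp
  have hΓc : Continuous Γ := continuous_iff_continuousAt.2 fun θ => (hΓd θ).continuousAt
  have hXΓ : Continuous fun θ => X (Γ θ) := hX.comp_continuous hΓc hΓb
  have hΓper : Function.Periodic Γ (2 * Real.pi) := fun θ => by
    simp only [Γ]; rw [hrp θ]; simp [polarPt]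
  let w : ℝ → ℝ := fun θ => (((Γ θ).2 - c.2) * (X (Γ θ)).1 - ((Γ θ).1 - c.1) * (X (Γ θ)).2)
    / r θ ^ 2
  have hwc : Continuous w := by
    have := hrd.continuous
    have h1 := continuous_fst.comp hΓc
    have h2 := continuous_snd.comp hΓc
    have h3 := continuous_fst.comp hXΓ
    have h4 := continuous_snd.comp hXΓ
    simp only [Function.comp_def] at h1 h2 h3 h4
    exact Continuous.div (by fun_prop) (by fun_prop) fun θ => pow_ne_zero 2 (hr θ).1.ne'
  have hwpos : ∀ θ, 0 < w θ := fun θ =>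
    div_pos (hS _ (hΓb θ) (polarPt_ne (hr θ).1 θ)) (pow_pos (hr θ).1 2)
  have hwper : Function.Periodic w (2 * Real.pi) := fun θ => by
    simp only [w]; rw [hΓper θ, hrp θ]
  obtain ⟨s', hs'⟩ := exists_forall_le_of_periodic hwc hwper
  obtain ⟨e, hed, hes⟩ := exists_time_change hwc hwpos hs'
  -- Differentiating G(Γ) = const shows that the velocity of Γ is parallel to the field; comparison
  -- of the angular components identifies the factor as `w`.
  have hΓX : ∀ θ, w θ • (deriv r θ * Real.cos θ - r θ * Real.sin θ,
      -(deriv r θ * Real.sin θ + r θ * Real.cos θ)) = X (Γ θ) := by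
    intro θ
    obtain ⟨κ, hκ, hd⟩ := hdG _ (hΓb θ)
    have h1 : HasDerivAt (fun θ => G (Γ θ)) _ θ :=
      ((hG _ (hΓb θ)).differentiableAt.hasFDerivAt).comp_hasDerivAt θ (hΓd θ)
    have h2 : (fun θ => G (Γ θ)) = fun _ => G z := funext fun θ => (hr θ).2.2
    rw [h2, hd] at h1
    have h3 := (mul_eq_zero.1 (h1.unique (hasDerivAt_const θ _))).resolve_left hκ.ne'
    have hr2 : r θ ^ 2 ≠ 0 := pow_ne_zero 2 (hr θ).1.ne'
    have h4 := Real.sin_sq_add_cos_sq θ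
    simp only at h3
    simp only [w]
    generalize X (Γ θ) = A at h3 ⊢
    ext
    · simp only [Prod.smul_fst, smul_eq_mul, Γ]
      rw [div_mul_eq_mul_div, div_eq_iff hr2]
      simp only [polarPt]
      linear_combination (r θ ^ 2 * A.1) * h4
        + r θ * Real.cos θ * h3
    · simp only [Prod.smul_snd, smul_eq_mul, Γ]
      rw [div_mul_eq_mul_div, div_eq_iff hr2]
      simp only [polarPt]
      linear_combination (r θ ^ 2 * A.2) * h4
        - r θ * Real.sin θ * h3
  refine ⟨fun h => ?_, fun t => Γ (e (t + e.symm θ₀)), e.symm (2 * Real.pi), ?_, ?_, fun t => ?_,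
    fun t => ?_, fun t => ?_⟩
  · have := hS z hzρ hzc
    rw [h] at this
    simp at this
  · have h0 : e.symm 0 = 0 := by rw [hes, intervalIntegral.integral_same]
    rw [← h0]
    exact e.symm.strictMono Real.two_pi_pos
  · simp only [zero_add, OrderIso.apply_symm_apply, Γ]
    rw [hr₁, ← hθ₀]
  · rw [← hΓX]
    have h1 : HasDerivAt (fun t => e (t + e.symm θ₀)) (w (e (t + e.symm θ₀))) t :=
      (hed _).comp_add_const t _
    exact (hΓd _).scomp t h1
  -- By periodicity of `w`, one turn takes the same time from every starting angle.
  · have hsh : ∀ s, e.symm (s + 2 * Real.pi) = e.symm s + e.symm (2 * Real.pi) := by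
      intro s
      have hi : Continuous fun r => (w r)⁻¹ := hwc.inv₀ fun s => (hwpos s).ne'
      have hip : Function.Periodic (fun r => (w r)⁻¹) (2 * Real.pi) := fun θ => by
        simp only [hwper θ]
      have := hip.intervalIntegral_add_eq s 0
      rw [hes, hes, hes, ← intervalIntegral.integral_add_adjacent_intervals
        (hi.intervalIntegrable 0 s) (hi.intervalIntegrable s _), this, zero_add]
    have h2 : e (t + e.symm (2 * Real.pi) + e.symm θ₀) = e (t + e.symm θ₀) + 2 * Real.pi := by
      apply e.symm.injective
      rw [hsh, e.symm_apply_apply, e.symm_apply_apply]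
      ring
    simp only [h2]
    exact hΓper _
  · exact hball (polarPt_mem_ball _ (hr _).1.le ((hr _).2.1.trans hRδ))

end Center

/-! ### Equilibria and integrals on a fixed neighbourhood of (1, 0) -/

open scoped ContDiff

theorem fderiv_snd_eq {Y E F : Type*} [NormedAddCommGroup Y] [NormedSpace ℝ Y]
    [NormedAddCommGroup E] [NormedSpace ℝ E] [NormedAddCommGroup F] [NormedSpace ℝ F]
    {Φ : Y × E → F} {x₀ : Y} {u₀ v : E} {w : F} (hΦ : DifferentiableAt ℝ Φ (x₀, u₀))
    (h : HasDerivAt (fun s : ℝ => Φ (x₀, u₀ + s • v)) w 0) :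
    fderiv ℝ Φ (x₀, u₀) (0, v) = w := by
  have e1 : HasDerivAt (fun s : ℝ => ((x₀, u₀ + s • v) : Y × E)) (0, v) 0 := by
    refine ((hasDerivAt_const _ _).prodMk
      (((hasDerivAt_id (0 : ℝ)).smul_const v).const_add _)).congr_deriv ?_
    simp
  exact (HasFDerivAt.comp_hasDerivAt (f := fun s : ℝ => ((x₀, u₀ + s • v) : Y × E)) 0
    (by simpa using hΦ.hasFDerivAt) e1).unique h

namespace CubicPerturbation

variable (p : CubicPerturbation)

/-- The perturbed system has an equilibrium near `(1, 0)`. -/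
theorem exists_equilibrium : ∃ c : ℝ → ℝ × ℝ, ContinuousAt c 0 ∧ c 0 = (1, 0) ∧
    ∀ᶠ ε in 𝓝 (0 : ℝ), p.field ε (c ε) = 0 := by
  -- The linear part of the unperturbed field at (1, 0) is (v₂, −2v₁); swapping and rescaling the
  -- components makes it the identity.
  let Φ : ℝ × (ℝ × ℝ) → ℝ × ℝ := fun w =>
    (-(p.field w.1 w.2).2 / 2, (p.field w.1 w.2).1)
  have hΦ : AnalyticAt ℝ Φ (0, (1, 0)) := by
    have h : ContDiff ℝ ω Φ := by
      unfold Φ field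
      simp only [f_eq, g_eq]
      fun_prop
    exact h.contDiffAt.analyticAt
  obtain ⟨c, hc, h0, -, hev⟩ := exists_analytic_implicit hΦ (by simp [Φ, field]) fun v => by
    refine fderiv_snd_eq hΦ.differentiableAt ?_
    simp only [Φ, field, zero_mul, add_zero, Prod.fst_add, Prod.snd_add, Prod.smul_fst,
      Prod.smul_snd, smul_eq_mul, zero_add]
    have h1 : HasDerivAt (fun s : ℝ => 1 + s * v.1) v.1 0 := by
      simpa using ((hasDerivAt_id (0 : ℝ)).mul_const v.1).const_add 1
    have h2 : HasDerivAt (fun s : ℝ => s * v.2) v.2 0 := by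
      simpa using (hasDerivAt_id (0 : ℝ)).mul_const v.2
    refine (((h1.fun_sub (h1.fun_pow 3)).fun_neg.div_const 2).prodMk h2).congr_deriv ?_
    ext
    · simp; ring
    · simp
  refine ⟨c, hc.continuousAt, h0, hev.mono fun ε h => ?_⟩
  have h1 := congrArg Prod.fst h
  have h2 := congrArg Prod.snd h
  ext
  · exact h2
  · simp only [Φ, Prod.fst_zero] at h1
    simp only [Prod.snd_zero]
    linarith

theorem contDiff_fg : ContDiff ℝ 1 fun z : ℝ × ℝ => (p.f z.1 z.2, p.g z.1 z.2) := by
  simp only [f_eq, g_eq]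
  fun_prop

/-- Near `(1, 0)` the perturbed system turns around its equilibrium. -/
theorem exists_angular_pos : ∃ ρ > 0, ∀ᶠ ε in 𝓝 (0 : ℝ), ∀ c ∈ Metric.ball ((1, 0) : ℝ × ℝ) ρ,
    ∀ z ∈ Metric.ball ((1, 0) : ℝ × ℝ) ρ, p.field ε c = 0 → z ≠ c →
      0 < (z.2 - c.2) * (p.field ε z).1 - (z.1 - c.1) * (p.field ε z).2 := by
  obtain ⟨K, t, ht, hK⟩ := (p.contDiff_fg.contDiffAt (x := (1, 0))).exists_lipschitzOnWith
  obtain ⟨δ, hδ, hball⟩ := Metric.mem_nhds_iff.1 ht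
  have hε : ∀ᶠ ε in 𝓝 (0 : ℝ), |ε| * (2 * (K : ℝ)) < 1 / 2 :=
    (by fun_prop : ContinuousAt (fun ε : ℝ => |ε| * (2 * (K : ℝ))) 0).eventually_lt_const
      (by norm_num)
  -- Within 1/4 of 1 the factor z₁² + z₁c₁ + c₁² − 1 exceeds 11/16 > 1/2 + 1/8, whereas the
  -- perturbation contributes at most d²/2, and d² is at most the squared Euclidean distance.
  refine ⟨min δ (1 / 4), by positivity, hε.mono fun ε hε c hc z hz h0 hzc => ?_⟩
  have hc' := Metric.ball_subset_ball (min_le_right _ _) hc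
  have hz' := Metric.ball_subset_ball (min_le_right _ _) hz
  have hL := hK.dist_le_mul z (hball (Metric.ball_subset_ball (min_le_left _ _) hz)) c
    (hball (Metric.ball_subset_ball (min_le_left _ _) hc))
  rw [Metric.mem_ball, Prod.dist_eq, max_lt_iff, Real.dist_eq, Real.dist_eq] at hc' hz'
  obtain ⟨⟨c1, c2⟩, -⟩ := And.imp_left abs_lt.1 hc'
  obtain ⟨⟨z1, z2⟩, -⟩ := And.imp_left abs_lt.1 hz'
  rw [Prod.dist_eq, max_le_iff, Real.dist_eq, Real.dist_eq] at hL
  obtain ⟨hf, hg⟩ := hL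
  set d := dist z c with hd
  have hdx : |z.1 - c.1| ≤ d := by rw [hd, Prod.dist_eq, ← Real.dist_eq]; exact le_max_left _ _
  have hdy : |z.2 - c.2| ≤ d := by rw [hd, Prod.dist_eq, ← Real.dist_eq]; exact le_max_right _ _
  have hd0 : 0 < d := dist_pos.2 hzc
  have hd2 : d ^ 2 ≤ (z.1 - c.1) ^ 2 + (z.2 - c.2) ^ 2 := by
    rcases le_total |z.1 - c.1| |z.2 - c.2| with h | h
    · rw [hd, Prod.dist_eq, Real.dist_eq, Real.dist_eq, max_eq_right h, sq_abs]
      nlinarith [sq_nonneg (z.1 - c.1)]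
    · rw [hd, Prod.dist_eq, Real.dist_eq, Real.dist_eq, max_eq_left h, sq_abs]
      nlinarith [sq_nonneg (z.2 - c.2)]
  have e1 := congrArg Prod.fst h0
  have e2 := congrArg Prod.snd h0
  simp only [field, Prod.fst_zero, Prod.snd_zero] at e1 e2 ⊢
  simp only at hf hg c1 c2 z1 z2
  have hE : |(z.2 - c.2) * (p.f z.1 z.2 - p.f c.1 c.2) - (z.1 - c.1) * (p.g z.1 z.2 - p.g c.1 c.2)|
      ≤ 2 * K * d ^ 2 := by
    refine (abs_sub _ _).trans ?_
    rw [abs_mul, abs_mul]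
    have := mul_le_mul hdy hf (abs_nonneg _) hd0.le
    have := mul_le_mul hdx hg (abs_nonneg _) hd0.le
    linarith
  have hE' : |ε * ((z.2 - c.2) * (p.f z.1 z.2 - p.f c.1 c.2)
      - (z.1 - c.1) * (p.g z.1 z.2 - p.g c.1 c.2))| ≤ 1 / 2 * d ^ 2 := by
    rw [abs_mul]
    calc _ ≤ |ε| * (2 * K * d ^ 2) := mul_le_mul_of_nonneg_left hE (abs_nonneg _)
      _ = |ε| * (2 * K) * d ^ 2 := by ring
      _ ≤ _ := mul_le_mul_of_nonneg_right hε.le (sq_nonneg d)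
  have hpos : 0 < (z.1 - c.1) ^ 2 * (z.1 ^ 2 + z.1 * c.1 + c.1 ^ 2 - 1) + (z.2 - c.2) ^ 2
      + ε * ((z.2 - c.2) * (p.f z.1 z.2 - p.f c.1 c.2)
        - (z.1 - c.1) * (p.g z.1 z.2 - p.g c.1 c.2)) := by
    have h3 := (abs_le.1 hE').1
    have hx0 : 1 / 2 * (z.1 - c.1) ^ 2 + 1 / 8 * (z.1 - c.1) ^ 2
      ≤ (z.1 - c.1) ^ 2 * (z.1 ^ 2 + z.1 * c.1 + c.1 ^ 2 - 1) := by
      nlinarith [mul_nonneg (sq_nonneg (z.1 - c.1)) (mul_nonneg (show 0 ≤ z.1 - 3 / 4 by linarith)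
        (show 0 ≤ c.1 - 3 / 4 by linarith)), mul_nonneg (sq_nonneg (z.1 - c.1))
        (show 0 ≤ z.1 - 3 / 4 by linarith), mul_nonneg (sq_nonneg (z.1 - c.1))
        (show 0 ≤ c.1 - 3 / 4 by linarith), mul_nonneg (sq_nonneg (z.1 - c.1)) (sq_nonneg
        (z.1 - 3 / 4)), mul_nonneg (sq_nonneg (z.1 - c.1)) (sq_nonneg (c.1 - 3 / 4))]
    nlinarith [sq_nonneg (z.2 - c.2), sq_nonneg (z.1 - c.1), pow_pos hd0 2]
  refine hpos.trans_le (le_of_eq ?_)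
  linear_combination (-(z.2 - c.2)) * e1 + (z.1 - c.1) * e2

/-- The third difference of ẏ in x is −6(1 − εb₃₀) times the cube of the step, so ẏ cannot vanish at
four equally spaced points of a horizontal segment. -/
theorem exists_field_ne_zero {ε : ℝ} (hε : ε * p.b 3 0 ≠ 1) {W : Set (ℝ × ℝ)} (hW : IsOpen W)
    (hne : W.Nonempty) : ∃ z ∈ W, p.field ε z ≠ 0 := by
  by_contra hcon
  push Not at hcon
  obtain ⟨z, hz⟩ := hne
  obtain ⟨δ, hδ, hball⟩ := Metric.isOpen_iff.1 hW z hz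
  have h : ∀ k : ℝ, 0 ≤ k → k < 4 → (p.field ε (z.1 + k * (δ / 4), z.2)).2 = 0 := fun k h0 hk => by
    refine congrArg Prod.snd (hcon _ (hball ?_))
    rw [Metric.mem_ball, Prod.dist_eq, max_lt_iff, Real.dist_eq, Real.dist_eq]
    simp only [add_sub_cancel_left, sub_self, abs_zero]
    exact ⟨by rw [abs_of_nonneg (by positivity)]; nlinarith, hδ⟩
  have h0 := h 0 le_rfl (by norm_num)
  have h1 := h 1 (by norm_num) (by norm_num)
  have h2 := h 2 (by norm_num) (by norm_num)
  have h3 := h 3 (by norm_num) (by norm_num)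
  simp only [field, g_eq] at h0 h1 h2 h3
  have : (1 - ε * p.b 3 0) * δ ^ 3 = 0 := by
    linear_combination (-32 / 3) * (h3 - 3 * h2 + 3 * h1 - h0)
  rcases mul_eq_zero.1 this with h | h
  · exact hε (by linarith)
  · exact (pow_pos hδ 3).ne' h

theorem eventually_mul_ne_one (b : ℝ) : ∀ᶠ ε in 𝓝 (0 : ℝ), ε * b ≠ 1 :=
  (by fun_prop : ContinuousAt (fun ε : ℝ => ε * b) 0).eventually_ne (by simp)

end CubicPerturbation

/-- As κ > 0, dG vanishes only at equilibria, and these do not fill an open set; hence G is not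
locally constant. -/
theorem isAnalyticFirstIntegral_of_fderiv {p : CubicPerturbation} {ε : ℝ} (hε : ε * p.b 3 0 ≠ 1)
    {K : Set (ℝ × ℝ)} {G : ℝ × ℝ → ℝ} (hG : ∀ z ∈ K, AnalyticAt ℝ G z)
    (hdG : ∀ z ∈ K, ∃ κ > 0, ∀ v : ℝ × ℝ,
      fderiv ℝ G z v = κ * ((p.field ε z).1 * v.2 - (p.field ε z).2 * v.1)) :
    IsAnalyticFirstIntegral (p.field ε) K G := by
  refine ⟨hG, fun z hz => ?_, fun W hW hne hWK => ?_⟩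
  · obtain ⟨κ, -, h⟩ := hdG z hz
    rw [h]; ring
  · by_contra hcon
    push Not at hcon
    obtain ⟨z, hz, hX⟩ := p.exists_field_ne_zero hε hW hne
    obtain ⟨κ, hκ, h⟩ := hdG z (hWK hz)
    have hconst : G =ᶠ[𝓝 z] fun _ => G z := by
      filter_upwards [hW.mem_nhds hz] with w hw using (hcon z hz w hw).symm
    have hv := h (-(p.field ε z).2, (p.field ε z).1)
    rw [hconst.fderiv_eq, fderiv_fun_const] at hv
    simp only [Pi.zero_apply, zero_apply] at hv
    have h0 := (mul_eq_zero.1 hv.symm).resolve_left hκ.ne'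
    apply hX
    ext
    · have : (p.field ε z).1 ^ 2 = 0 := by
        nlinarith [sq_nonneg (p.field ε z).1, sq_nonneg (p.field ε z).2]
      simpa using this
    · have : (p.field ε z).2 ^ 2 = 0 := by
        nlinarith [sq_nonneg (p.field ε z).1, sq_nonneg (p.field ε z).2]
      simpa using this

/-- The perturbed system is orbitally Hamiltonian in a fixed neighbourhood of `(1, 0)`. -/
def HasLocalIntegral (p : CubicPerturbation) : Prop :=
  ∃ ρ > 0, ∀ᶠ ε in 𝓝 (0 : ℝ), ∃ G : ℝ × ℝ → ℝ, ∀ z ∈ Metric.ball ((1, 0) : ℝ × ℝ) ρ,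
    AnalyticAt ℝ G z ∧ ∃ κ > 0, ∀ v : ℝ × ℝ,
      fderiv ℝ G z v = κ * ((p.field ε z).1 * v.2 - (p.field ε z).2 * v.1)

theorem HasLocalIntegral.eventually_isCenter {p : CubicPerturbation} (H : HasLocalIntegral p) :
    ∃ ρ > 0, ∀ᶠ ε in 𝓝 (0 : ℝ), ∀ c ∈ Metric.ball ((1, 0) : ℝ × ℝ) ρ, p.field ε c = 0 →
      IsCenter (p.field ε) c := by
  obtain ⟨ρ₁, hρ₁, H⟩ := H
  obtain ⟨ρ₂, hρ₂, hS⟩ := p.exists_angular_pos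
  refine ⟨min ρ₁ ρ₂, lt_min hρ₁ hρ₂, ?_⟩
  filter_upwards [H, hS] with ε ⟨G, hG⟩ hS c hc h0
  obtain ⟨r, hr, hsub⟩ := Metric.isOpen_iff.1 Metric.isOpen_ball c hc
  have hsub1 := hsub.trans (Metric.ball_subset_ball (min_le_left _ _))
  have hsub2 := hsub.trans (Metric.ball_subset_ball (min_le_right _ _))
  exact isCenter_of_integral (fun z hz => (hG z (hsub1 hz)).1) (fun z hz => (hG z (hsub1 hz)).2)
    (fun z hz hzc => hS c (hsub2 (Metric.mem_ball_self hr)) z (hsub2 hz) h0 hzc) hr h0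
    (p.contDiff_field ε 1).continuous.continuousOn

theorem HasLocalIntegral.isIntegrableNear {p : CubicPerturbation} (H : HasLocalIntegral p) :
    IsIntegrableNear p (1, 0) := by
  intro V hV
  obtain ⟨δ, hδ, hball⟩ := Metric.mem_nhds_iff.1 hV
  obtain ⟨ρ₂, hρ₂, hc⟩ := H.eventually_isCenter
  obtain ⟨ρ₁, hρ₁, H⟩ := H
  obtain ⟨c, hcc, hc0, hceq⟩ := p.exists_equilibrium
  have hρ : 0 < min δ (min ρ₁ ρ₂) := lt_min hδ (lt_min hρ₁ hρ₂)
  refine ⟨Metric.ball (1, 0) (min δ (min ρ₁ ρ₂)), Metric.ball_mem_nhds _ hρ,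
    (Metric.ball_subset_ball (min_le_left _ _)).trans hball, ?_⟩
  have hmem : ∀ᶠ ε in 𝓝 (0 : ℝ), c ε ∈ Metric.ball ((1, 0) : ℝ × ℝ) (min δ (min ρ₁ ρ₂)) :=
    hcc (Metric.isOpen_ball.mem_nhds (by rw [hc0]; exact Metric.mem_ball_self hρ))
  filter_upwards [H, hc, hceq, hmem, CubicPerturbation.eventually_mul_ne_one (p.b 3 0)]
    with ε ⟨G, hG⟩ hc h0 hm h3
  have hs1 : Metric.ball ((1, 0) : ℝ × ℝ) (min δ (min ρ₁ ρ₂)) ⊆ Metric.ball (1, 0) ρ₁ :=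
    Metric.ball_subset_ball ((min_le_right _ _).trans (min_le_left _ _))
  have hs2 : Metric.ball ((1, 0) : ℝ × ℝ) (min δ (min ρ₁ ρ₂)) ⊆ Metric.ball (1, 0) ρ₂ :=
    Metric.ball_subset_ball ((min_le_right _ _).trans (min_le_right _ _))
  exact ⟨⟨c ε, hm, hc _ (hs2 hm) h0⟩, G, isAnalyticFirstIntegral_of_fderiv h3
    (fun z hz => (hG z (hs1 hz)).1) fun z hz => (hG z (hs1 hz)).2⟩

theorem IsCenter.reflect {p : CubicPerturbation} {ε : ℝ} {c : ℝ × ℝ}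
    (H : IsCenter (p.field ε) c) : IsCenter (p.reflect.field ε) (-c) := by
  obtain ⟨h0, H⟩ := H
  refine ⟨by rw [p.reflect_field, neg_neg, h0, neg_zero], fun V hV => ?_⟩
  have hneg : ContinuousAt (fun z : ℝ × ℝ => -z) c := continuous_neg.continuousAt
  have hneg' : ContinuousAt (fun z : ℝ × ℝ => -z) (-c) := continuous_neg.continuousAt
  obtain ⟨U, hU, h⟩ := H _ (hneg hV)
  refine ⟨_, hneg' (by rwa [neg_neg] : U ∈ 𝓝 (- -c)), fun z hz hzc => ?_⟩
  obtain ⟨hX, γ, T, hT, hγ0, hγ, hper, hV'⟩ := h (-z) hz fun h => hzc (by rw [← h, neg_neg])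
  refine ⟨by rw [p.reflect_field, neg_ne_zero]; exact hX, fun t => -γ t, T, hT, ?_, fun t => ?_,
    fun t => ?_, hV'⟩
  · simp [hγ0]
  · rw [p.reflect_field, neg_neg]
    exact (hγ t).fun_neg
  · simp only [hper t]

theorem IsAnalyticFirstIntegral.reflect {p : CubicPerturbation} {ε : ℝ} {K : Set (ℝ × ℝ)}
    {F : ℝ × ℝ → ℝ} (H : IsAnalyticFirstIntegral (p.field ε) K F) :
    IsAnalyticFirstIntegral (p.reflect.field ε) (Neg.neg ⁻¹' K) fun z => F (-z) := by
  obtain ⟨h1, h2, h3⟩ := H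
  refine ⟨fun z hz => ?_, fun z hz => ?_, fun W hW hne hWK => ?_⟩
  · exact (h1 (-z) hz).comp_of_eq (f := fun z : ℝ × ℝ => -z) analyticAt_id.neg rfl
  · have hd : HasFDerivAt (fun z => F (-z)) ((fderiv ℝ F (-z)).comp (-ContinuousLinearMap.id ℝ _))
        z := ((h1 (-z) hz).differentiableAt.hasFDerivAt).comp z (hasFDerivAt_id z).neg
    rw [hd.fderiv, p.reflect_field]
    simpa using h2 (-z) hz
  · obtain ⟨z, hz, w, hw, h⟩ := h3 (Neg.neg ⁻¹' W) (hW.preimage continuous_neg)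
      (by obtain ⟨z, hz⟩ := hne; exact ⟨-z, by simpa using hz⟩)
      (fun z hz => by simpa using hWK hz)
    exact ⟨-z, hz, -w, hw, by simpa using h⟩

theorem IsIntegrableNear.reflect {p : CubicPerturbation} {c : ℝ × ℝ}
    (H : IsIntegrableNear p c) : IsIntegrableNear p.reflect (-c) := by
  intro V hV
  have hneg : ContinuousAt (fun z : ℝ × ℝ => -z) c := continuous_neg.continuousAt
  have hneg' : ContinuousAt (fun z : ℝ × ℝ => -z) (-c) := continuous_neg.continuousAt
  obtain ⟨U, hU, hUV, h⟩ := H _ (hneg hV)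
  refine ⟨Neg.neg ⁻¹' U, hneg' (by rwa [neg_neg] : U ∈ 𝓝 (- -c)),
    fun z hz => by simpa using hUV hz, h.mono ?_⟩
  rintro ε ⟨⟨e, he, hc⟩, F, hF⟩
  exact ⟨⟨-e, by simpa using he, hc.reflect⟩, _, hF.reflect⟩

/-! ### The Hamiltonian stratum -/

open scoped ContDiff in
theorem analyticAt_Ham_sub (p : CubicPerturbation) (ε : ℝ) (z : ℝ × ℝ) :
    AnalyticAt ℝ (fun z : ℝ × ℝ => Ham z.1 z.2 - ε * primQ p z.1 z.2) z := by
  have h : ContDiff ℝ ω fun z : ℝ × ℝ => Ham z.1 z.2 - ε * primQ p z.1 z.2 := by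
    unfold Ham primQ primF primB primL primE Ham
    fun_prop
  exact h.contDiffAt.analyticAt

theorem fderiv_eq_of_line {G : ℝ × ℝ → ℝ} {z v : ℝ × ℝ} {w : ℝ} (hG : DifferentiableAt ℝ G z)
    (h : HasDerivAt (fun s : ℝ => G (z.1 + s * v.1, z.2 + s * v.2)) w 0) :
    fderiv ℝ G z v = w := by
  have e1 : HasDerivAt (fun s : ℝ => ((z.1 + s * v.1, z.2 + s * v.2) : ℝ × ℝ)) v 0 := by
    have h1 := ((hasDerivAt_id (0 : ℝ)).mul_const v.1).const_add z.1
    have h2 := ((hasDerivAt_id (0 : ℝ)).mul_const v.2).const_add z.2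
    refine (h1.prodMk h2).congr_deriv ?_
    simp
  exact (HasFDerivAt.comp_hasDerivAt (f := fun s : ℝ => ((z.1 + s * v.1, z.2 + s * v.2) : ℝ × ℝ)) 0
    (by simpa using hG.hasFDerivAt) e1).unique h

theorem hasDerivAt_line (a b : ℝ) : HasDerivAt (fun s : ℝ => a + s * b) b 0 := by
  simpa using ((hasDerivAt_id (0 : ℝ)).mul_const b).const_add a

/-- If λ = μ = 0 then `primL` vanishes and ω is the differential of `primQ`; thus H − ε `primQ`
serves with κ = 1. -/
theorem hasLocalIntegral_of_hamiltonian {p : CubicPerturbation} (hp : M1Condition p)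
    (hl : p.lam = 0) (hmu : p.mu = 0) : HasLocalIntegral p := by
  refine ⟨1, one_pos, Eventually.of_forall fun ε => ⟨fun z => Ham z.1 z.2 - ε * primQ p z.1 z.2,
    fun z _ => ⟨analyticAt_Ham_sub p ε z, 1, one_pos, fun v => ?_⟩⟩⟩
  have hx := hasDerivAt_line z.1 v.1
  have hy := hasDerivAt_line z.2 v.2
  refine fderiv_eq_of_line (analyticAt_Ham_sub p ε z).differentiableAt ?_
  refine ((hasDerivAt_Ham hx hy).fun_sub
    ((isStep_primQ hp _ _ _ _ _ hx hy).const_mul ε)).congr_deriv ?_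
  simp only [primL, hl, hmu, CubicPerturbation.field, zero_mul, add_zero]
  ring

open MvPolynomial in
theorem isHamiltonian_of_conditions {p : CubicPerturbation} (hp : M1Condition p)
    (hl : p.lam = 0) (hmu : p.mu = 0) : IsHamiltonian p := by
  obtain ⟨h1, h2, h3, h4⟩ := hp
  rw [CubicPerturbation.lam] at hl
  rw [CubicPerturbation.mu] at hmu
  refine ⟨-(C (p.a 0 0) * X 1 + C (p.a 0 1 / 2) * X 1 ^ 2 + C (p.a 0 2 / 3) * X 1 ^ 3
    + C (p.a 0 3 / 4) * X 1 ^ 4 + C (p.a 1 0) * X 0 * X 1 + C (p.a 1 1 / 2) * X 0 * X 1 ^ 2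
    + C (p.a 1 2 / 3) * X 0 * X 1 ^ 3 + C (p.a 2 0) * X 0 ^ 2 * X 1
    + C (p.a 2 1 / 2) * X 0 ^ 2 * X 1 ^ 2 + C (p.a 3 0) * X 0 ^ 3 * X 1)
    + C (p.b 0 0) * X 0 + C (p.b 1 0 / 2) * X 0 ^ 2 + C (p.b 2 0 / 3) * X 0 ^ 3
    + C (p.b 3 0 / 4) * X 0 ^ 4, fun x y => ⟨?_, ?_⟩⟩
  · simp [p.f_eq, Derivation.leibniz, Derivation.leibniz_pow, pderiv_X]
    ring
  · simp [p.g_eq, Derivation.leibniz, Derivation.leibniz_pow, pderiv_X]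
    linear_combination y * h1 + 1 / 3 * y ^ 3 * h2 + x * y * h3 + x ^ 2 * y * h4 + y ^ 2 * hl
      + x * y ^ 2 * hmu

/-! ### The stratum reversible in y: transport of Y = y² along x -/

open scoped ContDiff

/-- The continuous functions on `[0, 1]`. -/
abbrev UnitFun : Type := C(Icc (0 : ℝ) 1, ℝ)

/-- The function `s ↦ 1 + τ (1 - s)` on `[0, 1]`. -/
def segK (τ : ℝ) : UnitFun := ⟨fun s => 1 + τ * (1 - s), by fun_prop⟩

theorem segK_eq (τ : ℝ) : segK τ = 1 + τ • segK 1 - τ • (1 : UnitFun) := by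
  ext s
  simp [segK]
  ring

/-- The right-hand side of the equation for `ẋ/y`, in terms of `x` and `Y = y²`. -/
def revD (p : CubicPerturbation) (ε x Y : ℝ) : ℝ :=
  1 + ε * (p.a 0 1 + p.a 1 1 * x + p.a 2 1 * x ^ 2 + p.a 0 3 * Y)

/-- The right-hand side of the equation for `ẏ`, in terms of `x` and `Y = y²`. -/
def revN (p : CubicPerturbation) (ε x Y : ℝ) : ℝ :=
  x - x ^ 3 + ε * (p.b 0 0 + p.b 1 0 * x + p.b 2 0 * x ^ 2 + p.b 3 0 * x ^ 3
    + (p.b 0 2 + p.b 1 2 * x) * Y)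

/-- `revD` along the segment from `1 + τ` to `1`. -/
def revDK (p : CubicPerturbation) (w : (ℝ × ℝ × ℝ) × UnitFun) : UnitFun :=
  1 + w.1.1 • (p.a 0 1 • (1 : UnitFun) + p.a 1 1 • segK w.1.2.1 + p.a 2 1 • segK w.1.2.1 ^ 2
    + p.a 0 3 • w.2)

/-- `revN` along the segment from `1 + τ` to `1`. -/
def revNK (p : CubicPerturbation) (w : (ℝ × ℝ × ℝ) × UnitFun) : UnitFun :=
  segK w.1.2.1 - segK w.1.2.1 ^ 3 + w.1.1 • (p.b 0 0 • (1 : UnitFun) + p.b 1 0 • segK w.1.2.1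
    + p.b 2 0 • segK w.1.2.1 ^ 2 + p.b 3 0 • segK w.1.2.1 ^ 3
    + (p.b 0 2 • (1 : UnitFun) + p.b 1 2 • segK w.1.2.1) * w.2)

theorem revDK_apply (p : CubicPerturbation) (ε τ Y : ℝ) (u : UnitFun) (s : Icc (0 : ℝ) 1) :
    revDK p ((ε, τ, Y), u) s = revD p ε (1 + τ * (1 - s)) (u s) := by
  simp [revDK, revD, segK]
  ring

theorem revNK_apply (p : CubicPerturbation) (ε τ Y : ℝ) (u : UnitFun) (s : Icc (0 : ℝ) 1) :
    revNK p ((ε, τ, Y), u) s = revN p ε (1 + τ * (1 - s)) (u s) := by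
  simp [revNK, revN, segK]
  ring

/-- The slope `dY/dx` along the segment from `1 + τ` to `1`. -/
def revRK (p : CubicPerturbation) (w : (ℝ × ℝ × ℝ) × UnitFun) : UnitFun :=
  (2 : ℝ) • (revNK p w * Ring.inverse (revDK p w))

theorem revRK_apply {p : CubicPerturbation} {ε τ Y : ℝ} {u : UnitFun}
    (h : ∀ s : Icc (0 : ℝ) 1, 0 < revD p ε (1 + τ * (1 - s)) (u s)) (s : Icc (0 : ℝ) 1) :
    revRK p ((ε, τ, Y), u) s
      = 2 * (revN p ε (1 + τ * (1 - s)) (u s) / revD p ε (1 + τ * (1 - s)) (u s)) := by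
  have hpos : ∀ s, 0 < revDK p ((ε, τ, Y), u) s := fun s => by rw [revDK_apply]; exact h s
  have h1 := Ring.inverse_mul_cancel _ (isUnit_of_pos hpos)
  have h2 : Ring.inverse (revDK p ((ε, τ, Y), u)) s * revDK p ((ε, τ, Y), u) s = 1 := by
    rw [← ContinuousMap.mul_apply, h1]; rfl
  have h3 := eq_inv_of_mul_eq_one_left h2
  rw [revDK_apply] at h3
  rw [revRK, ContinuousMap.smul_apply, ContinuousMap.mul_apply, h3, revNK_apply, smul_eq_mul,
    div_eq_mul_inv]

/-- The fixed point equation for the solution `Y` with the value `w.1.2.2` at `1 + τ`. -/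
def revPhi (p : CubicPerturbation) (w : (ℝ × ℝ × ℝ) × UnitFun) : UnitFun :=
  w.2 - w.1.2.2 • (1 : UnitFun) + w.1.2.1 • volterra 1 zero_le_one (revRK p w)

@[fun_prop]
theorem contDiff_segK {n : WithTop ℕ∞} : ContDiff ℝ n segK := by
  have : segK = fun τ => 1 + τ • segK 1 - τ • (1 : UnitFun) := funext segK_eq
  rw [this]
  fun_prop

theorem contDiff_revDK (p : CubicPerturbation) : ContDiff ℝ ω (revDK p) := by
  unfold revDK
  fun_prop

theorem contDiff_revNK (p : CubicPerturbation) : ContDiff ℝ ω (revNK p) := by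
  unfold revNK
  fun_prop

theorem analyticAt_revPhi (p : CubicPerturbation) : AnalyticAt ℝ (revPhi p) (0, 0) := by
  have h1 : revDK p (0, 0) = 1 := by simp [revDK]
  have h2 : ContDiffAt ℝ ω (fun w => Ring.inverse (revDK p w)) (0, 0) := by
    refine ContDiffAt.comp (g := Ring.inverse) _ ?_ (contDiff_revDK p).contDiffAt
    rw [h1]
    exact contDiffAt_ringInverse ℝ (1 : UnitFunˣ)
  have h3 := (contDiff_revNK p).contDiffAt (x := ((0, 0) : (ℝ × ℝ × ℝ) × UnitFun))
  have h4 : ContDiffAt ℝ ω (revPhi p) (0, 0) := by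
    unfold revPhi revRK
    fun_prop
  exact h4.analyticAt

/-- At τ = 0 the equation reads u = Y, so the derivative in u is the identity; the denominator is 1
at the base point ε = τ = Y = 0. -/
theorem exists_revPsi (p : CubicPerturbation) : ∃ ψ : ℝ × ℝ × ℝ → UnitFun, AnalyticAt ℝ ψ 0 ∧
    ψ 0 = 0 ∧ (∀ᶠ z in 𝓝 ((0, 0) : (ℝ × ℝ × ℝ) × UnitFun), revPhi p z = 0 ↔ ψ z.1 = z.2) ∧
    ∀ᶠ q in 𝓝 (0 : ℝ × ℝ × ℝ), revPhi p (q, ψ q) = 0 := by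
  refine exists_analytic_implicit (analyticAt_revPhi p) (by simp [revPhi]) fun v => ?_
  refine fderiv_snd_eq (analyticAt_revPhi p).differentiableAt ?_
  have : (fun s : ℝ => revPhi p ((0 : ℝ × ℝ × ℝ), (0 : UnitFun) + s • v)) = fun s => s • v := by
    funext s
    simp [revPhi]
  rw [this]
  simpa using (hasDerivAt_id (0 : ℝ)).smul_const v

/-- The point `r + (1 - r) s` of `[0, 1]`. -/
def tailPt (r s : Icc (0 : ℝ) 1) : Icc (0 : ℝ) 1 :=
  ⟨r + (1 - r) * s, by
      have h1 := r.2.1; have h2 := r.2.2; have h3 := s.2.1; have h4 := s.2.2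
      constructor
      · nlinarith
      · nlinarith⟩

/-- The tail of a function on `[0, 1]`, rescaled. -/
def tailK (u : UnitFun) (r : Icc (0 : ℝ) 1) : UnitFun :=
  ⟨fun s => u (tailPt r s), by unfold tailPt; fun_prop⟩

theorem norm_tailK_le (u : UnitFun) (r : Icc (0 : ℝ) 1) : ‖tailK u r‖ ≤ ‖u‖ :=
  (ContinuousMap.norm_le _ (norm_nonneg u)).2 fun _ => u.norm_coe_le_norm _

theorem revPhi_apply {p : CubicPerturbation} {ε τ Y : ℝ} {u : UnitFun}
    (h : ∀ s : Icc (0 : ℝ) 1, 0 < revD p ε (1 + τ * (1 - s)) (u s)) (s : Icc (0 : ℝ) 1) :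
    revPhi p ((ε, τ, Y), u) s = u s - Y + τ * ∫ σ in (0 : ℝ)..s,
      2 * (revN p ε (1 + τ * (1 - (projIcc 0 1 zero_le_one σ : ℝ))) (u (projIcc 0 1 zero_le_one σ))
        / revD p ε (1 + τ * (1 - (projIcc 0 1 zero_le_one σ : ℝ)))
          (u (projIcc 0 1 zero_le_one σ))) := by
  have h1 : revPhi p ((ε, τ, Y), u) s
      = u s - Y * 1 + τ * ∫ σ in (0 : ℝ)..s,
        revRK p ((ε, τ, Y), u) (projIcc 0 1 zero_le_one σ) := rfl
  have h2 : ∀ σ : ℝ, revRK p ((ε, τ, Y), u) (projIcc 0 1 zero_le_one σ)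
      = 2 * (revN p ε (1 + τ * (1 - (projIcc 0 1 zero_le_one σ : ℝ)))
          (u (projIcc 0 1 zero_le_one σ))
        / revD p ε (1 + τ * (1 - (projIcc 0 1 zero_le_one σ : ℝ)))
          (u (projIcc 0 1 zero_le_one σ))) := fun σ => revRK_apply h (projIcc 0 1 zero_le_one σ)
  rw [h1, mul_one]
  simp only [h2]

/-- The flow property: the rest of a solution, rescaled to [0, 1], solves the problem with starting
point 1 + τ(1 − r) and starting value u(r). With local uniqueness it makes the value at x = 1
constant along solutions. -/
theorem revPhi_tail {p : CubicPerturbation} {ε τ Y : ℝ} {u : UnitFun}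
    (h : ∀ s : Icc (0 : ℝ) 1, 0 < revD p ε (1 + τ * (1 - s)) (u s))
    (h0 : revPhi p ((ε, τ, Y), u) = 0) (r : Icc (0 : ℝ) 1) :
    revPhi p ((ε, τ * (1 - r), u r), tailK u r) = 0 := by
  have hpt : ∀ s : Icc (0 : ℝ) 1, 1 + τ * (1 - r) * (1 - (s : ℝ))
      = 1 + τ * (1 - ((r : ℝ) + (1 - r) * s)) := fun s => by ring
  have htail : ∀ s : Icc (0 : ℝ) 1,
      0 < revD p ε (1 + τ * (1 - r) * (1 - (s : ℝ))) (tailK u r s) := fun s => by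
    rw [hpt]; exact h (tailPt r s)
  let F : ℝ → ℝ := fun σ =>
    2 * (revN p ε (1 + τ * (1 - (projIcc 0 1 zero_le_one σ : ℝ))) (u (projIcc 0 1 zero_le_one σ))
      / revD p ε (1 + τ * (1 - (projIcc 0 1 zero_le_one σ : ℝ))) (u (projIcc 0 1 zero_le_one σ)))
  have hFc : Continuous F := by
    have : F = fun σ => revRK p ((ε, τ, Y), u) (projIcc 0 1 zero_le_one σ) :=
      funext fun σ => (revRK_apply h _).symm
    rw [this]
    fun_prop
  have hu : ∀ s : Icc (0 : ℝ) 1, u s = Y - τ * ∫ σ in (0 : ℝ)..s, F σ := fun s => by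
    have := congrArg (fun v : UnitFun => v s) h0
    simp only [revPhi_apply h, ContinuousMap.zero_apply] at this
    linarith
  ext s
  rw [revPhi_apply htail, ContinuousMap.zero_apply]
  have hs := s.2
  have hr := r.2
  have hint : ∫ σ in (0 : ℝ)..s,
      2 * (revN p ε (1 + τ * (1 - r) * (1 - (projIcc 0 1 zero_le_one σ : ℝ)))
          (tailK u r (projIcc 0 1 zero_le_one σ))
        / revD p ε (1 + τ * (1 - r) * (1 - (projIcc 0 1 zero_le_one σ : ℝ)))
          (tailK u r (projIcc 0 1 zero_le_one σ)))
      = ∫ σ in (0 : ℝ)..s, F (r + (1 - r) * σ) := by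
    refine intervalIntegral.integral_congr fun σ hσ => ?_
    rw [uIcc_of_le hs.1] at hσ
    have hσ1 : σ ∈ Icc (0 : ℝ) 1 := ⟨hσ.1, hσ.2.trans hs.2⟩
    have hσ2 : (r : ℝ) + (1 - r) * σ ∈ Icc (0 : ℝ) 1 := by
      have h1 := hr.1; have h2 := hr.2; have h3 := hσ1.1; have h4 := hσ1.2
      constructor
      · nlinarith
      · nlinarith
    have e2 : tailK u r ⟨σ, hσ1⟩ = u ⟨r + (1 - r) * σ, hσ2⟩ := rfl
    have e3 : 1 + τ * (1 - (r : ℝ)) * (1 - σ) = 1 + τ * (1 - ((r : ℝ) + (1 - r) * σ)) := by ring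
    simp only [F, projIcc_of_mem zero_le_one hσ1, projIcc_of_mem zero_le_one hσ2, e2, e3]
  have e1 : tailK u r s = u (tailPt r s) := rfl
  rw [hint, e1, hu, hu r]
  simp only [tailPt]
  have hsub : (1 - (r : ℝ)) * ∫ σ in (0 : ℝ)..s, F (r + (1 - r) * σ)
      = ∫ σ in (r : ℝ)..(r + (1 - r) * s), F σ := by
    rw [intervalIntegral.mul_integral_comp_add_mul]
    simp
  have hadd := intervalIntegral.integral_add_adjacent_intervals
    (hFc.intervalIntegrable (μ := MeasureTheory.volume) 0 r)
    (hFc.intervalIntegrable r (r + (1 - r) * s))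
  rw [mul_assoc, hsub, ← hadd]
  ring

theorem eventually_prod_norm {P : ℝ × ℝ × ℝ → UnitFun → Prop}
    (h : ∀ᶠ z in 𝓝 ((0, 0) : (ℝ × ℝ × ℝ) × UnitFun), P z.1 z.2) :
    ∃ δ > 0, ∀ q u, ‖q‖ < δ → ‖u‖ < δ → P q u := by
  obtain ⟨δ, hδ, H⟩ := Metric.eventually_nhds_iff.1 h
  refine ⟨δ, hδ, fun q u hq hu => @H (q, u) ?_⟩
  rw [Prod.dist_eq]
  simpa [dist_eq_norm] using ⟨hq, hu⟩

/-- The solution `Y` of the equation `dY/dx = 2 N / D` depends analytically on the initial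
values: there is an analytic function that maps `(ε, τ, Y)` to the value at `x = 1` of the solution
with the value `Y` at `x = 1 + τ`. -/
theorem exists_transport (p : CubicPerturbation) : ∃ χ : ℝ × ℝ × ℝ → ℝ, AnalyticAt ℝ χ 0 ∧
    (∀ᶠ q in 𝓝 (0 : ℝ × ℝ × ℝ), q.2.1 = 0 → χ q = q.2.2) ∧
    ∀ᶠ q in 𝓝 (0 : ℝ × ℝ × ℝ), 0 < revD p q.1 (1 + q.2.1) q.2.2 ∧
      q.2.1 * fderiv ℝ χ q (0, 1, 2 * (revN p q.1 (1 + q.2.1) q.2.2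
        / revD p q.1 (1 + q.2.1) q.2.2)) = 0 := by
  obtain ⟨ψ, hψ, hψ0, hU, hz⟩ := exists_revPsi p
  obtain ⟨δ, hδ, hU⟩ := eventually_prod_norm (P := fun q u => revPhi p (q, u) = 0 ↔ ψ q = u) hU
  let one : Icc (0 : ℝ) 1 := ⟨1, by simp⟩
  let zero : Icc (0 : ℝ) 1 := ⟨0, by simp⟩
  have hχ : AnalyticAt ℝ (fun q => ψ q one) 0 :=
    (ContinuousLinearMap.analyticAt (ContinuousMap.evalCLM ℝ one : UnitFun →L[ℝ] ℝ) (ψ 0)).comp hψ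
  have hq_small : ∀ᶠ q in 𝓝 (0 : ℝ × ℝ × ℝ), ‖q‖ < δ := by
    simpa using Metric.eventually_nhds_iff.2 ⟨δ, hδ, fun {q} (hq : dist q 0 < δ) => by
      simpa using hq⟩
  refine ⟨fun q => ψ q one, hχ, ?_, ?_⟩
  · filter_upwards [hq_small] with q hq hτ
    obtain ⟨ε, τ, Y⟩ := q
    have hτ' : τ = 0 := hτ
    subst hτ'
    have h1 : ‖Y • (1 : UnitFun)‖ < δ := by
      rw [norm_smul, norm_one, mul_one]
      exact ((norm_snd_le _).trans (norm_snd_le _)).trans_lt hq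
    have h2 := (hU _ _ hq h1).1 (by simp [revPhi])
    simp only [h2]
    simp
  · have hψs : ∀ᶠ q in 𝓝 (0 : ℝ × ℝ × ℝ), ‖ψ q‖ < δ :=
      (hψ.continuousAt.norm).eventually_lt continuousAt_const (by simpa [hψ0] using hδ)
    have hD : ∀ᶠ q in 𝓝 (0 : ℝ × ℝ × ℝ), ∀ s, 0 < revDK p (q, ψ q) s := by
      have hc : ContinuousAt (fun q => revDK p (q, ψ q)) 0 :=
        ContinuousAt.comp (g := revDK p) (contDiff_revDK p).continuous.continuousAt
          (continuousAt_id.prodMk hψ.continuousAt)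
      refine hc.eventually (eventually_pos (w₀ := revDK p (0, ψ 0)) fun s => ?_)
      simp [revDK]
    filter_upwards [hq_small, hψs, hD, hz, hχ.eventually_analyticAt] with q hq hψq hDq hzq hχq
    obtain ⟨ε, τ, Y⟩ := q
    set u := ψ (ε, τ, Y) with hu
    have h : ∀ s : Icc (0 : ℝ) 1, 0 < revD p ε (1 + τ * (1 - s)) (u s) := fun s => by
      rw [← revDK_apply]; exact hDq s
    let F : ℝ → ℝ := fun σ =>
      2 * (revN p ε (1 + τ * (1 - (projIcc 0 1 zero_le_one σ : ℝ))) (u (projIcc 0 1 zero_le_one σ))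
        / revD p ε (1 + τ * (1 - (projIcc 0 1 zero_le_one σ : ℝ)))
          (u (projIcc 0 1 zero_le_one σ)))
    have hFc : Continuous F := by
      have : F = fun σ => revRK p ((ε, τ, Y), u) (projIcc 0 1 zero_le_one σ) :=
        funext fun σ => (revRK_apply h _).symm
      rw [this]
      fun_prop
    have hus : ∀ s : Icc (0 : ℝ) 1, u s = Y - τ * ∫ σ in (0 : ℝ)..s, F σ := fun s => by
      have := congrArg (fun v : UnitFun => v s) hzq
      simp only [revPhi_apply h, ContinuousMap.zero_apply] at this
      linarith
    have hu0 : u zero = Y := by simpa [zero] using hus zero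
    have hF0 : F 0 = 2 * (revN p ε (1 + τ) Y / revD p ε (1 + τ) Y) := by
      have e : projIcc (0 : ℝ) 1 zero_le_one 0 = zero := projIcc_left _
      simp only [F, e, hu0]
      simp [zero]
    have hD0 : 0 < revD p ε (1 + τ) Y := by
      have := h zero
      rw [hu0] at this
      simpa [zero] using this
    refine ⟨hD0, ?_⟩
    -- The curve of initial data along one solution; its velocity at r = 0 is −τ (0, 1, `F 0`),
    -- whence the factor τ in the conclusion.
    let c : ℝ → ℝ × ℝ × ℝ := fun r => (ε, τ * (1 - r), Y - τ * ∫ σ in (0 : ℝ)..r, F σ)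
    have hc0 : c 0 = (ε, τ, Y) := by simp [c]
    have hcd : HasDerivAt c (0, -τ, -(τ * F 0)) 0 := by
      have h1 := ((hasDerivAt_id (0 : ℝ)).const_sub 1).const_mul τ
      have h2 := ((hFc.integral_hasStrictDerivAt 0 0).hasDerivAt.const_mul τ).const_sub Y
      refine ((hasDerivAt_const (0 : ℝ) ε).prodMk (h1.prodMk h2)).congr_deriv ?_
      simp
    have hconst : ∀ r ∈ Icc (0 : ℝ) 1, ψ (c r) one = u one := fun r hr => by
      let r' : Icc (0 : ℝ) 1 := ⟨r, hr⟩
      have e1 : c r = (ε, τ * (1 - (r' : ℝ)), u r') := by simp only [c, hus, r']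
      have hn : ‖c r‖ < δ := by
        rw [e1]
        have n1 : ‖ε‖ < δ := (norm_fst_le _).trans_lt hq
        have n2 : ‖τ‖ < δ := ((norm_fst_le (τ, Y)).trans (norm_snd_le (ε, τ, Y))).trans_lt hq
        have n3 : ‖τ * (1 - (r' : ℝ))‖ < δ := by
          rw [norm_mul]
          refine lt_of_le_of_lt (mul_le_of_le_one_right (norm_nonneg _) ?_) n2
          rw [Real.norm_eq_abs, abs_le]
          constructor <;> linarith [hr.1, hr.2, show (r' : ℝ) = r from rfl]
        have n4 : ‖u r'‖ < δ := (u.norm_coe_le_norm _).trans_lt hψq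
        simp only [Prod.norm_def, max_lt_iff]
        exact ⟨n1, n3, n4⟩
      have h1 := (hU _ _ hn ((norm_tailK_le u r').trans_lt hψq)).1 (by
        rw [e1]; exact revPhi_tail h hzq r')
      rw [h1]
      have : tailPt r' one = one := by
        apply Subtype.ext
        simp [tailPt, one]
      exact congrArg u this
    have hcomp : HasDerivAt (fun r => ψ (c r) one)
        (fderiv ℝ (fun q => ψ q one) (ε, τ, Y) (0, -τ, -(τ * F 0))) 0 :=
      HasFDerivAt.comp_hasDerivAt (f := c) (l := fun q => ψ q one) 0
        (by rw [hc0]; exact hχq.differentiableAt.hasFDerivAt) hcd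
    have hz0 : fderiv ℝ (fun q => ψ q one) (ε, τ, Y) (0, -τ, -(τ * F 0)) = 0 := by
      have hmem : (0 : ℝ) ∈ Icc (0 : ℝ) 1 := by simp
      refine ((uniqueDiffOn_Icc (zero_lt_one' ℝ)) 0 hmem).eq_deriv _
        (hcomp.hasDerivWithinAt (s := Icc 0 1)) ?_
      exact (hasDerivWithinAt_const _ _ (u one)).congr (fun r hr => hconst r hr) (hconst 0 hmem)
    have hv : ((0, -τ, -(τ * F 0)) : ℝ × ℝ × ℝ) = (-τ) • ((0, 1, F 0) : ℝ × ℝ × ℝ) := by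
      simp
    rw [hv, map_smul, smul_eq_mul, hF0] at hz0
    linarith


/-- The relation of `exists_transport` is void at τ = 0; continuity of the derivative removes the
factor. The derivative in Y is 1 at the origin because χ(0, 0, Y) = Y for small Y, so it is positive
nearby. -/
theorem exists_transport' (p : CubicPerturbation) : ∃ χ : ℝ × ℝ × ℝ → ℝ,
    ∀ᶠ q in 𝓝 (0 : ℝ × ℝ × ℝ), AnalyticAt ℝ χ q ∧ 0 < fderiv ℝ χ q (0, 0, 1) ∧
      0 < revD p q.1 (1 + q.2.1) q.2.2 ∧ fderiv ℝ χ q (0, 1, 2 * (revN p q.1 (1 + q.2.1) q.2.2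
        / revD p q.1 (1 + q.2.1) q.2.2)) = 0 := by
  obtain ⟨χ, hχ, h1, h2⟩ := exists_transport p
  have hd : ContinuousAt (fderiv ℝ χ) 0 := hχ.fderiv.continuousAt
  have hY : fderiv ℝ χ 0 (0, 0, 1) = 1 := by
    have hl : HasDerivAt (fun s : ℝ => ((0, 0, s) : ℝ × ℝ × ℝ)) (0, 0, 1) 0 :=
      (hasDerivAt_const _ _).prodMk ((hasDerivAt_const _ _).prodMk (hasDerivAt_id _))
    have hc : HasDerivAt (fun s : ℝ => χ (0, 0, s)) (fderiv ℝ χ 0 (0, 0, 1)) 0 :=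
      HasFDerivAt.comp_hasDerivAt (f := fun s : ℝ => ((0, 0, s) : ℝ × ℝ × ℝ)) (l := χ) 0
        hχ.differentiableAt.hasFDerivAt hl
    refine hc.unique ((hasDerivAt_id (0 : ℝ)).congr_of_eventuallyEq ?_)
    have : Tendsto (fun s : ℝ => ((0, 0, s) : ℝ × ℝ × ℝ)) (𝓝 0) (𝓝 0) := hl.continuousAt
    filter_upwards [this.eventually h1] with s hs using hs rfl
  have hpos : ∀ᶠ q in 𝓝 (0 : ℝ × ℝ × ℝ), 0 < fderiv ℝ χ q (0, 0, 1) :=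
    continuousAt_const.eventually_lt (hd.clm_apply continuousAt_const) (by rw [hY]; exact one_pos)
  refine ⟨χ, ?_⟩
  filter_upwards [hχ.eventually_analyticAt, hpos, h2, eventually_eventually_nhds.2 h2]
    with q hq1 hq2 hq3 hq4
  refine ⟨hq1, hq2, hq3.1, ?_⟩
  rcases ne_or_eq q.2.1 0 with hne | h0
  · exact (mul_eq_zero.1 hq3.2).resolve_left hne
  have hl : ContinuousAt (fun t : ℝ => q + (0, t, 0)) 0 := by fun_prop
  have hl' : Tendsto (fun t : ℝ => q + (0, t, 0)) (𝓝 0) (𝓝 q) := by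
    have e : q + (0, 0, 0) = q := add_zero q
    simpa only [e] using hl.tendsto
  let R : ℝ × ℝ × ℝ → ℝ × ℝ × ℝ := fun q => (0, 1, 2 * (revN p q.1 (1 + q.2.1) q.2.2
        / revD p q.1 (1 + q.2.1) q.2.2))
  have hR : ContinuousAt R q := by
    have hN : Continuous fun q : ℝ × ℝ × ℝ => revN p q.1 (1 + q.2.1) q.2.2 := by
      unfold revN; fun_prop
    have hD : Continuous fun q : ℝ × ℝ × ℝ => revD p q.1 (1 + q.2.1) q.2.2 := by
      unfold revD; fun_prop
    exact continuousAt_const.prodMk (continuousAt_const.prodMk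
      (continuousAt_const.mul (hN.continuousAt.div hD.continuousAt hq3.1.ne')))
  have hcont : Tendsto (fun t : ℝ => fderiv ℝ χ (q + (0, t, 0)) (R (q + (0, t, 0)))) (𝓝[≠] 0)
      (𝓝 (fderiv ℝ χ q (R q))) :=
    ((hq1.fderiv.continuousAt.clm_apply hR).tendsto.comp hl').mono_left nhdsWithin_le_nhds
  refine tendsto_nhds_unique hcont (tendsto_const_nhds.congr' ?_)
  filter_upwards [(hl'.eventually hq4).filter_mono nhdsWithin_le_nhds, self_mem_nhdsWithin]
    with t ht ht0
  have : (q + (0, t, 0)).2.1 ≠ 0 := by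
    simpa [h0] using ht0
  exact ((mul_eq_zero.1 ht.2).resolve_left this).symm

/-- The conditions on the coefficients for the system to be reversible in `y`. -/
structure ReversibleCoefficients (p : CubicPerturbation) : Prop where
  a00 : p.a 0 0 = 0
  a10 : p.a 1 0 = 0
  a20 : p.a 2 0 = 0
  a30 : p.a 3 0 = 0
  a02 : p.a 0 2 = 0
  a12 : p.a 1 2 = 0
  b01 : p.b 0 1 = 0
  b11 : p.b 1 1 = 0
  b21 : p.b 2 1 = 0
  b03 : p.b 0 3 = 0

namespace ReversibleCoefficients

variable {p : CubicPerturbation}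

theorem field_eq (hp : ReversibleCoefficients p) (ε : ℝ) (z : ℝ × ℝ) :
    p.field ε z = (z.2 * revD p ε z.1 (z.2 ^ 2), revN p ε z.1 (z.2 ^ 2)) := by
  simp only [CubicPerturbation.field, p.f_eq, p.g_eq, hp.a00, hp.a10, hp.a20, hp.a30, hp.a02,
    hp.a12, hp.b01, hp.b11, hp.b21, hp.b03, revD, revN]
  ext
  · ring
  · ring

theorem isReversibleInY (hp : ReversibleCoefficients p) : IsReversibleInY p := fun ε x y => by
  simp [hp.field_eq]

/-- With Y = y² the field is ẋ = yD, ẏ = N, so dY/dx = 2N/D off the axis. Then G = χ(ε, x − 1, y²)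
is analytic across y = 0 as well, and dG = (2χ_Y/D)(ẋ dy − ẏ dx). -/
theorem hasLocalIntegral (hp : ReversibleCoefficients p) : HasLocalIntegral p := by
  obtain ⟨χ, hχ⟩ := exists_transport' p
  have hcont : Tendsto (fun w : (ℝ × ℝ) × ℝ => ((w.2, w.1.1 - 1, w.1.2 ^ 2) : ℝ × ℝ × ℝ))
      (𝓝 ((1, 0), 0)) (𝓝 0) := by
    have : Continuous (fun w : (ℝ × ℝ) × ℝ => ((w.2, w.1.1 - 1, w.1.2 ^ 2) : ℝ × ℝ × ℝ)) := by
      fun_prop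
    have e : ((0, 1 - 1, 0 ^ 2) : ℝ × ℝ × ℝ) = 0 := by simp
    simpa only [e] using this.tendsto ((1, 0), 0)
  have hev := hcont.eventually hχ
  rw [nhds_prod_eq, eventually_prod_iff] at hev
  obtain ⟨P, hP, Q, hQ, H⟩ := hev
  obtain ⟨ρ, hρ, hball⟩ := Metric.eventually_nhds_iff_ball.1 hP
  refine ⟨ρ, hρ, ?_⟩
  filter_upwards [hQ] with ε hε
  refine ⟨fun z => χ (ε, z.1 - 1, z.2 ^ 2), fun z hz => ?_⟩
  obtain ⟨h1, h2, h3, h4⟩ := H (hball z hz) hε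
  simp only [add_sub_cancel] at h1 h2 h3 h4
  have hin : AnalyticAt ℝ (fun z : ℝ × ℝ => ((ε, z.1 - 1, z.2 ^ 2) : ℝ × ℝ × ℝ)) z :=
    analyticAt_const.prod ((analyticAt_fst.sub analyticAt_const).prod (analyticAt_snd.pow 2))
  have hG : AnalyticAt ℝ (fun z : ℝ × ℝ => χ (ε, z.1 - 1, z.2 ^ 2)) z :=
    AnalyticAt.comp (g := χ) h1 hin
  set L := fderiv ℝ χ (ε, z.1 - 1, z.2 ^ 2) with hL
  refine ⟨hG, 2 * L (0, 0, 1) / revD p ε z.1 (z.2 ^ 2), by positivity, fun v => ?_⟩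
  refine fderiv_eq_of_line hG.differentiableAt ?_
  have hx := (hasDerivAt_line z.1 v.1).sub_const 1
  have hy := (hasDerivAt_line z.2 v.2).pow 2
  have hc := (hasDerivAt_const (0 : ℝ) ε).prodMk (hx.prodMk hy)
  refine (HasFDerivAt.comp_hasDerivAt (l := χ)
    (f := fun s : ℝ => ((ε, z.1 + s * v.1 - 1, (z.2 + s * v.2) ^ 2) : ℝ × ℝ × ℝ)) 0
    (by simpa using h1.differentiableAt.hasFDerivAt) hc).congr_deriv ?_
  have hsplit : ∀ a b R : ℝ, ((0, a, b) : ℝ × ℝ × ℝ)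
      = a • (0, 1, R) + (b - a * R) • (0, 0, 1) := fun a b R => by
    ext <;> simp
  rw [hsplit _ _ (2 * (revN p ε z.1 (z.2 ^ 2) / revD p ε z.1 (z.2 ^ 2))), map_add, map_smul,
    map_smul, h4, hp.field_eq]
  simp only [smul_eq_mul]
  field_simp
  simp
  ring

end ReversibleCoefficients

/-! ### The stratum reversible in x: the Darboux integral for ε > 0 -/

/-- The form of the systems that are reversible in `x`. -/
structure DarbouxForm (p : CubicPerturbation) : Prop where
  f_eq : ∀ x y, p.f x y =
    p.a 0 0 * (1 - x ^ 2) + p.a 0 1 * y + p.a 2 1 * x ^ 2 * y + p.a 0 3 * y ^ 3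
  g_eq : ∀ x y, p.g x y = p.b 1 0 * (x - x ^ 3) + 2 * p.a 0 0 * x * y + 2 * p.a 2 1 * x * y ^ 2
  b30 : p.b 3 0 = -p.b 1 0
  a21 : p.a 2 1 ≠ 0

/-- The differential of `P_σ`. -/
def darbouxdP (p : CubicPerturbation) (ε σ : ℝ) (z v : ℝ × ℝ) : ℂ :=
  2 * z.1 * v.1 + (2 * darbouxA p ε σ * z.2 + darbouxB p ε) * v.2

theorem hasDerivAt_darbouxP (p : CubicPerturbation) (ε σ : ℝ) (z v : ℝ × ℝ) :
    HasDerivAt (fun s : ℝ => darbouxP p ε σ (z.1 + s * v.1, z.2 + s * v.2))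
      (darbouxdP p ε σ z v) 0 := by
  have hx := (hasDerivAt_line z.1 v.1).ofReal_comp
  have hy := (hasDerivAt_line z.2 v.2).ofReal_comp
  refine ((((hx.pow 2).add ((hy.pow 2).const_mul (darbouxA p ε σ))).add
    (hy.const_mul (darbouxB p ε))).add_const (darbouxC p ε σ)).congr_deriv ?_
  simp [darbouxdP]
  ring

open scoped ContDiff in
theorem analyticAt_darbouxP (p : CubicPerturbation) (ε σ : ℝ) (z : ℝ × ℝ) :
    AnalyticAt ℝ (darbouxP p ε σ) z := by
  have hx : ContDiff ℝ ω (fun z : ℝ × ℝ => (z.1 : ℂ)) :=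
    Complex.ofRealCLM.contDiff.comp contDiff_fst
  have hy : ContDiff ℝ ω (fun z : ℝ × ℝ => (z.2 : ℂ)) :=
    Complex.ofRealCLM.contDiff.comp contDiff_snd
  have h : ContDiff ℝ ω (darbouxP p ε σ) := by
    unfold darbouxP
    fun_prop
  exact h.contDiffAt.analyticAt

/-- Comparison of coefficients in n₁P₂ dP₁ + n₂P₁ dP₂ = ẋ dy − ẏ dx, where e stands for 1 + εb₁₀ and
(v, w) for (dx, dy). Division by P₁P₂ gives the logarithmic differential of P₁^{n₁} P₂^{n₂}. -/
theorem darboux_identity {x y v w ε e a00 a01 a21 a03 n₁ n₂ A₁ A₂ B C₁ C₂ : ℂ}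
    (h1 : n₁ + n₂ = e / 2) (h2 : n₁ * A₁ + n₂ * A₂ = ε * a21 / 2)
    (h3 : n₁ * A₂ + n₂ * A₁ = -(ε * a21)) (h4 : A₁ * A₂ * e = ε * a03)
    (h5 : e * B = -(2 * ε * a00)) (h6 : n₁ * C₂ + n₂ * C₁ = -(e / 2))
    (h7 : 2 * (n₁ * A₁ * C₂ + n₂ * A₂ * C₁) = 1 + ε * a01 - e / 2 * B ^ 2) :
    n₁ * (x ^ 2 + A₂ * y ^ 2 + B * y + C₂) * (2 * x * v + (2 * A₁ * y + B) * w)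
      + n₂ * (x ^ 2 + A₁ * y ^ 2 + B * y + C₁) * (2 * x * v + (2 * A₂ * y + B) * w)
    = (y + ε * (a00 * (1 - x ^ 2) + a01 * y + a21 * x ^ 2 * y + a03 * y ^ 3)) * w
      - (e * (x - x ^ 3) + ε * (2 * a00 * x * y + 2 * a21 * x * y ^ 2)) * v := by
  linear_combination (2 * x * v + B * w) * ((x ^ 2 + B * y) * h1 + y ^ 2 * h3 + h6 + y / 2 * h5)
    + 2 * y * w * ((x ^ 2 + B * y) * h2 + A₁ * A₂ * y ^ 2 * h1) + y ^ 3 * w * h4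
    + y * w * h7 + (x ^ 2 - 1 - B * y) / 2 * w * h5

/-- The discriminant `Δ`. -/
def darbouxDisc (p : CubicPerturbation) (ε : ℝ) : ℝ :=
  (p.a 2 1) ^ 2 - 4 * p.a 0 3 * (p.b 1 0 + 1 / ε)

theorem darbouxSqrt_sq (p : CubicPerturbation) (ε : ℝ) :
    darbouxSqrt p ε ^ 2 = (darbouxDisc p ε : ℂ) := by
  have h := Complex.cpow_nat_inv_pow (darbouxDisc p ε : ℂ) two_ne_zero
  rw [darbouxSqrt, one_div (2 : ℂ)]
  exact h

/-- The nondegeneracy conditions for the Darboux integral to be well defined. -/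
structure DarbouxRegular (p : CubicPerturbation) (ε : ℝ) : Prop where
  eps : ε ≠ 0
  unit : (1 : ℂ) + ε * p.b 1 0 ≠ 0
  sqrt : darbouxSqrt p ε ≠ 0
  n1 : darbouxN p ε 1 ≠ 0
  n2 : darbouxN p ε (-1) ≠ 0

theorem darbouxA_sub (p : CubicPerturbation) (ε σ : ℝ) :
    darbouxA p ε (-σ) - darbouxA p ε σ = -(σ * ε * darbouxSqrt p ε / (1 + ε * p.b 1 0)) := by
  simp only [darbouxA, Complex.ofReal_neg]
  rcases eq_or_ne ((1 : ℂ) + ε * p.b 1 0) 0 with h | h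
  · simp [h]
  · field_simp
    ring

theorem darbouxN_add (p : CubicPerturbation) (ε : ℝ) :
    darbouxN p ε 1 + darbouxN p ε (-1) = (1 + ε * p.b 1 0) / 2 := by
  simp only [darbouxN, Complex.ofReal_neg, Complex.ofReal_one]
  ring

/-- The definition of C with its denominators cleared. The factor ε√Δ is also the scale on which C
has a finite nonzero limit as ε ↓ 0. -/
theorem DarbouxRegular.n_mul_C {p : CubicPerturbation} {ε : ℝ} (h : DarbouxRegular p ε) {σ : ℝ}
    (hσ : σ = 1 ∨ σ = -1) :
    darbouxN p ε (-σ) * (ε * darbouxSqrt p ε * darbouxC p ε σ) = -(σ * (1 + ε * p.b 1 0) / 2) *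
      (1 + ε * p.a 0 1 + (1 + ε * p.b 1 0) / 2 * (2 * darbouxA p ε σ - darbouxB p ε ^ 2)) := by
  have hs := h.sqrt
  have he := h.unit
  have hε : (ε : ℂ) ≠ 0 := by exact_mod_cast h.eps
  rw [darbouxC, darbouxA_sub, darbouxN_add]
  rcases hσ with rfl | rfl
  · have hn := h.n2
    field_simp
    push_cast
    ring
  · have hn := h.n1
    rw [neg_neg]
    field_simp
    push_cast
    ring

theorem DarbouxForm.field_eq {p : CubicPerturbation} (hp : DarbouxForm p) (ε : ℝ) (z : ℝ × ℝ) :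
    p.field ε z = (z.2 + ε * (p.a 0 0 * (1 - z.1 ^ 2) + p.a 0 1 * z.2 + p.a 2 1 * z.1 ^ 2 * z.2
      + p.a 0 3 * z.2 ^ 3), (1 + ε * p.b 1 0) * (z.1 - z.1 ^ 3)
      + ε * (2 * p.a 0 0 * z.1 * z.2 + 2 * p.a 2 1 * z.1 * z.2 ^ 2)) := by
  rw [CubicPerturbation.field, hp.f_eq, hp.g_eq]
  ext
  · rfl
  · ring

theorem DarbouxForm.differential_eq {p : CubicPerturbation} (hp : DarbouxForm p) {ε : ℝ}
    (h : DarbouxRegular p ε) (z v : ℝ × ℝ) :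
    darbouxN p ε 1 * darbouxP p ε (-1) z * darbouxdP p ε 1 z v
      + darbouxN p ε (-1) * darbouxP p ε 1 z * darbouxdP p ε (-1) z v
    = (((p.field ε z).1 * v.2 - (p.field ε z).2 * v.1 : ℝ) : ℂ) := by
  have hs := h.sqrt
  have he := h.unit
  have hε : (ε : ℂ) ≠ 0 := by exact_mod_cast h.eps
  have hsq := darbouxSqrt_sq p ε
  simp only [darbouxDisc] at hsq
  push_cast at hsq
  have hc1 := h.n_mul_C (σ := 1) (Or.inl rfl)
  have hc2 := h.n_mul_C (σ := -1) (Or.inr rfl)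
  rw [neg_neg] at hc2
  have hd := darbouxA_sub p ε 1
  have h1 := darbouxN_add p ε
  have hA : ∀ σ, darbouxA p ε σ
      = ε * (-p.a 2 1 + σ * darbouxSqrt p ε) / (2 * (1 + ε * p.b 1 0)) := fun σ => rfl
  have hN : ∀ σ, darbouxN p ε σ
      = (1 + σ * (3 * p.a 2 1 / darbouxSqrt p ε)) * ((1 + ε * p.b 1 0) / 4) := fun σ => rfl
  have h2 : darbouxN p ε 1 * darbouxA p ε 1 + darbouxN p ε (-1) * darbouxA p ε (-1)
      = ε * p.a 2 1 / 2 := by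
    rw [hA, hA, hN, hN]
    push_cast
    field_simp
    ring
  have h3 : darbouxN p ε 1 * darbouxA p ε (-1) + darbouxN p ε (-1) * darbouxA p ε 1
      = -(ε * p.a 2 1) := by
    rw [hA, hA, hN, hN]
    push_cast
    field_simp
    ring
  have h4 : darbouxA p ε 1 * darbouxA p ε (-1) * (1 + ε * p.b 1 0) = ε * p.a 0 3 := by
    have e1 : darbouxA p ε 1 * darbouxA p ε (-1) * (1 + ε * p.b 1 0)
        = ε ^ 2 * (p.a 2 1 ^ 2 - darbouxSqrt p ε ^ 2) / (4 * (1 + ε * p.b 1 0)) := by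
      rw [hA, hA]
      push_cast
      field_simp
      ring
    rw [e1, div_eq_iff (mul_ne_zero (by norm_num) he)]
    field_simp at hsq
    linear_combination (-(ε : ℂ)) * hsq
  have h5 : (1 + ε * p.b 1 0) * darbouxB p ε = -(2 * ε * p.a 0 0) := by
    rw [darbouxB]
    field_simp
  have hS : (ε : ℂ) * darbouxSqrt p ε ≠ 0 := mul_ne_zero hε hs
  push_cast at hc1 hc2 hd
  have hd' : (darbouxA p ε (-1) - darbouxA p ε 1) * (1 + ε * p.b 1 0)
      = -(ε * darbouxSqrt p ε) := by
    rw [hd]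
    field_simp
  have h6 : darbouxN p ε 1 * darbouxC p ε (-1) + darbouxN p ε (-1) * darbouxC p ε 1
      = -((1 + ε * p.b 1 0) / 2) := by
    refine mul_left_cancel₀ hS ?_
    linear_combination hc1 + hc2 + (1 + ε * p.b 1 0) / 2 * hd'
  have h7 : 2 * (darbouxN p ε 1 * darbouxA p ε 1 * darbouxC p ε (-1)
      + darbouxN p ε (-1) * darbouxA p ε (-1) * darbouxC p ε 1)
      = 1 + ε * p.a 0 1 - (1 + ε * p.b 1 0) / 2 * darbouxB p ε ^ 2 := by
    refine mul_left_cancel₀ hS ?_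
    linear_combination 2 * darbouxA p ε (-1) * hc1 + 2 * darbouxA p ε 1 * hc2
      - (1 + ε * p.a 0 1 - (1 + ε * p.b 1 0) / 2 * darbouxB p ε ^ 2) * hd'
  have key := darboux_identity (x := z.1) (y := z.2) (v := v.1) (w := v.2) h1 h2 h3 h4 h5 h6 h7
  rw [hp.field_eq]
  simp only [darbouxP, darbouxdP]
  push_cast
  rw [← key]

/-- The derivative of a Darboux function. -/
theorem DarbouxForm.fderiv_re_eq {p : CubicPerturbation} (hp : DarbouxForm p) {ε : ℝ}
    (h : DarbouxRegular p ε) {z : ℝ × ℝ} {s₁ s₂ τ : ℝ} {F : ℝ × ℝ → ℂ}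
    (hF : ∀ z, F z = (s₁ * darbouxP p ε 1 z) ^ (τ * darbouxN p ε 1)
      * (s₂ * darbouxP p ε (-1) z) ^ (τ * darbouxN p ε (-1)))
    (h1 : s₁ * darbouxP p ε 1 z ∈ Complex.slitPlane)
    (h2 : s₂ * darbouxP p ε (-1) z ∈ Complex.slitPlane) :
    AnalyticAt ℝ (fun z => (F z).re) z ∧ ∀ v, fderiv ℝ (fun z => (F z).re) z v
      = (τ * F z / (darbouxP p ε 1 z * darbouxP p ε (-1) z)).re
        * ((p.field ε z).1 * v.2 - (p.field ε z).2 * v.1) := by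
  have hpow : ∀ (s σ : ℝ) (c : ℂ), s * darbouxP p ε σ z ∈ Complex.slitPlane →
      AnalyticAt ℝ (fun z => (s * darbouxP p ε σ z) ^ c) z := fun s σ c hs => by
    have e1 : AnalyticAt ℂ (fun w : ℂ => w ^ c) (s * darbouxP p ε σ z) :=
      analyticAt_id.cpow analyticAt_const hs
    exact AnalyticAt.comp (g := fun w : ℂ => w ^ c) (e1.restrictScalars (𝕜 := ℝ))
      (analyticAt_const.mul (analyticAt_darbouxP p ε σ z))
  have hFa : AnalyticAt ℝ F z := by
    rw [funext hF]
    exact (hpow s₁ 1 _ h1).mul (hpow s₂ (-1) _ h2)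
  have hG : AnalyticAt ℝ (fun z => (F z).re) z :=
    AnalyticAt.comp (g := Complex.re) (Complex.reCLM.analyticAt _) hFa
  refine ⟨hG, fun v => fderiv_eq_of_line hG.differentiableAt ?_⟩
  have hd : ∀ (s σ : ℝ) (c : ℂ), s * darbouxP p ε σ z ∈ Complex.slitPlane →
      HasDerivAt (fun t : ℝ => (s * darbouxP p ε σ (z.1 + t * v.1, z.2 + t * v.2)) ^ c)
        ((s * darbouxP p ε σ z) ^ c * (c * (darbouxdP p ε σ z v / darbouxP p ε σ z))) 0 :=
      fun s σ c hs => by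
    have hs0 := Complex.slitPlane_ne_zero hs
    have hP0 : darbouxP p ε σ z ≠ 0 := right_ne_zero_of_mul hs0
    have hs0' : (s : ℂ) ≠ 0 := left_ne_zero_of_mul hs0
    have e1 := ((hasDerivAt_darbouxP p ε σ z v).const_mul (s : ℂ))
    refine (HasDerivAt.comp (h₂ := fun w : ℂ => w ^ c) 0
      (Complex.hasStrictDerivAt_cpow_const (x := s * darbouxP p ε σ (z.1 + 0 * v.1, z.2 + 0 * v.2))
        (by simpa using hs)).hasDerivAt e1).congr_deriv ?_
    simp only [zero_mul, add_zero, Prod.mk.eta]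
    rw [Complex.cpow_sub _ _ hs0, Complex.cpow_one]
    field_simp
  have hP1 : darbouxP p ε 1 z ≠ 0 := right_ne_zero_of_mul (Complex.slitPlane_ne_zero h1)
  have hP2 : darbouxP p ε (-1) z ≠ 0 := right_ne_zero_of_mul (Complex.slitPlane_ne_zero h2)
  have hprod := (hd s₁ 1 (τ * darbouxN p ε 1) h1).fun_mul (hd s₂ (-1) (τ * darbouxN p ε (-1)) h2)
  have hFd : HasDerivAt (fun t : ℝ => F (z.1 + t * v.1, z.2 + t * v.2))
      (τ * F z / (darbouxP p ε 1 z * darbouxP p ε (-1) z)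
        * (((p.field ε z).1 * v.2 - (p.field ε z).2 * v.1 : ℝ) : ℂ)) 0 := by
    simp only [hF]
    refine hprod.congr_deriv ?_
    rw [← hp.differential_eq h]
    simp only [zero_mul, add_zero, Prod.mk.eta]
    field_simp
  refine (HasFDerivAt.comp_hasDerivAt (l := Complex.re) (0 : ℝ)
    Complex.reCLM.hasFDerivAt hFd).congr_deriv ?_
  rw [Complex.reCLM_apply, Complex.re_mul_ofReal]

/-- Near `z` the Darboux function is real-valued at `z`, and its real part is an analytic first
integral with the orientation of the Hamiltonian. -/
def DarbouxGoodAt (p : CubicPerturbation) (ε : ℝ) (z : ℝ × ℝ) : Prop :=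
  (darboux p ε z).im = 0 ∧ AnalyticAt ℝ (fun z => (darboux p ε z).re) z ∧
    ∃ κ > 0, ∀ v, fderiv ℝ (fun z => (darboux p ε z).re) z v
      = κ * ((p.field ε z).1 * v.2 - (p.field ε z).2 * v.1)

/-- The multiplier is τF/(P₁P₂). The signs `s₁`, `s₂` make the bases positive, hence F > 0, and τ
compensates the sign of P₁P₂. -/
theorem DarbouxForm.goodAt_of_real {p : CubicPerturbation} (hp : DarbouxForm p) {ε : ℝ}
    (h : DarbouxRegular p ε) {z : ℝ × ℝ} {s₁ s₂ τ r₁ r₂ m₁ m₂ : ℝ}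
    (hF : ∀ z, darboux p ε z = (s₁ * darbouxP p ε 1 z) ^ (τ * darbouxN p ε 1)
      * (s₂ * darbouxP p ε (-1) z) ^ (τ * darbouxN p ε (-1)))
    (hP1 : darbouxP p ε 1 z = r₁) (hP2 : darbouxP p ε (-1) z = r₂)
    (hN1 : darbouxN p ε 1 = m₁) (hN2 : darbouxN p ε (-1) = m₂)
    (h1 : 0 < s₁ * r₁) (h2 : 0 < s₂ * r₂) (hτ : 0 < τ * (r₁ * r₂)) : DarbouxGoodAt p ε z := by
  have hmem : ∀ {s r : ℝ}, 0 < s * r → (s : ℂ) * (r : ℂ) ∈ Complex.slitPlane := fun {s r} hsr => by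
    rw [← Complex.ofReal_mul]
    exact Complex.ofReal_mem_slitPlane.2 hsr
  obtain ⟨hA, hd⟩ := hp.fderiv_re_eq h hF (by rw [hP1]; exact hmem h1)
    (by rw [hP2]; exact hmem h2)
  have hG : darboux p ε z = (((s₁ * r₁) ^ (τ * m₁) * (s₂ * r₂) ^ (τ * m₂) : ℝ) : ℂ) := by
    rw [hF, hP1, hP2, hN1, hN2]
    push_cast [Complex.ofReal_cpow h1.le, Complex.ofReal_cpow h2.le]
    rfl
  set G := (s₁ * r₁) ^ (τ * m₁) * (s₂ * r₂) ^ (τ * m₂)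
  have hGpos : 0 < G := by positivity
  refine ⟨by rw [hG, Complex.ofReal_im], hA, _, ?_, hd⟩
  rw [hG, hP1, hP2, ← Complex.ofReal_mul, ← Complex.ofReal_mul, ← Complex.ofReal_div,
    Complex.ofReal_re]
  have hr : r₁ * r₂ ≠ 0 := right_ne_zero_of_mul hτ.ne'
  have e : τ * G / (r₁ * r₂) = τ * (r₁ * r₂) * G / (r₁ * r₂) ^ 2 := by
    field_simp
  rw [e]
  positivity

-- With conjugate factors and exponents, F = |P₁^{n₁}|² and P₁P₂ = |P₁|², so the multiplier is
-- positive. Membership in the slit plane lets conjugation commute with the power.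
open ComplexConjugate in
theorem DarbouxForm.goodAt_of_conj {p : CubicPerturbation} (hp : DarbouxForm p) {ε : ℝ}
    (h : DarbouxRegular p ε) {z : ℝ × ℝ}
    (hF : ∀ z, darboux p ε z = darbouxP p ε 1 z ^ darbouxN p ε 1
      * darbouxP p ε (-1) z ^ darbouxN p ε (-1))
    (hP : darbouxP p ε (-1) z = conj (darbouxP p ε 1 z))
    (hN : darbouxN p ε (-1) = conj (darbouxN p ε 1))
    (h1 : darbouxP p ε 1 z ∈ Complex.slitPlane) : DarbouxGoodAt p ε z := by
  obtain ⟨hA, hd⟩ := hp.fderiv_re_eq h (s₁ := 1) (s₂ := 1) (τ := 1) (F := darboux p ε) (z := z)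
    (by simpa using hF) (by simpa using h1) (by
      simp only [Complex.ofReal_one, one_mul, hP, Complex.mem_slitPlane_iff, Complex.conj_re,
        Complex.conj_im, neg_ne_zero] at h1 ⊢
      exact h1)
  have hG : darboux p ε z = (Complex.normSq (darbouxP p ε 1 z ^ darbouxN p ε 1) : ℂ) := by
    rw [hF, hP, hN, Complex.conj_cpow _ _ (Complex.mem_slitPlane_iff_arg.1 h1).1,
      Complex.conj_conj, Complex.mul_conj]
  have h0 := Complex.slitPlane_ne_zero h1
  refine ⟨by rw [hG, Complex.ofReal_im], hA, _, ?_, hd⟩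
  rw [hG, hP, Complex.mul_conj, ← Complex.ofReal_mul, ← Complex.ofReal_div, Complex.ofReal_re,
    one_mul]
  have e1 : darbouxP p ε 1 z ^ darbouxN p ε 1 ≠ 0 := by
    rw [Ne, Complex.cpow_eq_zero_iff]
    exact fun h => h0 h.1
  exact div_pos (Complex.normSq_pos.2 e1) (Complex.normSq_pos.2 h0)

section Asymptotics

variable {p : CubicPerturbation} {w₀ : ℂ}

theorem tendsto_ofReal_zero : Tendsto (fun ε : ℝ => (ε : ℂ)) (𝓝[>] 0) (𝓝 0) := by
  have : Tendsto (fun ε : ℝ => (ε : ℂ)) (𝓝 0) (𝓝 ((0 : ℝ) : ℂ)) :=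
    Complex.continuous_ofReal.tendsto 0
  simpa using this.mono_left nhdsWithin_le_nhds

theorem tendsto_unit (b : ℝ) : Tendsto (fun ε : ℝ => (1 : ℂ) + ε * b) (𝓝[>] 0) (𝓝 1) := by
  simpa using (tendsto_ofReal_zero.mul_const (b : ℂ)).const_add 1

theorem tendsto_darbouxN (hw : Tendsto (fun ε => (darbouxSqrt p ε)⁻¹) (𝓝[>] 0) (𝓝 w₀)) (σ : ℝ) :
    Tendsto (fun ε => darbouxN p ε σ) (𝓝[>] 0) (𝓝 ((1 + σ * (3 * p.a 2 1 * w₀)) / 4)) := by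
  have h := (((hw.const_mul (3 * p.a 2 1 : ℂ)).const_mul (σ : ℂ)).const_add 1).mul
    ((tendsto_unit (p.b 1 0)).div_const 4)
  simpa only [darbouxN, div_eq_mul_inv, one_mul] using h

theorem tendsto_darbouxA (hS : Tendsto (fun ε : ℝ => ε * darbouxSqrt p ε) (𝓝[>] 0) (𝓝 0)) (σ : ℝ) :
    Tendsto (fun ε => darbouxA p ε σ) (𝓝[>] 0) (𝓝 0) := by
  have h := ((tendsto_ofReal_zero.mul_const (-p.a 2 1 : ℂ)).add (hS.const_mul (σ : ℂ))).div
    ((tendsto_unit (p.b 1 0)).const_mul 2) (by norm_num)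
  simp only [zero_mul, mul_zero, add_zero, zero_div] at h
  refine h.congr fun ε => ?_
  simp only [darbouxA, Pi.div_apply]
  ring

theorem tendsto_darbouxB : Tendsto (fun ε => darbouxB p ε) (𝓝[>] 0) (𝓝 0) := by
  have h := ((tendsto_ofReal_zero.const_mul 2).mul_const (p.a 0 0 : ℂ)).neg.div
    (tendsto_unit (p.b 1 0)) (by norm_num)
  simp only [zero_mul, mul_zero, neg_zero, zero_div] at h
  exact h

theorem eventually_darbouxRegular
    (hw : Tendsto (fun ε => (darbouxSqrt p ε)⁻¹) (𝓝[>] 0) (𝓝 w₀))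
    (hs : ∀ᶠ ε in 𝓝[>] 0, darbouxSqrt p ε ≠ 0)
    (hn : ∀ σ : ℝ, σ = 1 ∨ σ = -1 → 1 + σ * (3 * p.a 2 1 * w₀) ≠ 0) :
    ∀ᶠ ε in 𝓝[>] 0, DarbouxRegular p ε := by
  have hn' : ∀ σ : ℝ, σ = 1 ∨ σ = -1 → ∀ᶠ ε in 𝓝[>] 0, darbouxN p ε σ ≠ 0 := fun σ hσ =>
    (tendsto_darbouxN hw σ).eventually_ne (div_ne_zero (hn σ hσ) (by norm_num))
  filter_upwards [self_mem_nhdsWithin, (tendsto_unit (p.b 1 0)).eventually_ne one_ne_zero, hs,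
    hn' 1 (Or.inl rfl), hn' (-1) (Or.inr rfl)] with ε h1 h2 h3 h4 h5
  exact ⟨(ne_of_gt h1), h2, h3, h4, h5⟩

theorem tendsto_mul_darbouxC
    (hw : Tendsto (fun ε => (darbouxSqrt p ε)⁻¹) (𝓝[>] 0) (𝓝 w₀))
    (hS : Tendsto (fun ε : ℝ => ε * darbouxSqrt p ε) (𝓝[>] 0) (𝓝 0))
    (hs : ∀ᶠ ε in 𝓝[>] 0, darbouxSqrt p ε ≠ 0)
    (hn : ∀ σ : ℝ, σ = 1 ∨ σ = -1 → 1 + σ * (3 * p.a 2 1 * w₀) ≠ 0) {σ : ℝ}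
    (hσ : σ = 1 ∨ σ = -1) :
    Tendsto (fun ε : ℝ => ε * darbouxSqrt p ε * darbouxC p ε σ) (𝓝[>] 0)
      (𝓝 (-(2 * σ) / (1 - σ * (3 * p.a 2 1 * w₀)))) := by
  have hσ' : -σ = 1 ∨ -σ = -1 := by rcases hσ with rfl | rfl <;> simp
  have hn' := hn _ hσ'
  have h1 := ((tendsto_unit (p.b 1 0)).const_mul (σ : ℂ)).div_const 2 |>.neg
  have h2 := (tendsto_unit (p.a 0 1)).add (((tendsto_unit (p.b 1 0)).div_const 2).mul
    (((tendsto_darbouxA hS σ).const_mul 2).sub ((tendsto_darbouxB (p := p)).pow 2)))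
  have h3 := (h1.mul h2).div (tendsto_darbouxN hw (-σ)) (div_ne_zero hn' (by norm_num))
  have e : -((σ : ℂ) * 1 / 2) * (1 + 1 / 2 * (2 * 0 - 0 ^ 2))
      / ((1 + (-σ : ℝ) * (3 * p.a 2 1 * w₀)) / 4) = -(2 * σ) / (1 - σ * (3 * p.a 2 1 * w₀)) := by
    push_cast at hn' ⊢
    have hn2 : 1 - (σ : ℂ) * (3 * p.a 2 1 * w₀) ≠ 0 := by
      convert hn' using 1
      ring
    rw [show (1 : ℂ) + -σ * (3 * p.a 2 1 * w₀) = 1 - (σ : ℂ) * (3 * p.a 2 1 * w₀) by ring]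
    field_simp
    ring
  rw [e] at h3
  refine h3.congr' ?_
  filter_upwards [eventually_darbouxRegular hw hs hn] with ε hε
  have hc := hε.n_mul_C hσ
  have h0 : darbouxN p ε (-σ) ≠ 0 := by
    rcases hσ with rfl | rfl
    · exact hε.n2
    · rw [neg_neg]; exact hε.n1
  simp only [Pi.div_apply]
  rw [div_eq_iff h0, ← hc]
  ring

/-- As ε ↓ 0 the factor ε√Δ tends to 0 while ε√Δ C does not, so the constant term dominates P on
bounded sets. The number `w₀` is the limit of 1/√Δ. -/
theorem eventually_mul_darbouxP
    (hw : Tendsto (fun ε => (darbouxSqrt p ε)⁻¹) (𝓝[>] 0) (𝓝 w₀))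
    (hS : Tendsto (fun ε : ℝ => ε * darbouxSqrt p ε) (𝓝[>] 0) (𝓝 0))
    (hs : ∀ᶠ ε in 𝓝[>] 0, darbouxSqrt p ε ≠ 0)
    (hn : ∀ σ : ℝ, σ = 1 ∨ σ = -1 → 1 + σ * (3 * p.a 2 1 * w₀) ≠ 0) {σ : ℝ}
    (hσ : σ = 1 ∨ σ = -1) (R : ℝ) {η : ℝ} (hη : 0 < η) :
    ∀ᶠ ε in 𝓝[>] 0, ∀ z : ℝ × ℝ, ‖z‖ ≤ R →
      ‖ε * darbouxSqrt p ε * darbouxP p ε σ z - -(2 * σ) / (1 - σ * (3 * p.a 2 1 * w₀))‖ < η := by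
  have hC := (tendsto_mul_darbouxC hw hS hs hn hσ).sub_const
    (-(2 * σ) / (1 - σ * (3 * p.a 2 1 * w₀)))
  have hA := hS.mul (tendsto_darbouxA hS σ)
  have hB := hS.mul (tendsto_darbouxB (p := p))
  have hE := (((hS.norm.mul_const (R ^ 2)).add (hA.norm.mul_const (R ^ 2))).add
    (hB.norm.mul_const R)).add hC.norm
  simp only [sub_self, mul_zero, norm_zero, zero_mul, add_zero] at hE
  filter_upwards [hE.eventually_lt_const hη] with ε hε z hz
  refine lt_of_le_of_lt ?_ hε
  have hz1 : ‖(z.1 : ℂ)‖ ≤ R := by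
    rw [Complex.norm_real]; exact (norm_fst_le z).trans hz
  have hz2 : ‖(z.2 : ℂ)‖ ≤ R := by
    rw [Complex.norm_real]; exact (norm_snd_le z).trans hz
  have e : ε * darbouxSqrt p ε * darbouxP p ε σ z - -(2 * σ) / (1 - σ * (3 * p.a 2 1 * w₀))
      = ε * darbouxSqrt p ε * (z.1 : ℂ) ^ 2 + ε * darbouxSqrt p ε * darbouxA p ε σ * (z.2 : ℂ) ^ 2
        + ε * darbouxSqrt p ε * darbouxB p ε * z.2
        + (ε * darbouxSqrt p ε * darbouxC p ε σ - -(2 * σ) / (1 - σ * (3 * p.a 2 1 * w₀))) := by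
    rw [darbouxP]
    ring
  rw [e]
  refine (norm_add_le _ _).trans (add_le_add ((norm_add_le _ _).trans (add_le_add
    ((norm_add_le _ _).trans (add_le_add ?_ ?_)) ?_)) le_rfl)
  · rw [norm_mul, norm_pow]; gcongr
  · rw [norm_mul, norm_pow]; gcongr
  · rw [norm_mul]; gcongr

end Asymptotics

theorem darbouxSqrt_of_nonneg {p : CubicPerturbation} {ε : ℝ} (h : 0 ≤ darbouxDisc p ε) :
    darbouxSqrt p ε = (√(darbouxDisc p ε) : ℝ) := by
  rw [Real.sqrt_eq_rpow, Complex.ofReal_cpow h]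
  simp [darbouxSqrt, darbouxDisc]

theorem darbouxSqrt_of_nonpos {p : CubicPerturbation} {ε : ℝ} (h : darbouxDisc p ε ≤ 0) :
    darbouxSqrt p ε = (√(-darbouxDisc p ε) : ℝ) * Complex.I := by
  have e1 : darbouxSqrt p ε = (darbouxDisc p ε : ℂ) ^ (1 / 2 : ℂ) := rfl
  have e2 : Complex.exp (Real.pi * Complex.I * (1 / 2)) = Complex.I := by
    rw [show (Real.pi * Complex.I * (1 / 2) : ℂ) = Real.pi / 2 * Complex.I by ring]
    exact Complex.exp_pi_div_two_mul_I
  rw [e1, Complex.ofReal_cpow_of_nonpos h, e2, Real.sqrt_eq_rpow,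
    Complex.ofReal_cpow (neg_nonneg.2 h)]
  push_cast
  rfl

theorem tendsto_zero_of_sq {α : Type*} {l : Filter α} {f : α → ℂ} {g : α → ℝ}
    (h : ∀ x, f x ^ 2 = (g x : ℂ)) (hg : Tendsto g l (𝓝 0)) : Tendsto f l (𝓝 0) := by
  rw [tendsto_zero_iff_norm_tendsto_zero]
  have e : ∀ x, ‖f x‖ = √|g x| := fun x => by
    rw [← Real.norm_eq_abs, ← Complex.norm_real, ← h, norm_pow, Real.sqrt_sq (norm_nonneg _)]
  simp only [e]
  have := (Real.continuous_sqrt.comp continuous_abs).tendsto 0 |>.comp hg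
  simpa [Function.comp_def] using this

section

variable {p : CubicPerturbation}

theorem tendsto_mul_darbouxDisc (p : CubicPerturbation) :
    Tendsto (fun ε => ε * darbouxDisc p ε) (𝓝[>] 0) (𝓝 (-(4 * p.a 0 3))) := by
  have hc : Continuous fun ε : ℝ => ε * p.a 2 1 ^ 2 - 4 * p.a 0 3 * (ε * p.b 1 0 + 1) := by
    fun_prop
  have := (hc.tendsto 0).mono_left (nhdsWithin_le_nhds (s := Ioi 0))
  simp only [zero_mul, zero_add, zero_sub, mul_one] at this
  refine this.congr' ?_
  filter_upwards [self_mem_nhdsWithin] with ε hε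
  have : ε ≠ 0 := ne_of_gt hε
  rw [darbouxDisc]
  field_simp

theorem tendsto_mul_darbouxSqrt (p : CubicPerturbation) :
    Tendsto (fun ε : ℝ => ε * darbouxSqrt p ε) (𝓝[>] 0) (𝓝 0) := by
  refine tendsto_zero_of_sq (g := fun ε => ε * (ε * darbouxDisc p ε)) (fun ε => ?_) ?_
  · rw [mul_pow, darbouxSqrt_sq]
    push_cast
    ring
  · have h : Tendsto (fun ε : ℝ => ε) (𝓝[>] 0) (𝓝 0) := nhdsWithin_le_nhds
    simpa using h.mul (tendsto_mul_darbouxDisc p)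

theorem tendsto_inv_darbouxSqrt (h : p.a 0 3 ≠ 0) :
    Tendsto (fun ε : ℝ => (darbouxSqrt p ε)⁻¹) (𝓝[>] 0) (𝓝 0) := by
  refine tendsto_zero_of_sq (g := fun ε => (darbouxDisc p ε)⁻¹) (fun ε => ?_) ?_
  · rw [inv_pow, darbouxSqrt_sq]
    push_cast
    rfl
  · have h1 : Tendsto (fun ε : ℝ => ε) (𝓝[>] 0) (𝓝 0) := nhdsWithin_le_nhds
    have h2 := h1.div (tendsto_mul_darbouxDisc p) (by simpa using h)
    rw [zero_div] at h2
    refine h2.congr' ?_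
    filter_upwards [self_mem_nhdsWithin] with ε hε
    have : ε ≠ 0 := ne_of_gt hε
    simp only [Pi.div_apply]
    rw [div_mul_eq_div_div, div_self this, one_div]

open ComplexConjugate

theorem conj_darbouxA {t ε : ℝ} (h : conj (darbouxSqrt p ε) = t * darbouxSqrt p ε) (σ : ℝ) :
    conj (darbouxA p ε σ) = darbouxA p ε (t * σ) := by
  simp only [darbouxA, map_div₀, map_mul, map_add, map_neg, map_one, Complex.conj_ofReal, h,
    Complex.conj_ofNat]
  push_cast
  ring

theorem conj_darbouxB (ε : ℝ) : conj (darbouxB p ε) = darbouxB p ε := by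
  simp [darbouxB, Complex.conj_ofNat]

theorem conj_darbouxN {t ε : ℝ} (ht : t = 1 ∨ t = -1)
    (h : conj (darbouxSqrt p ε) = t * darbouxSqrt p ε) (σ : ℝ) :
    conj (darbouxN p ε σ) = darbouxN p ε (t * σ) := by
  simp only [darbouxN, map_div₀, map_mul, map_add, map_one, Complex.conj_ofReal, h,
    Complex.conj_ofNat]
  rcases ht with rfl | rfl
  · simp
  · push_cast
    rw [neg_one_mul, div_neg]
    ring

theorem conj_darbouxC {t ε : ℝ} (ht : t = 1 ∨ t = -1)
    (h : conj (darbouxSqrt p ε) = t * darbouxSqrt p ε) (σ : ℝ) :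
    conj (darbouxC p ε σ) = darbouxC p ε (t * σ) := by
  simp only [darbouxC, darbouxN_add]
  simp only [map_div₀, map_mul, map_add, map_sub, map_pow, map_one, Complex.conj_ofReal,
    Complex.conj_ofNat, conj_darbouxA h, conj_darbouxB, conj_darbouxN ht h, mul_neg]

theorem conj_darbouxP {t ε : ℝ} (ht : t = 1 ∨ t = -1)
    (h : conj (darbouxSqrt p ε) = t * darbouxSqrt p ε) (σ : ℝ) (z : ℝ × ℝ) :
    conj (darbouxP p ε σ z) = darbouxP p ε (t * σ) z := by
  simp only [darbouxP, map_mul, map_add, map_pow, Complex.conj_ofReal, conj_darbouxA h,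
    conj_darbouxB, conj_darbouxC ht h]

theorem mul_pos_of_norm_sub_lt {k r L : ℝ} (hk : 0 < k)
    (h : ‖(k : ℂ) * (r : ℂ) - (L : ℂ)‖ < |L|) : 0 < L * r := by
  rw [← Complex.ofReal_mul, ← Complex.ofReal_sub, Complex.norm_real, Real.norm_eq_abs] at h
  have h1 : 0 < L * (k * r) := by
    by_contra! hn
    have h2 := sq_lt_sq.2 h
    nlinarith [sq_nonneg (k * r)]
  have h2 : 0 < k * (L * r) := by linarith [mul_left_comm L k r]
  exact pos_of_mul_pos_right h2 hk.le

/-- The case of a real square root. -/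
theorem DarbouxForm.eventually_goodAt_of_real (hp : DarbouxForm p) {w₀ s₁ s₂ τ : ℝ}
    (hw : Tendsto (fun ε => (darbouxSqrt p ε)⁻¹) (𝓝[>] 0) (𝓝 (w₀ : ℂ)))
    (hd : ∀ᶠ ε in 𝓝[>] 0, 0 < darbouxDisc p ε)
    (hF : ∀ ε z, darboux p ε z = (s₁ * darbouxP p ε 1 z) ^ (τ * darbouxN p ε 1)
      * (s₂ * darbouxP p ε (-1) z) ^ (τ * darbouxN p ε (-1)))
    {L₁ L₂ : ℝ} (hL1 : L₁ * (1 - 3 * p.a 2 1 * w₀) = -2)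
    (hL2 : L₂ * (1 + 3 * p.a 2 1 * w₀) = 2)
    (h1 : 0 < s₁ * L₁) (h2 : 0 < s₂ * L₂) (hτ : 0 < τ * (L₁ * L₂)) (R : ℝ) :
    ∀ᶠ ε in 𝓝[>] 0, ∀ z : ℝ × ℝ, ‖z‖ ≤ R → DarbouxGoodAt p ε z := by
  have hs : ∀ᶠ ε in 𝓝[>] 0, darbouxSqrt p ε ≠ 0 := by
    filter_upwards [hd] with ε hε
    rw [darbouxSqrt_of_nonneg hε.le]
    exact_mod_cast (Real.sqrt_pos.2 hε).ne'
  have hm : (1 - 3 * p.a 2 1 * w₀ : ℝ) ≠ 0 := fun h => by rw [h] at hL1; norm_num at hL1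
  have hm' : (1 + 3 * p.a 2 1 * w₀ : ℝ) ≠ 0 := fun h => by rw [h] at hL2; norm_num at hL2
  have hn : ∀ σ : ℝ, σ = 1 ∨ σ = -1 → (1 : ℂ) + σ * (3 * p.a 2 1 * w₀) ≠ 0 := by
    rintro σ (rfl | rfl)
    · have : (1 : ℂ) + (1 : ℝ) * (3 * p.a 2 1 * w₀) = ((1 + 3 * p.a 2 1 * w₀ : ℝ) : ℂ) := by
        push_cast; ring
      rw [this]
      exact_mod_cast hm'
    · have : (1 : ℂ) + (-1 : ℝ) * (3 * p.a 2 1 * w₀) = ((1 - 3 * p.a 2 1 * w₀ : ℝ) : ℂ) := by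
        push_cast; ring
      rw [this]
      exact_mod_cast hm
  have hL10 : L₁ ≠ 0 := right_ne_zero_of_mul h1.ne'
  have hL20 : L₂ ≠ 0 := right_ne_zero_of_mul h2.ne'
  have e1 : -(2 * ((1 : ℝ) : ℂ)) / (1 - (1 : ℝ) * (3 * p.a 2 1 * w₀)) = (L₁ : ℂ) := by
    have : L₁ = -(2 * 1) / (1 - 1 * (3 * p.a 2 1 * w₀)) := by
      rw [eq_div_iff (by simpa using hm)]; linarith
    rw [this]; push_cast; rfl
  have e2 : -(2 * ((-1 : ℝ) : ℂ)) / (1 - (-1 : ℝ) * (3 * p.a 2 1 * w₀)) = (L₂ : ℂ) := by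
    have : L₂ = -(2 * (-1)) / (1 - (-1) * (3 * p.a 2 1 * w₀)) := by
      rw [eq_div_iff (by simpa using hm')]; linarith
    rw [this]; push_cast; rfl
  have hS := tendsto_mul_darbouxSqrt p
  have hP1 := eventually_mul_darbouxP hw hS hs hn (Or.inl rfl) R (abs_pos.2 hL10)
  have hP2 := eventually_mul_darbouxP hw hS hs hn (Or.inr rfl) R (abs_pos.2 hL20)
  rw [e1] at hP1
  rw [e2] at hP2
  filter_upwards [hP1, hP2, hd, self_mem_nhdsWithin, eventually_darbouxRegular hw hs hn]
    with ε hP1 hP2 hd hε hreg z hz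
  have hk : 0 < ε * √(darbouxDisc p ε) := mul_pos hε (Real.sqrt_pos.2 hd)
  have hsq := darbouxSqrt_of_nonneg hd.le
  have hconj : conj (darbouxSqrt p ε) = (1 : ℝ) * darbouxSqrt p ε := by
    rw [hsq, Complex.conj_ofReal]; simp
  have hPr : ∀ σ, darbouxP p ε σ z = ((darbouxP p ε σ z).re : ℂ) := fun σ =>
    (Complex.conj_eq_iff_re.1 (by rw [conj_darbouxP (Or.inl rfl) hconj, one_mul])).symm
  have hNr : ∀ σ, darbouxN p ε σ = ((darbouxN p ε σ).re : ℂ) := fun σ =>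
    (Complex.conj_eq_iff_re.1 (by rw [conj_darbouxN (Or.inl rfl) hconj, one_mul])).symm
  have q1 := hP1 z hz
  have q2 := hP2 z hz
  rw [hPr, hsq, ← Complex.ofReal_mul] at q1 q2
  have r1 := mul_pos_of_norm_sub_lt hk q1
  have r2 := mul_pos_of_norm_sub_lt hk q2
  have hpos : ∀ {s L r : ℝ}, 0 < s * L → 0 < L * r → 0 < s * r := fun {s L r} h h' => by
    have : 0 < (s * r) * (L ^ 2) := by
      have := mul_pos h h'
      linarith [show s * L * (L * r) = s * r * L ^ 2 by ring]
    exact pos_of_mul_pos_left this (sq_nonneg _)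
  refine hp.goodAt_of_real hreg (hF ε) (hPr 1) (hPr (-1)) (hNr 1) (hNr (-1)) (hpos h1 r1)
    (hpos h2 r2) (hpos hτ ?_)
  have := mul_pos r1 r2
  linarith [mul_mul_mul_comm L₁ (darbouxP p ε 1 z).re L₂ (darbouxP p ε (-1) z).re]

theorem DarbouxForm.eventually_goodAt_of_pos (hp : DarbouxForm p) (h : 0 < p.a 0 3) (R : ℝ) :
    ∀ᶠ ε in 𝓝[>] 0, ∀ z : ℝ × ℝ, ‖z‖ ≤ R → DarbouxGoodAt p ε z := by
  have hd : ∀ᶠ ε in 𝓝[>] 0, darbouxDisc p ε < 0 := by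
    filter_upwards [(tendsto_mul_darbouxDisc p).eventually_lt_const (by linarith : _ < (0 : ℝ)),
      self_mem_nhdsWithin] with ε h1 h2
    exact neg_of_mul_neg_right h1 (le_of_lt h2)
  have hs : ∀ᶠ ε in 𝓝[>] 0, darbouxSqrt p ε ≠ 0 := by
    filter_upwards [hd] with ε hε h0
    have := darbouxSqrt_sq p ε
    rw [h0, zero_pow two_ne_zero] at this
    exact hε.ne (by exact_mod_cast this.symm)
  have hw := tendsto_inv_darbouxSqrt h.ne'
  have hn : ∀ σ : ℝ, σ = 1 ∨ σ = -1 → (1 : ℂ) + σ * (3 * p.a 2 1 * 0) ≠ 0 := by simp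
  have hP1 := eventually_mul_darbouxP hw (tendsto_mul_darbouxSqrt p) hs hn (Or.inl rfl) R two_pos
  filter_upwards [hP1, hd, self_mem_nhdsWithin, eventually_darbouxRegular hw hs hn]
    with ε hP1 hd hε hreg z hz
  have hk : 0 < ε * √(-darbouxDisc p ε) := mul_pos hε (Real.sqrt_pos.2 (neg_pos.2 hd))
  have hsq := darbouxSqrt_of_nonpos hd.le
  have hconj : conj (darbouxSqrt p ε) = (-1 : ℝ) * darbouxSqrt p ε := by
    rw [hsq]; simp
  refine hp.goodAt_of_conj hreg (fun z => by rw [darboux, if_pos (Or.inl h)])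
    (by rw [conj_darbouxP (Or.inr rfl) hconj, mul_one])
    (by rw [conj_darbouxN (Or.inr rfl) hconj, mul_one]) ?_
  have q1 := (Complex.abs_re_le_norm _).trans_lt (hP1 z hz)
  rw [hsq, ← mul_assoc, ← Complex.ofReal_mul] at q1
  rw [Complex.mem_slitPlane_iff]
  -- √Δ is purely imaginary: were P₁ real, ε√Δ P₁ would have real part 0 and could not be closer
  -- than 2 to −2.
  refine Or.inr fun him => ?_
  simp [him] at q1

theorem DarbouxForm.eventually_goodAt (hp : DarbouxForm p) (R : ℝ) :
    ∀ᶠ ε in 𝓝[>] 0, ∀ z : ℝ × ℝ, ‖z‖ ≤ R → DarbouxGoodAt p ε z := by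
  rcases lt_trichotomy (p.a 0 3) 0 with h | h | h
  · have hd : ∀ᶠ ε in 𝓝[>] 0, 0 < darbouxDisc p ε := by
      filter_upwards [(tendsto_mul_darbouxDisc p).eventually_const_lt
        (by linarith : (0 : ℝ) < _), self_mem_nhdsWithin] with ε h1 h2
      exact pos_of_mul_pos_right h1 (le_of_lt h2)
    -- For a₀₃ < 0 the limits of ε√Δ P₁ and ε√Δ P₂ are −2 and 2; their opposite signs require τ =
    -- −1.
    refine hp.eventually_goodAt_of_real (w₀ := 0) (s₁ := -1) (s₂ := 1) (τ := -1) (L₁ := -2)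
      (L₂ := 2) (by simpa using tendsto_inv_darbouxSqrt h.ne) hd (fun ε z => ?_) (by norm_num)
      (by norm_num) (by norm_num) (by norm_num) (by norm_num) R
    rw [darboux, if_neg (by rintro (h1 | ⟨h1, -⟩) <;> linarith), if_pos h]
    simp
  -- For a₀₃ = 0 the root √Δ = |a₂₁| is constant and 3a₂₁w₀ = ±3: the limits are −1/2, −1 for a₂₁ <
  -- 0 and 1, 1/2 for a₂₁ > 0.
  · have hdisc : ∀ ε, darbouxDisc p ε = p.a 2 1 ^ 2 := fun ε => by simp [darbouxDisc, h]
    have hd : ∀ᶠ ε in 𝓝[>] (0 : ℝ), 0 < darbouxDisc p ε :=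
      Eventually.of_forall fun ε => by rw [hdisc]; have := hp.a21; positivity
    have hw : Tendsto (fun ε => (darbouxSqrt p ε)⁻¹) (𝓝[>] 0) (𝓝 ((|p.a 2 1|⁻¹ : ℝ) : ℂ)) := by
      have : ∀ ε, (darbouxSqrt p ε)⁻¹ = ((|p.a 2 1|⁻¹ : ℝ) : ℂ) := fun ε => by
        rw [darbouxSqrt_of_nonneg (by rw [hdisc]; positivity), hdisc, Real.sqrt_sq_eq_abs]
        push_cast
        rfl
      simp only [this]
      exact tendsto_const_nhds
    rcases lt_or_gt_of_ne hp.a21 with h' | h'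
    · have e : p.a 2 1 * |p.a 2 1|⁻¹ = -1 := by
        rw [abs_of_neg h', inv_neg, mul_neg, mul_inv_cancel₀ hp.a21]
      refine hp.eventually_goodAt_of_real (s₁ := -1) (s₂ := -1) (τ := 1) (L₁ := -(1 / 2))
        (L₂ := -1) hw hd (fun ε z => ?_) (by linear_combination (3 / 2) * e)
        (by linear_combination (-3) * e) (by norm_num) (by norm_num) (by norm_num) R
      rw [darboux, if_neg (by rintro (h1 | ⟨-, h1⟩) <;> linarith), if_neg h.not_lt]
      simp
    · have e : p.a 2 1 * |p.a 2 1|⁻¹ = 1 := by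
        rw [abs_of_pos h', mul_inv_cancel₀ hp.a21]
      refine hp.eventually_goodAt_of_real (s₁ := 1) (s₂ := 1) (τ := 1) (L₁ := 1)
        (L₂ := 1 / 2) hw hd (fun ε z => ?_) (by linear_combination (-3) * e)
        (by linear_combination (3 / 2) * e) (by norm_num) (by norm_num) (by norm_num) R
      rw [darboux, if_pos (Or.inr ⟨h, h'⟩)]
      simp
  · exact hp.eventually_goodAt_of_pos h R

end

/-! ### The stratum reversible in x for all small ε -/

/-- The perturbation obtained by the symmetry `(x, y, t, ε) ↦ (x, -y, -t, -ε)`. -/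
def CubicPerturbation.flip (p : CubicPerturbation) : CubicPerturbation where
  a i j := (-1) ^ j * p.a i j
  b i j := -((-1) ^ j * p.b i j)

namespace CubicPerturbation

variable (p : CubicPerturbation)

theorem flip_f (x y : ℝ) : p.flip.f x y = p.f x (-y) := by
  simp only [f_eq, flip]; ring

theorem flip_g (x y : ℝ) : p.flip.g x y = -p.g x (-y) := by
  simp only [g_eq, flip]; ring

theorem flip_field (ε : ℝ) (z : ℝ × ℝ) :
    p.flip.field (-ε) (z.1, -z.2) = (-(p.field ε z).1, (p.field ε z).2) := by
  ext
  · simp only [field, flip_f, neg_neg]; ring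
  · simp only [field, flip_g, neg_neg]; ring

end CubicPerturbation

namespace DarbouxForm

variable {p : CubicPerturbation}

theorem flip (hp : DarbouxForm p) : DarbouxForm p.flip where
  f_eq x y := by
    rw [p.flip_f, hp.f_eq]
    simp only [CubicPerturbation.flip]
    ring
  g_eq x y := by
    rw [p.flip_g, hp.g_eq]
    simp only [CubicPerturbation.flip]
    ring
  b30 := by simp [CubicPerturbation.flip, hp.b30]
  a21 := by simpa [CubicPerturbation.flip] using hp.a21

/-- The Darboux function is available for ε > 0 only. For ε < 0 the integral of the flipped system
at −ε is pulled back; y and t are both reversed, so κ stays positive. At ε = 0 the integral is H. -/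
theorem hasLocalIntegral (hp : DarbouxForm p) : HasLocalIntegral p := by
  have hball : ∀ z ∈ Metric.ball ((1, 0) : ℝ × ℝ) 1, ‖z‖ ≤ 2 := fun z hz => by
    have h1 : ‖z - (1, 0)‖ < 1 := by simpa [dist_eq_norm] using hz
    have h2 : ‖((1, 0) : ℝ × ℝ)‖ ≤ 1 := by simp [Prod.norm_def]
    have h3 : z = (z - (1, 0)) + (1, 0) := by simp
    calc ‖z‖ = ‖(z - (1, 0)) + (1, 0)‖ := by rw [← h3]
      _ ≤ ‖z - (1, 0)‖ + ‖((1, 0) : ℝ × ℝ)‖ := norm_add_le _ _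
      _ ≤ 2 := by linarith
  refine ⟨1, one_pos, ?_⟩
  rw [← nhdsNE_sup_pure, ← nhdsLT_sup_nhdsGT, eventually_sup, eventually_sup, eventually_pure]
  refine ⟨⟨?_, ?_⟩, ?_⟩
  · have hneg : Tendsto (fun ε : ℝ => -ε) (𝓝[<] 0) (𝓝[>] 0) := by
      simpa using tendsto_neg_nhdsLT (a := (0 : ℝ))
    filter_upwards [hneg.eventually (hp.flip.eventually_goodAt 2)] with ε hε
    refine ⟨fun z => (darboux p.flip (-ε) (z.1, -z.2)).re, fun z hz => ?_⟩
    have hn : ‖((z.1, -z.2) : ℝ × ℝ)‖ ≤ 2 := by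
      simpa [Prod.norm_def] using hball z hz
    obtain ⟨-, hA, κ, hκ, hd⟩ := hε _ hn
    have hin : AnalyticAt ℝ (fun z : ℝ × ℝ => ((z.1, -z.2) : ℝ × ℝ)) z :=
      analyticAt_fst.prod analyticAt_snd.neg
    have hG : AnalyticAt ℝ (fun z : ℝ × ℝ => (darboux p.flip (-ε) (z.1, -z.2)).re) z :=
      AnalyticAt.comp (g := fun z => (darboux p.flip (-ε) z).re) hA hin
    refine ⟨hG, κ, hκ, fun v => fderiv_eq_of_line hG.differentiableAt ?_⟩
    have hl := (hasDerivAt_line z.1 v.1).prodMk (hasDerivAt_line z.2 v.2).neg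
    refine (HasFDerivAt.comp_hasDerivAt (l := fun z => (darboux p.flip (-ε) z).re)
      (f := fun s : ℝ => ((z.1 + s * v.1, -(z.2 + s * v.2)) : ℝ × ℝ)) 0
      (by simpa using hA.differentiableAt.hasFDerivAt) hl).congr_deriv ?_
    rw [hd, p.flip_field]
    ring
  · filter_upwards [hp.eventually_goodAt 2] with ε hε
    exact ⟨_, fun z hz => (hε z (hball z hz)).2⟩
  · refine ⟨fun z => Ham z.1 z.2 - 0 * primQ p z.1 z.2, fun z _ => ⟨analyticAt_Ham_sub p 0 z, 1,
      one_pos, fun v => fderiv_eq_of_line (analyticAt_Ham_sub p 0 z).differentiableAt ?_⟩⟩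
    simp only [zero_mul, sub_zero]
    refine (hasDerivAt_Ham (hasDerivAt_line z.1 v.1) (hasDerivAt_line z.2 v.2)).congr_deriv ?_
    simp [CubicPerturbation.field]
    ring

theorem isReversibleInX (hp : DarbouxForm p) : IsReversibleInX p := fun ε x y => by
  simp only [hp.field_eq]
  ext
  · simp only; ring
  · simp only; ring

theorem field_eq_zero (hp : DarbouxForm p) (ε : ℝ) {s : ℝ} (hs : s = 1 ∨ s = -1) :
    p.field ε (s, 0) = 0 := by
  rw [hp.field_eq]
  rcases hs with rfl | rfl <;> norm_num

theorem isAnalyticFirstIntegral (hp : DarbouxForm p) {K : Set (ℝ × ℝ)}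
    (hK : Bornology.IsBounded K) : ∀ᶠ ε in 𝓝[>] (0 : ℝ), (∀ z ∈ K, (darboux p ε z).im = 0) ∧
      IsAnalyticFirstIntegral (p.field ε) K (fun z => (darboux p ε z).re) := by
  obtain ⟨R, hR⟩ := hK.exists_norm_le
  filter_upwards [hp.eventually_goodAt R,
    (CubicPerturbation.eventually_mul_ne_one (p.b 3 0)).filter_mono nhdsWithin_le_nhds]
    with ε hε h3
  exact ⟨fun z hz => (hε z (hR z hz)).1, isAnalyticFirstIntegral_of_fderiv h3
    (fun z hz => (hε z (hR z hz)).2.1) fun z hz => (hε z (hR z hz)).2.2⟩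

end DarbouxForm

/-! ### The three strata -/

section Strata

variable {p : CubicPerturbation} (h1 : Vanish p 1) (h2 : Vanish p 2) (h3 : Vanish p 3)
  (h4 : Vanish p 4)

-- Let (λ, μ) ≠ 0. If c = 0, the vanishing of M₁ and M₂ makes the system reversible in y. If λ = 0
-- and c ≠ 0, then m ≠ 0 and the conditions for M₃ = 0 give the Darboux form. If λ ≠ 0 and c ≠ 0,
-- then M₄ would not vanish.
include h1 h2 h3 h4 in
theorem strata_of_vanish : (M1Condition p ∧ p.lam = 0 ∧ p.mu = 0) ∨ ReversibleCoefficients p ∨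
    DarbouxForm p := by
  obtain ⟨hp, h | hc⟩ := trivial_or_nontrivial h1 h2
  · exact Or.inl ⟨hp, h⟩
  by_cases ht : p.lam = 0 ∧ p.mu = 0
  · exact Or.inl ⟨hp, ht⟩
  right
  obtain ⟨e01, e03, e11, e21⟩ := M1Condition_iff.1 hp
  obtain ⟨h02, h12, h00, h30, hβ, hγ⟩ := hc
  by_cases hl : p.lam = 0
  · have hmu : p.mu ≠ 0 := fun h => ht ⟨hl, h⟩
    have c30 := (mul_eq_zero.1 h30).resolve_right hmu
    rw [hl] at hβ hγ
    have c10 := (mul_eq_zero.1 (show p.a 1 0 * p.mu = 0 by linarith)).resolve_right hmu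
    have c20 := (mul_eq_zero.1 (show (p.a 0 0 + p.a 2 0) * p.mu = 0 by linarith)).resolve_right hmu
    by_cases c00 : p.a 0 0 = 0
    · left
      constructor <;> linarith
    · right
      have hm : p.m ≠ 0 := by
        rw [CubicPerturbation.m, hl, mul_zero, add_zero]
        exact mul_ne_zero two_ne_zero (mul_ne_zero c00 hmu)
      obtain ⟨b00, b20, b30, a11, a21⟩ := (M_three_eq_zero_iff h1 h2 hm).1 h3.1
      have c11 : p.a 1 1 = 0 := by linarith
      have hl' := hl
      have hmu' : p.mu = p.a 2 1 + p.b 1 2 := rfl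
      rw [CubicPerturbation.lam, c11] at hl'
      have c02 : p.b 0 2 = 0 := by linarith
      have c12 : p.b 1 2 = 2 * p.a 2 1 := by linarith
      have d11 : p.b 1 1 = 2 * p.a 0 0 := by linarith
      have d01 : p.b 0 1 = 0 := by linarith
      have d03 : p.b 0 3 = 0 := by linarith
      have d21 : p.b 2 1 = 0 := by linarith
      have d30 : p.b 3 0 = -p.b 1 0 := by linarith
      have c20' : p.a 2 0 = -p.a 0 0 := by linarith
      refine ⟨fun x y => ?_, fun x y => ?_, d30, fun h => hmu (by linarith)⟩
      · rw [p.f_eq, c10, c20', c30, c11, h02, h12]; ring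
      · rw [p.g_eq, b00, b20, c02, c12, d11, d01, d03, d21, d30]; ring
  · have c00 := (mul_eq_zero.1 h00).resolve_right hl
    by_cases c10 : p.a 1 0 = 0
    · left
      rw [c10] at hβ hγ
      have c20 := (mul_eq_zero.1 (show p.a 2 0 * p.lam = 0 by linarith)).resolve_right hl
      rw [c00, c20] at hβ
      have c30 := (mul_eq_zero.1 (show p.a 3 0 * p.lam = 0 by linarith)).resolve_right hl
      constructor <;> linarith
    -- Here a₁₀λ ≠ 0, and either μ = 0 or μ = ±λ by the equations for M₂, so M₄ is a nonzero
    -- multiple of a combination of independent functions.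
    · exfalso
      have hne : 6 * p.a 1 0 ^ 3 * p.lam ≠ 0 :=
        mul_ne_zero (mul_ne_zero (by norm_num) (pow_ne_zero 3 c10)) hl
      by_cases hmu : p.mu = 0
      · refine hne (linearIndependent_I 0 0 (6 * p.a 1 0 ^ 3 * p.lam * (1 / 4))
          (6 * p.a 1 0 ^ 3 * p.lam) 0 0 fun h hh => ?_).2.2.2.1
        have := h4.1 h hh
        rw [M_four_of_mu_eq_zero h1 h2 h3 hh hmu] at this
        linear_combination this
      · have c30 := (mul_eq_zero.1 h30).resolve_right hmu
        rw [c30, c00] at hβ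
        have hs : p.a 1 0 * (p.lam ^ 2 - p.mu ^ 2) = 0 := by
          linear_combination p.lam * hβ - p.mu * hγ
        have hs' := (mul_eq_zero.1 hs).resolve_left c10
        have hs2 : (p.mu / p.lam) ^ 2 = 1 := by
          field_simp
          linarith
        refine hne (linearIndependent_I 0 0 (6 * p.a 1 0 ^ 3 * p.lam) 0
          (-(6 * p.a 1 0 ^ 3 * p.lam * (p.mu / p.lam))) 0 fun h hh => ?_).2.2.1
        have := h4.1 h hh
        rw [M_four_of_mu_eq h1 h2 h3 hh hs2 (by field_simp)] at this
        linear_combination this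

include h1 h2 h3 h4 in
theorem hasLocalIntegral_of_vanish : HasLocalIntegral p := by
  rcases strata_of_vanish h1 h2 h3 h4 with ⟨hp, hl, hmu⟩ | hp | hp
  · exact hasLocalIntegral_of_hamiltonian hp hl hmu
  · exact hp.hasLocalIntegral
  · exact hp.hasLocalIntegral

include h1 h2 h3 h4 in
theorem hasLocalIntegral_reflect_of_vanish : HasLocalIntegral p.reflect :=
  hasLocalIntegral_of_vanish (vanish_reflect h1) (vanish_reflect h2) (vanish_reflect h3)
    (vanish_reflect h4)

include h1 h2 h3 h4 in
theorem isIntegrableNear_of_vanish : IsIntegrableNear p (1, 0) ∧ IsIntegrableNear p (-1, 0) := by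
  refine ⟨(hasLocalIntegral_of_vanish h1 h2 h3 h4).isIntegrableNear, ?_⟩
  have h := (hasLocalIntegral_reflect_of_vanish h1 h2 h3 h4).isIntegrableNear.reflect
  rw [p.reflect_reflect] at h
  simpa using h

include h1 h2 h3 h4 in
theorem eventually_isCenter_of_darbouxForm (hp : DarbouxForm p) :
    ∀ᶠ ε in 𝓝 (0 : ℝ), IsCenter (p.field ε) (1, 0) ∧ IsCenter (p.field ε) (-1, 0) := by
  obtain ⟨ρ, hρ, H⟩ := (hasLocalIntegral_of_vanish h1 h2 h3 h4).eventually_isCenter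
  obtain ⟨ρ', hρ', H'⟩ := (hasLocalIntegral_reflect_of_vanish h1 h2 h3 h4).eventually_isCenter
  filter_upwards [H, H'] with ε hε hε'
  refine ⟨hε _ (Metric.mem_ball_self hρ) (hp.field_eq_zero ε (Or.inl rfl)), ?_⟩
  have h0 : p.reflect.field ε (1, 0) = 0 := by
    have := hp.field_eq_zero ε (s := -1) (Or.inr rfl)
    rw [p.reflect_field]
    simpa using this
  have h := (hε' _ (Metric.mem_ball_self hρ') h0).reflect
  rw [p.reflect_reflect] at h
  simpa using h

end Strata

end EightLoop

end

theorem theorem1 :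
    -- the six functions that occur below are linearly independent on `Σ`
    (∀ α₀ α₁ β₀ β₁ γ₀ γ₁ : ℝ,
      (∀ h ∈ EightLoop.Sig, (α₀ + α₁ * h) * EightLoop.I 0 h + (β₀ + β₁ * h) * EightLoop.I 1 h
        + (γ₀ + γ₁ * h) * EightLoop.I 2 h = 0) →
      α₀ = 0 ∧ α₁ = 0 ∧ β₀ = 0 ∧ β₁ = 0 ∧ γ₀ = 0 ∧ γ₁ = 0) ∧
    (∀ p : EightLoop.CubicPerturbation,
      -- the displacement maps are defined for small `ε`, with convergent expansions
      (∀ h ∈ EightLoop.Sig,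
        (∀ᶠ ε in 𝓝 (0 : ℝ), (∃ h', EightLoop.IsFirstReturn p 1 ε h h') ∧
          HasSum (fun k : ℕ => ε ^ (k + 1) * EightLoop.M p (k + 1) h)
            (EightLoop.displacement p 1 h ε)) ∧
        (∀ᶠ ε in 𝓝 (0 : ℝ), (∃ h', EightLoop.IsFirstReturn p (-1) ε h h') ∧
          HasSum (fun k : ℕ => ε ^ (k + 1) * EightLoop.Mstar p (k + 1) h)
            (EightLoop.displacement p (-1) h ε))) ∧
      -- (i)
      (∃ α₀ α₁ β₀ γ₀ : ℝ,
        α₀ = p.a 1 0 + p.b 0 1 ∧ α₁ = 4 / 7 * (p.a 1 2 + 3 * p.b 0 3) ∧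
        β₀ = 2 * p.a 2 0 + p.b 1 1 ∧
        γ₀ = 3 * p.a 3 0 + p.b 2 1 + 1 / 7 * (p.a 1 2 + 3 * p.b 0 3) ∧
        (∀ h ∈ EightLoop.Sig,
          EightLoop.M p 1 h = (α₀ + α₁ * h) * EightLoop.I 0 h + β₀ * EightLoop.I 1 h
            + γ₀ * EightLoop.I 2 h ∧
          EightLoop.Mstar p 1 h = (α₀ + α₁ * h) * EightLoop.I 0 h - β₀ * EightLoop.I 1 h
            + γ₀ * EightLoop.I 2 h)) ∧
      ((∀ h ∈ EightLoop.Sig, EightLoop.M p 1 h = 0) ↔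
        p.a 1 0 + p.b 0 1 = 0 ∧ p.a 1 2 + 3 * p.b 0 3 = 0 ∧ 2 * p.a 2 0 + p.b 1 1 = 0 ∧
          3 * p.a 3 0 + p.b 2 1 = 0) ∧
      ((∀ h ∈ EightLoop.Sig, EightLoop.Mstar p 1 h = 0) ↔
        p.a 1 0 + p.b 0 1 = 0 ∧ p.a 1 2 + 3 * p.b 0 3 = 0 ∧ 2 * p.a 2 0 + p.b 1 1 = 0 ∧
          3 * p.a 3 0 + p.b 2 1 = 0) ∧
      -- (ii)
      (EightLoop.Vanish p 1 →
        (∃ α₀ α₁ β₀ β₁ γ₀ γ₁ : ℝ,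
          α₀ = -2 * p.a 0 0 * p.lam ∧
          α₁ = -(8 / 7) * p.a 0 2 * p.lam - (8 / 7 * p.a 3 0 + 8 / 63 * p.a 1 2) * p.mu ∧
          β₀ = -2 * (p.a 1 0 + p.a 3 0 + 1 / 8 * p.a 1 2) * p.lam
            - 2 * (p.a 0 0 + p.a 2 0 + 1 / 8 * p.a 0 2) * p.mu ∧
          β₁ = -p.a 1 2 * p.lam - p.a 0 2 * p.mu ∧
          γ₀ = -2 * (p.a 2 0 + 1 / 7 * p.a 0 2) * p.lam
            - 2 * (p.a 1 0 + 8 / 7 * p.a 3 0 + 8 / 63 * p.a 1 2) * p.mu ∧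
          γ₁ = -(8 / 9) * p.a 1 2 * p.mu ∧
          (∀ h ∈ EightLoop.Sig,
            EightLoop.M p 2 h = (α₀ + α₁ * h) * EightLoop.I 0 h
              + (β₀ + β₁ * h) * EightLoop.I 1 h + (γ₀ + γ₁ * h) * EightLoop.I 2 h ∧
            EightLoop.Mstar p 2 h = (α₀ + α₁ * h) * EightLoop.I 0 h
              - (β₀ + β₁ * h) * EightLoop.I 1 h + (γ₀ + γ₁ * h) * EightLoop.I 2 h)) ∧
        ((∀ h ∈ EightLoop.Sig, EightLoop.M p 2 h = 0) ↔ EightLoop.M2Condition p) ∧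
        ((∀ h ∈ EightLoop.Sig, EightLoop.Mstar p 2 h = 0) ↔ EightLoop.M2Condition p)) ∧
      -- (iii)
      (EightLoop.Vanish p 1 → EightLoop.Vanish p 2 →
        (∃ α₀ α₁ β₀ β₁ γ₀ : ℝ,
          α₀ = p.m * p.b 0 0 ∧ α₁ = p.m * (4 / 7 * p.lam - 6 / 7 * p.a 1 1) ∧
          β₀ = p.m * (p.b 1 0 + p.b 3 0 + 1 / 8 * p.mu - 3 / 8 * p.a 2 1) ∧
          β₁ = p.m * (1 / 2 * p.mu - 3 / 2 * p.a 2 1) ∧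
          γ₀ = p.m * (p.b 2 0 + 1 / 7 * p.lam - 3 / 14 * p.a 1 1) ∧
          (∀ h ∈ EightLoop.Sig,
            EightLoop.M p 3 h = (α₀ + α₁ * h) * EightLoop.I 0 h
              + (β₀ + β₁ * h) * EightLoop.I 1 h + γ₀ * EightLoop.I 2 h ∧
            EightLoop.Mstar p 3 h = (α₀ + α₁ * h) * EightLoop.I 0 h
              - (β₀ + β₁ * h) * EightLoop.I 1 h + γ₀ * EightLoop.I 2 h)) ∧
        (p.m ≠ 0 →
          ((∀ h ∈ EightLoop.Sig, EightLoop.M p 3 h = 0) ↔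
            p.b 0 0 = 0 ∧ p.b 2 0 = 0 ∧ p.b 1 0 + p.b 3 0 = 0 ∧
              2 * p.lam - 3 * p.a 1 1 = 0 ∧ p.mu - 3 * p.a 2 1 = 0) ∧
          ((∀ h ∈ EightLoop.Sig, EightLoop.Mstar p 3 h = 0) ↔
            p.b 0 0 = 0 ∧ p.b 2 0 = 0 ∧ p.b 1 0 + p.b 3 0 = 0 ∧
              2 * p.lam - 3 * p.a 1 1 = 0 ∧ p.mu - 3 * p.a 2 1 = 0))) ∧
      -- (iv)
      (EightLoop.Vanish p 1 → EightLoop.Vanish p 2 → EightLoop.Vanish p 3 →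
        (p.lam = 0 → ∀ h ∈ EightLoop.Sig, EightLoop.M p 4 h = 0 ∧ EightLoop.Mstar p 4 h = 0) ∧
        (p.mu = 0 → ∀ h ∈ EightLoop.Sig,
          EightLoop.M p 4 h = 6 * p.a 1 0 ^ 3 * p.lam * (1 / 4 + h) * EightLoop.I 1 h ∧
          EightLoop.Mstar p 4 h = -6 * p.a 1 0 ^ 3 * p.lam * (1 / 4 + h) * EightLoop.I 1 h) ∧
        (p.mu = p.lam → ∀ h ∈ EightLoop.Sig,
          EightLoop.M p 4 h = 6 * p.a 1 0 ^ 3 * p.lam * (EightLoop.I 1 h - EightLoop.I 2 h) ∧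
          EightLoop.Mstar p 4 h =
            -6 * p.a 1 0 ^ 3 * p.lam * (EightLoop.I 1 h + EightLoop.I 2 h)) ∧
        (p.mu = -p.lam → ∀ h ∈ EightLoop.Sig,
          EightLoop.M p 4 h = 6 * p.a 1 0 ^ 3 * p.lam * (EightLoop.I 1 h + EightLoop.I 2 h) ∧
          EightLoop.Mstar p 4 h =
            -6 * p.a 1 0 ^ 3 * p.lam * (EightLoop.I 1 h - EightLoop.I 2 h)) ∧
        (p.lam * p.mu * (p.lam ^ 2 - p.mu ^ 2) ≠ 0 →
          ∀ h ∈ EightLoop.Sig, EightLoop.M p 4 h = 0 ∧ EightLoop.Mstar p 4 h = 0)) ∧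
      -- (v)
      (EightLoop.Vanish p 1 → EightLoop.Vanish p 2 → EightLoop.Vanish p 3 →
        EightLoop.Vanish p 4 →
        EightLoop.IsIntegrableNear p (1, 0) ∧ EightLoop.IsIntegrableNear p (-1, 0) ∧
        (EightLoop.IsHamiltonian p ∨ EightLoop.IsReversibleInY p ∨
          (EightLoop.IsReversibleInX p ∧
            (∀ x y, p.f x y =
                p.a 0 0 * (1 - x ^ 2) + p.a 0 1 * y + p.a 2 1 * x ^ 2 * y + p.a 0 3 * y ^ 3 ∧
              p.g x y =
                p.b 1 0 * (x - x ^ 3) + 2 * p.a 0 0 * x * y + 2 * p.a 2 1 * x * y ^ 2) ∧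
            p.a 2 1 ≠ 0 ∧
            (∀ᶠ ε in 𝓝 (0 : ℝ), EightLoop.IsCenter (p.field ε) (1, 0) ∧
              EightLoop.IsCenter (p.field ε) (-1, 0)) ∧
            (∀ K : Set (ℝ × ℝ), Bornology.IsBounded K → ∀ᶠ ε in 𝓝[>] (0 : ℝ),
              (∀ z ∈ K, (EightLoop.darboux p ε z).im = 0) ∧
              EightLoop.IsAnalyticFirstIntegral (p.field ε) K
                (fun z => (EightLoop.darboux p ε z).re)))))) ∧
    -- all the coefficients in the above forms of `M₁`, `M₂`, `M₃`, `M₄` are free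
    (∀ α₀ α₁ β₀ γ₀ : ℝ, ∃ p : EightLoop.CubicPerturbation, ∀ h ∈ EightLoop.Sig,
      EightLoop.M p 1 h = (α₀ + α₁ * h) * EightLoop.I 0 h + β₀ * EightLoop.I 1 h
        + γ₀ * EightLoop.I 2 h) ∧
    (∀ α₀ α₁ β₀ β₁ γ₀ γ₁ : ℝ, ∃ p : EightLoop.CubicPerturbation, EightLoop.Vanish p 1 ∧
      ∀ h ∈ EightLoop.Sig, EightLoop.M p 2 h = (α₀ + α₁ * h) * EightLoop.I 0 h
        + (β₀ + β₁ * h) * EightLoop.I 1 h + (γ₀ + γ₁ * h) * EightLoop.I 2 h) ∧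
    (∀ α₀ α₁ β₀ β₁ γ₀ : ℝ, ∃ p : EightLoop.CubicPerturbation, EightLoop.Vanish p 1 ∧
      EightLoop.Vanish p 2 ∧ p.m ≠ 0 ∧
      ∀ h ∈ EightLoop.Sig, EightLoop.M p 3 h = (α₀ + α₁ * h) * EightLoop.I 0 h
        + (β₀ + β₁ * h) * EightLoop.I 1 h + γ₀ * EightLoop.I 2 h) ∧
    (∀ w ∈ ({fun h => (1 / 4 + h) * EightLoop.I 1 h, fun h => EightLoop.I 1 h - EightLoop.I 2 h,
        fun h => EightLoop.I 1 h + EightLoop.I 2 h} : Set (ℝ → ℝ)),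
      ∀ c : ℝ, ∃ p : EightLoop.CubicPerturbation, EightLoop.Vanish p 1 ∧ EightLoop.Vanish p 2 ∧
        EightLoop.Vanish p 3 ∧ ∀ h ∈ EightLoop.Sig, EightLoop.M p 4 h = c * w h) := by
  open EightLoop in
  refine ⟨linearIndependent_I, fun p => ⟨fun h hh => ⟨eventually_hasSum_displacement p hh,
    eventually_hasSum_displacement_star p hh⟩, ?_, ?_, ?_, fun h1 => ?_, fun h1 h2 => ?_,
    fun h1 h2 h3 => ?_, fun h1 h2 h3 h4 => ?_⟩, M_one_free, M_two_free, M_three_free, ?_⟩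
  · exact ⟨_, _, _, _, rfl, rfl, rfl, rfl, fun h hh => ⟨M_one p hh, Mstar_one p hh⟩⟩
  · rw [M_one_eq_zero_iff, M1Condition_iff]
  · rw [Mstar_one_eq_zero_iff, M1Condition_iff]
  · have hp := vanish_one_iff.1 h1
    exact ⟨⟨_, _, _, _, _, _, rfl, rfl, rfl, rfl, rfl, rfl, fun h hh =>
      ⟨M_two hp hh, Mstar_two hp hh⟩⟩, M_two_eq_zero_iff hp, Mstar_two_eq_zero_iff hp⟩
  · exact ⟨⟨_, _, _, _, _, rfl, rfl, rfl, rfl, rfl, fun h hh =>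
      ⟨M_three h1 h2 hh, Mstar_three h1 h2 hh⟩⟩, fun hm =>
      ⟨M_three_eq_zero_iff h1 h2 hm, Mstar_three_eq_zero_iff h1 h2 hm⟩⟩
  · refine ⟨fun hl h hh => ⟨M_four_of_lam_eq_zero h1 h2 h3 hh hl,
      Mstar_four_of_lam_eq_zero h1 h2 h3 hh hl⟩, fun hmu h hh =>
      ⟨M_four_of_mu_eq_zero h1 h2 h3 hh hmu, Mstar_four_of_mu_eq_zero h1 h2 h3 hh hmu⟩,
      fun hmu h hh => ?_, fun hmu h hh => ?_, fun hne h hh =>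
      ⟨M_four_generic h1 h2 h3 hh hne, Mstar_four_generic h1 h2 h3 hh hne⟩⟩
    · have hmu' : p.mu = 1 * p.lam := by rw [hmu, one_mul]
      rw [M_four_of_mu_eq h1 h2 h3 hh (one_pow 2) hmu',
        Mstar_four_of_mu_eq h1 h2 h3 hh (one_pow 2) hmu', one_mul]
      exact ⟨rfl, rfl⟩
    · have hmu' : p.mu = -1 * p.lam := by rw [hmu, neg_one_mul]
      rw [M_four_of_mu_eq h1 h2 h3 hh (by norm_num) hmu',
        Mstar_four_of_mu_eq h1 h2 h3 hh (by norm_num) hmu']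
      constructor <;> ring
  · obtain ⟨hi, hi'⟩ := isIntegrableNear_of_vanish h1 h2 h3 h4
    refine ⟨hi, hi', ?_⟩
    rcases strata_of_vanish h1 h2 h3 h4 with ⟨hp, hl, hmu⟩ | hp | hp
    · exact Or.inl (isHamiltonian_of_conditions hp hl hmu)
    · exact Or.inr (Or.inl hp.isReversibleInY)
    · exact Or.inr (Or.inr ⟨hp.isReversibleInX, fun x y => ⟨hp.f_eq x y, hp.g_eq x y⟩, hp.a21,
        eventually_isCenter_of_darbouxForm h1 h2 h3 h4 hp,
        fun K hK => hp.isAnalyticFirstIntegral hK⟩)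
  · rintro w (rfl | rfl | rfl) c
    · exact M_four_free_mu_eq_zero c
    · simpa only [one_mul] using M_four_free_mu_eq (one_pow 2) c
    · simpa only [neg_one_mul, sub_neg_eq_add] using
        M_four_free_mu_eq (s := -1) (by norm_num) c
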